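/- Let $\alpha,\beta>-1$, let $j\ge 1$ be an integer, $\gamma\in\mathbb{R}$, $M>0$, and let $\{M_n\}_{n\ge0}$ be nonnegative real numbers with $\lim_{n\to\infty}M_n n^{\gamma}=M$. For each $n$ let $Q_n$ be a polynomial of degree $n$ that is orthogonal to all polynomials of degree less than $n$ with respect to $$(f,g)_{S,n}=\int_{-1}^1 f(x)g(x)(1-x)^{\alpha}(1+x)^{\beta}\,dx+M_n f^{(j)}(1)g^{(j)}(1)$$ (such $Q_n$ is unique up to a nonzero constant factor). Let $J_\nu$ be the Bessel function of the first kind of order $\nu$. For a sequence $\theta=(\theta_i)_{i\ge 0}$ put $$F_{\theta}(x)=\sum_{i=0}^{j+1}b_i2^i\left(\frac x2\right)^{-\alpha}J_{\alpha+2i}(x),\qquad b_i=(-1)^i\,\frac{\theta_i-\Gamma(\alpha+i+1)\sum_{k=0}^{i-1}b_k\binom ik\frac{(-1)^kk!\,2^k}{\Gamma(\alpha+i+k+1)}}{i!\,\frac{2^i\Gamma(\alpha+i+1)}{\Gamma(\alpha+2i+1)}},\quad 0\le i\le j+1.$$ Let $D=\Gamma^2(\alpha+j+1)\,2^{\alpha+\beta+2j+1}(\alpha+2j+1)$;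 let $\varphi_{\alpha,j}=F_\theta$ with $\theta_i=\frac{i-j}{\alpha+j+i+1}$, and let $\psi_{\alpha,j}=F_\theta$ with $\theta_i=\frac{M(i-j)+D(\alpha+j+i+1)}{(\alpha+j+i+1)(M+D)}$. Put $$V=\frac{2^{\alpha+\beta+2j+1}(\alpha+j+1)(\alpha+2j+1)\Gamma^2(\alpha+j+1)}{j}.$$ Then, for every $n$, $Q_n$ has $n$ distinct real zeros $y_{n,1}>y_{n,2}>\dots>y_{n,n}$; each of the functions $J_\alpha$, $\varphi_{\alpha,j}$, $\psi_{\alpha,j}$ has, in the respective case below, an $i$-th positive zero (distinct zeros being numbered in increasing order) for every $i\ge1$, denoted $j_{\alpha,i}$, $s_{\alpha,i}$, $t_{\alpha,i}$ respectively; and the following hold. 1. If $\gamma>2(\alpha+2j+1)$, then $\lim_{n\to\infty}n\sqrt{2(1-y_{n,i})}=j_{\alpha,i}$ for all $i\ge1$. 2. If $\gamma<2(\alpha+2j+1)$, then $\lim_{n\to\infty}y_{n,1}=1$ and $\lim_{n\to\infty}n\sqrt{2(1-y_{n,i})}=s_{\alpha,i-1}$ for all $i\ge2$. 3. If $\gamma=2(\alpha+2j+1)$,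 then: (a) if $M<V$, then $y_{n,1}\le1$ for all sufficiently large $n$, and $\lim_{n\to\infty}n\sqrt{2(1-y_{n,i})}=t_{\alpha,i}$ for all $i\ge1$; (b) if $M>V$, then $\lim_{n\to\infty}y_{n,1}=1$ and $\lim_{n\to\infty}n\sqrt{2(1-y_{n,i})}=t_{\alpha,i-1}$ for all $i\ge2$; (c) if $M=V$, then $\lim_{n\to\infty}n\sqrt{2|1-y_{n,1}|}=0$ and $\lim_{n\to\infty}n\sqrt{2(1-y_{n,i})}=t_{\alpha,i-1}$ for all $i\ge2$. -/

import Mathlib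

open Polynomial Filter Topology Set

noncomputable section

/-- The discrete Jacobi-Sobolev bilinear form
`∫_{-1}^{1} p q (1-x)^α (1+x)^β dx + m p^{(j)}(1) q^{(j)}(1)` on real polynomials. -/
def jacobiSobolevForm (α β : ℝ) (j : ℕ) (m : ℝ) (p q : ℝ[X]) : ℝ :=
  (∫ x in (-1 : ℝ)..1, p.eval x * q.eval x * (1 - x) ^ α * (1 + x) ^ β)
    + m * (derivative^[j] p).eval 1 * (derivative^[j] q).eval 1

/-- `p` is an orthogonal polynomial of degree `n` for the form above: it has degree exactly `n`
and is orthogonal to every polynomial of smaller degree. -/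
def IsJacobiSobolevOP (α β : ℝ) (j : ℕ) (m : ℝ) (n : ℕ) (p : ℝ[X]) : Prop :=
  p.degree = n ∧ ∀ q : ℝ[X], q.degree < n → jacobiSobolevForm α β j m p q = 0

/-- `y 1 > y 2 > ⋯ > y n` are the zeros of the degree `n` polynomial `p`
(so all `n` zeros of `p` are real and simple). -/
def IsZeroList (p : ℝ[X]) (n : ℕ) (y : ℕ → ℝ) : Prop :=
  StrictAntiOn y (Icc 1 n) ∧ ∀ x : ℝ, p.IsRoot x ↔ ∃ i ∈ Icc 1 n, y i = x

/-- The Bessel function of the first kind `J_α(x)`, used for `x > 0` and `α > -1`. -/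
def besselJ (α x : ℝ) : ℝ :=
  ∑' k : ℕ, (-1 : ℝ) ^ k / ((k.factorial : ℝ) * Real.Gamma (k + α + 1))
    * (x / 2) ^ (2 * (k : ℝ) + α)

/-- The coefficients `b_i` computed recursively from a sequence `θ`. -/
def limitCoeff (α : ℝ) (θ : ℕ → ℝ) : ℕ → ℝ
  | i => (-1 : ℝ) ^ i *
      (θ i - Real.Gamma (α + i + 1) *
        ∑ k : Fin i, limitCoeff α θ k * (i.choose k : ℝ) *
          ((-1 : ℝ) ^ (k : ℕ) * ((k : ℕ).factorial : ℝ) * 2 ^ (k : ℕ)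
            / Real.Gamma (α + i + (k : ℕ) + 1)))
      / ((i.factorial : ℝ) * (2 ^ i * Real.Gamma (α + i + 1) / Real.Gamma (α + 2 * i + 1)))
  decreasing_by exact k.isLt

/-- `∑_{i=0}^{j+1} b_i 2^i (x/2)^{-α} J_{α+2i}(x)` with the coefficients `b_i` built from `θ`. -/
def besselCombination (α : ℝ) (j : ℕ) (θ : ℕ → ℝ) (x : ℝ) : ℝ :=
  ∑ i ∈ Finset.range (j + 2),
    limitCoeff α θ i * 2 ^ i * (x / 2) ^ (-α) * besselJ (α + 2 * i) x

/-- The function `φ_{α,j}`. -/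
def varphiFun (α : ℝ) (j : ℕ) : ℝ → ℝ :=
  besselCombination α j fun i => ((i : ℝ) - j) / (α + j + i + 1)

/-- The constant `Γ²(α+j+1) 2^{α+β+2j+1} (α+2j+1)`. -/
def massConst (α β : ℝ) (j : ℕ) : ℝ :=
  Real.Gamma (α + j + 1) ^ 2 * (2 : ℝ) ^ (α + β + 2 * j + 1) * (α + 2 * j + 1)

/-- The function `ψ_{α,j}` (it also depends on `β` and `M`). -/
def psiFun (α β : ℝ) (j : ℕ) (M : ℝ) : ℝ → ℝ :=
  besselCombination α j fun i =>
    (M * ((i : ℝ) - j) + massConst α β j * (α + j + i + 1))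
      / ((α + j + i + 1) * (M + massConst α β j))

/-- The threshold `2^{α+β+2j+1} (α+j+1) (α+2j+1) Γ²(α+j+1) / j`. -/
def massThreshold (α β : ℝ) (j : ℕ) : ℝ :=
  (2 : ℝ) ^ (α + β + 2 * j + 1) * (α + j + 1) * (α + 2 * j + 1)
    * Real.Gamma (α + j + 1) ^ 2 / j

/-- `t` is the `i`-th positive zero of `f` (`i ≥ 1`, in increasing order): `t` is a positive zero
and exactly `i` zeros of `f` lie in `(0, t]`. -/
def IsNthPosZero (f : ℝ → ℝ) (i : ℕ) (t : ℝ) : Prop :=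
  0 < t ∧ f t = 0 ∧ {s : ℝ | 0 < s ∧ s ≤ t ∧ f s = 0}.encard = i

end

/-! In the variable t = (1-x)/2 the form becomes the Jacobi functional on [0,1] plus a mass μ on the
product of the j-th coefficients. Let R_n be the Jacobi polynomial with R_n(0) = 1, and let K_n be
the kernel that reproduces the j-th coefficient in degrees below n. Then Q_n is a multiple of R_n -
μ r_{n,j} / (1 + μ K_{n,j}) · K_n, where r_{n,j} and K_{n,j} are the j-th coefficients
(`eq_jacobiPoly_sub_jacobiKernel`). After the scaling t = w/(4n²) its coefficients converge, under
one summable majorant, to those of an entire function F_c (`domTendsto_scaledPoly`). Here c is the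
limit of μ K_{n,j} / (1 + μ K_{n,j}), namely 0, 1 or M/(M+D) in the three regimes of γ
(`tendsto_relative_mass`). With w = x², F_c is Γ(α+1) times the stated Bessel combination
(`besselCombination_eq`); for c = 0 it is a nonvanishing multiple of J_α.

It remains to pass from convergence of functions to convergence of the numbered zeros. Counting sign
changes shows that Q_n has n simple real zeros, at most one of them outside t > 0
(`exists_roots_of_orthogonal`). No zero with a fixed index escapes to infinity, because F_c grows on
the negative axis faster than every polynomial and slower than every exponential
(`not_tendsto_root_atTop`). Limits of zeros along an ultrafilter are therefore zeros of F_c. A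
Hurwitz argument shows that they exhaust its positive zeros, and simplicity of the zeros keeps the
limits distinct (`RootFamily.exists_nthPosZero`).

Simplicity (`limitSeries_simple`) rests on a Laguerre inequality. Let H be the limit of the scaled
kernels, A = α+j+1 and θ = w d/dw. Then A·F_c = λH + θH for a constant λ, so a multiple positive
zero of F_c would give (θH)² = H·θ²H. The kernels have only positive zeros, and a quantitative
Laguerre inequality for them survives the limit and forces H = 0 there. This in turn would produce a
multiple zero of the Bessel series.

The cases differ only in the sign of F_c(0), which decides on which side of t = 0 the first zero
lies. It is 1 for c = 0, negative for c = 1, and has the sign of V - M in the critical regime. -/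

noncomputable section

/-! ### Entire power series and dominated convergence of coefficients. -/

/-- The sum of the real power series with coefficients `a`. -/
def psum (a : ℕ → ℝ) (w : ℝ) : ℝ := ∑' l, a l * w ^ l

/-- The power series with coefficients `a` converges absolutely everywhere. -/
def EntireCoeff (a : ℕ → ℝ) : Prop := ∀ r : ℝ, 0 ≤ r → Summable fun l => |a l| * r ^ l

/-- The coefficients of the derivative of a power series. -/
def coeffDeriv (a : ℕ → ℝ) (l : ℕ) : ℝ := (l + 1) * a (l + 1)

/-- Coefficientwise convergence of power series, dominated by an entire series. -/
def DomTendsto {ι : Type*} (F : Filter ι) (a : ι → ℕ → ℝ) (b C : ℕ → ℝ) : Prop :=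
  EntireCoeff C ∧ (∀ᶠ n in F, ∀ l, |a n l| ≤ C l) ∧ ∀ l, Tendsto (fun n => a n l) F (𝓝 (b l))

lemma EntireCoeff.of_le {a C : ℕ → ℝ} (hC : EntireCoeff C) (h : ∀ l, |a l| ≤ |C l|) :
    EntireCoeff a := fun r hr =>
  (hC r hr).of_nonneg_of_le (fun l => by positivity)
    fun l => mul_le_mul_of_nonneg_right (h l) (by positivity)

lemma EntireCoeff.summable {a : ℕ → ℝ} (ha : EntireCoeff a) (w : ℝ) :
    Summable fun l => a l * w ^ l := by
  refine Summable.of_norm ?_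
  simpa [Real.norm_eq_abs, abs_mul, abs_pow] using ha |w| (abs_nonneg w)

lemma EntireCoeff.deriv {a : ℕ → ℝ} (ha : EntireCoeff a) : EntireCoeff (coeffDeriv a) := by
  intro r hr
  have h := (summable_nat_add_iff 1).2 (ha (2 * max r 1) (by positivity))
  refine h.of_nonneg_of_le (fun l => by positivity) fun l => ?_
  have h1 : ((l : ℝ) + 1) ≤ 2 ^ (l + 1) := by
    exact_mod_cast (Nat.lt_two_pow_self (n := l + 1)).le
  have h2 : r ^ l ≤ (max r 1) ^ (l + 1) :=
    (pow_le_pow_left₀ hr (le_max_left r 1) l).trans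
      (pow_le_pow_right₀ (le_max_right r 1) (Nat.le_succ l))
  rw [coeffDeriv, abs_mul, abs_of_nonneg (by positivity : (0 : ℝ) ≤ l + 1), mul_pow]
  calc ((l : ℝ) + 1) * |a (l + 1)| * r ^ l = |a (l + 1)| * ((l + 1) * r ^ l) := by ring
    _ ≤ |a (l + 1)| * (2 ^ (l + 1) * (max r 1) ^ (l + 1)) := by gcongr

lemma hasDerivAt_psum {a : ℕ → ℝ} (ha : EntireCoeff a) (w : ℝ) :
    HasDerivAt (psum a) (psum (coeffDeriv a) w) w := by
  have hR : (0 : ℝ) ≤ |w| + 1 := by positivity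
  have hs := ha.deriv (|w| + 1) hR
  have hu : Summable fun l : ℕ => |a l * (l * (|w| + 1) ^ (l - 1))| := by
    refine (summable_nat_add_iff 1).1 ?_
    refine hs.congr fun l => ?_
    simp only [coeffDeriv, abs_mul, Nat.add_sub_cancel, abs_pow, abs_of_nonneg hR]
    push_cast
    ring
  have key := hasDerivAt_tsum_of_isPreconnected (g := fun l y => a l * y ^ l)
    (g' := fun l y => a l * (l * y ^ (l - 1))) (t := Metric.ball 0 (|w| + 1)) (y₀ := 0) (y := w)
    hu Metric.isOpen_ball (convex_ball _ _).isPreconnected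
    (fun l y _ => (hasDerivAt_pow l y).const_mul (a l))
    (fun l y hy => by
      rw [Real.norm_eq_abs, abs_mul, abs_mul, abs_mul, abs_mul]
      have hy' : |y| ≤ |w| + 1 := by
        have := mem_ball_zero_iff.1 hy
        rw [Real.norm_eq_abs] at this
        exact this.le
      rw [abs_pow, abs_pow, abs_of_nonneg hR]
      gcongr)
    (by simp; positivity) (ha.summable 0) (by simp)
  have hsum : Summable fun l : ℕ => a l * (l * w ^ (l - 1)) := by
    refine (summable_nat_add_iff 1).1 ((ha.deriv.summable w).congr fun l => ?_)
    simp only [coeffDeriv, Nat.add_sub_cancel]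
    push_cast
    ring
  rw [hsum.tsum_eq_zero_add] at key
  have heq : psum (coeffDeriv a) w
      = a 0 * ((0 : ℕ) * w ^ (0 - 1)) + ∑' l : ℕ, a (l + 1) * ((l + 1 : ℕ) * w ^ (l + 1 - 1)) := by
    simp only [Nat.cast_zero, zero_mul, mul_zero, zero_add, psum, coeffDeriv, Nat.add_sub_cancel]
    refine tsum_congr fun l => ?_
    push_cast
    ring
  rw [heq]
  exact key

lemma continuous_psum {a : ℕ → ℝ} (ha : EntireCoeff a) : Continuous (psum a) :=
  continuous_iff_continuousAt.2 fun w => (hasDerivAt_psum ha w).continuousAt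

lemma psum_zero (a : ℕ → ℝ) : psum a 0 = a 0 := by
  rw [psum, tsum_eq_single 0]
  · simp
  · intro l hl
    simp [hl]

lemma psum_add {a b : ℕ → ℝ} (ha : EntireCoeff a) (hb : EntireCoeff b) (w : ℝ) :
    psum (fun l => a l + b l) w = psum a w + psum b w := by
  rw [psum, psum, psum, ← (ha.summable w).tsum_add (hb.summable w)]
  exact tsum_congr fun l => by ring

lemma psum_const_mul (c : ℝ) (a : ℕ → ℝ) (w : ℝ) :
    psum (fun l => c * a l) w = c * psum a w := by
  rw [psum, psum, ← tsum_mul_left]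
  exact tsum_congr fun l => by ring

/-- Multiplying the `l`-th coefficient by `l` is the operator `w d/dw`. -/
lemma psum_nat_mul {a : ℕ → ℝ} (ha : EntireCoeff a) (w : ℝ) :
    psum (fun l => l * a l) w = w * psum (coeffDeriv a) w := by
  have hs : Summable fun l : ℕ => (l * a l) * w ^ l := by
    refine (summable_nat_add_iff 1).1 (((ha.deriv.summable w).mul_left w).congr fun l => ?_)
    simp only [coeffDeriv]
    push_cast
    ring
  rw [psum, hs.tsum_eq_zero_add, psum, ← tsum_mul_left]
  simp only [Nat.cast_zero, zero_mul, zero_add, coeffDeriv]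
  refine tsum_congr fun l => ?_
  push_cast
  ring

lemma EntireCoeff.const_mul {a : ℕ → ℝ} (ha : EntireCoeff a) (c : ℝ) :
    EntireCoeff fun l => c * a l := fun r hr =>
  ((ha r hr).mul_left |c|).congr fun l => by rw [abs_mul]; ring

lemma EntireCoeff.nat_mul {a : ℕ → ℝ} (ha : EntireCoeff a) : EntireCoeff fun l => l * a l := by
  intro r hr
  refine (summable_nat_add_iff 1).1 (((ha.deriv r hr).mul_left r).congr fun l => ?_)
  rw [coeffDeriv]
  push_cast
  ring

lemma psum_polynomial (p : ℝ[X]) (w : ℝ) : psum p.coeff w = p.eval w := by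
  rw [psum, Polynomial.eval_eq_sum, Polynomial.sum, tsum_eq_sum]
  intro l hl
  simp [Polynomial.notMem_support_iff.1 hl]

lemma coeffDeriv_polynomial (p : ℝ[X]) : coeffDeriv p.coeff = (derivative p).coeff := by
  ext l
  rw [coeffDeriv, Polynomial.coeff_derivative]
  ring

section DomTendsto

variable {ι : Type*} {F : Filter ι} {a : ι → ℕ → ℝ} {b C : ℕ → ℝ}

lemma DomTendsto.mono (h : DomTendsto F a b C) {F' : Filter ι} (hF : F' ≤ F) :
    DomTendsto F' a b C := ⟨h.1, hF h.2.1, fun l => (h.2.2 l).mono_left hF⟩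

lemma DomTendsto.abs_le [F.NeBot] (h : DomTendsto F a b C) (l : ℕ) : |b l| ≤ C l :=
  le_of_tendsto (h.2.2 l).abs (h.2.1.mono fun _ hn => hn l)

lemma DomTendsto.entire [F.NeBot] (h : DomTendsto F a b C) : EntireCoeff b :=
  h.1.of_le fun l => (h.abs_le l).trans (le_abs_self _)

lemma DomTendsto.deriv (h : DomTendsto F a b C) :
    DomTendsto F (fun n => coeffDeriv (a n)) (coeffDeriv b) (coeffDeriv C) := by
  refine ⟨h.1.deriv, h.2.1.mono fun n hn l => ?_, fun l => (h.2.2 (l + 1)).const_mul _⟩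
  simp only [coeffDeriv]
  rw [abs_mul, abs_of_nonneg (by positivity : (0 : ℝ) ≤ l + 1)]
  exact mul_le_mul_of_nonneg_left (hn _) (by positivity)

lemma DomTendsto.nat_mul (h : DomTendsto F a b C) :
    DomTendsto F (fun n l => l * a n l) (fun l => l * b l) (fun l => l * C l) := by
  refine ⟨h.1.nat_mul, h.2.1.mono fun n hn l => ?_, fun l => (h.2.2 l).const_mul _⟩
  rw [abs_mul, abs_of_nonneg (by positivity : (0 : ℝ) ≤ l)]
  exact mul_le_mul_of_nonneg_left (hn _) (by positivity)

/-- The evaluation point may move with `n`; this is what makes limits of zeros into zeros of the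
limit. The points are eventually bounded by `|w₀| + 1`, where the dominating series converges. -/
lemma DomTendsto.tendsto_psum (h : DomTendsto F a b C) {w : ι → ℝ} {w₀ : ℝ}
    (hw : Tendsto w F (𝓝 w₀)) : Tendsto (fun n => psum (a n) (w n)) F (𝓝 (psum b w₀)) := by
  have hR : ∀ᶠ n in F, |w n| ≤ |w₀| + 1 :=
    (hw.abs.eventually (gt_mem_nhds (lt_add_one |w₀|))).mono fun n hn => hn.le
  refine tendsto_tsum_of_dominated_convergence (h.1 (|w₀| + 1) (by positivity))
    (fun l => (h.2.2 l).mul (hw.pow l)) ?_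
  filter_upwards [hR, h.2.1] with n hn hC l
  rw [Real.norm_eq_abs, abs_mul, abs_pow]
  exact mul_le_mul ((hC l).trans (le_abs_self _)) (pow_le_pow_left₀ (abs_nonneg _) hn l)
    (by positivity) (by positivity)

end DomTendsto

/-! ### Zeros of fixed index do not escape to infinity. -/

lemma sum_le_prod_one_add (s : Finset ℕ) (x : ℕ → ℝ) (hx : ∀ k ∈ s, 0 ≤ x k) :
    1 + ∑ k ∈ s, x k ≤ ∏ k ∈ s, (1 + x k) := by
  induction s using Finset.induction_on with
  | empty => simp
  | insert a s ha ih =>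
    rw [Finset.sum_insert ha, Finset.prod_insert ha]
    have h1 := ih fun k hk => hx k (Finset.mem_insert_of_mem hk)
    have h2 := hx a (Finset.mem_insert_self _ _)
    have h3 : 0 ≤ ∑ k ∈ s, x k :=
      Finset.sum_nonneg fun k hk => hx k (Finset.mem_insert_of_mem hk)
    nlinarith

/-- A limit of products `∏ (1 + t x_k)` with uniformly small `x_k ≥ 0` is multiplicative under
doubling of `t`. -/
lemma prod_limit_two_mul {ι : Type*} {F : Filter ι} [F.NeBot] (s : ι → Finset ℕ) (x : ι → ℕ → ℝ)
    (e : ι → ℝ) (he0 : ∀ᶠ n in F, 0 ≤ e n)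
    (hx : ∀ᶠ n in F, ∀ k ∈ s n, 0 ≤ x n k ∧ x n k ≤ e n) (he : Tendsto e F (𝓝 0))
    (Φ : ℝ → ℝ)
    (hΦ : ∀ t, 0 ≤ t → Tendsto (fun n => ∏ k ∈ s n, (1 + t * x n k)) F (𝓝 (Φ t)))
    {t : ℝ} (ht : 0 ≤ t) : Φ (2 * t) = Φ t ^ 2 := by
  have h2 := hΦ (2 * t) (by positivity)
  have h1 := (hΦ t ht).pow 2
  refine le_antisymm (le_of_tendsto_of_tendsto h2 h1 ?_) ?_
  · filter_upwards [hx] with n hn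
    rw [← Finset.prod_pow]
    refine Finset.prod_le_prod (fun k hk => ?_) fun k hk => ?_
    · have := (hn k hk).1
      positivity
    · nlinarith [sq_nonneg (t * x n k)]
  -- For the reverse inequality, (1+tx)² ≤ (1+2tx)(1+t²x²) ≤ (1+2tx)·exp(t²·e·x). The accumulated
  -- error exp(t²·e·∑x) tends to 1, since ∑x ≤ ∏(1+x) stays bounded and e → 0.
  · have h3 : Tendsto (fun n => (∏ k ∈ s n, (1 + 2 * t * x n k))
        * Real.exp (t ^ 2 * (e n * ∏ k ∈ s n, (1 + 1 * x n k)))) F (𝓝 (Φ (2 * t) * 1)) := by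
      refine h2.mul ?_
      have := ((he.mul (hΦ 1 zero_le_one)).const_mul (t ^ 2)).rexp
      simpa using this
    rw [mul_one] at h3
    refine le_of_tendsto_of_tendsto h1 h3 ?_
    filter_upwards [hx, he0] with n hn hen
    have hA : ∀ k ∈ s n, (1 + t * x n k) ^ 2
        ≤ (1 + 2 * t * x n k) * Real.exp (t ^ 2 * (e n * x n k)) := by
      intro k hk
      obtain ⟨h0, he⟩ := hn k hk
      have h4 : 1 + t ^ 2 * (x n k) ^ 2 ≤ Real.exp (t ^ 2 * (e n * x n k)) := by
        have := Real.add_one_le_exp (t ^ 2 * (e n * x n k))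
        have h5 : t ^ 2 * (x n k) ^ 2 ≤ t ^ 2 * (e n * x n k) := by
          rw [sq (x n k)]
          gcongr
        linarith
      calc (1 + t * x n k) ^ 2 ≤ (1 + 2 * t * x n k) * (1 + t ^ 2 * (x n k) ^ 2) := by
            have : 0 ≤ 2 * t * x n k * (t ^ 2 * (x n k) ^ 2) := by positivity
            nlinarith
        _ ≤ _ := by gcongr
    rw [← Finset.prod_pow]
    refine (Finset.prod_le_prod (fun k hk => sq_nonneg _) hA).trans ?_
    rw [Finset.prod_mul_distrib, ← Real.exp_sum]
    have hP : 0 ≤ ∏ k ∈ s n, (1 + 2 * t * x n k) := Finset.prod_nonneg fun k hk => by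
      have := (hn k hk).1
      positivity
    refine mul_le_mul_of_nonneg_left (Real.exp_le_exp.2 ?_) hP
    rw [← Finset.mul_sum, ← Finset.mul_sum]
    have := sum_le_prod_one_add (s n) (x n) fun k hk => (hn k hk).1
    simp only [one_mul]
    gcongr
    linarith

/-- At `-v` all terms of index at least `l₀` are positive, so a single one of degree above `N` may
be kept; the finitely many earlier terms have smaller degree. -/
lemma psum_neg_ge {b : ℕ → ℝ} (hb : EntireCoeff b) {l₀ : ℕ}
    (hpos : ∀ l ≥ l₀, 0 < (-1) ^ l * b l) (N : ℕ) (K : ℝ) :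
    ∀ᶠ v : ℝ in atTop, K * v ^ N ≤ psum b (-v) := by
  set m := max l₀ (N + 1) with hm
  have hcm := hpos m (le_max_left _ _)
  set c := (-1) ^ m * b m with hc
  set B := ∑ l ∈ Finset.range m, |b l| with hB
  filter_upwards [eventually_ge_atTop (1 : ℝ), eventually_ge_atTop ((|K| + B) / c)] with v hv hv2
  have hv0 : 0 ≤ v := by linarith
  have hterm : ∀ l, b l * (-v) ^ l = ((-1) ^ l * b l) * v ^ l := fun l => by
    rw [neg_pow]; ring
  have hsum : Summable fun l => ((-1) ^ l * b l) * v ^ l := by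
    simpa only [hterm] using hb.summable (-v)
  have h1 : c * v ^ m - B * v ^ (m - 1) ≤ psum b (-v) := by
    rw [psum]
    simp only [hterm]
    rw [← hsum.sum_add_tsum_nat_add (m + 1), Finset.sum_range_succ]
    have ht : 0 ≤ ∑' i, ((-1) ^ (i + (m + 1)) * b (i + (m + 1))) * v ^ (i + (m + 1)) :=
      tsum_nonneg fun i => mul_nonneg (hpos _ (by omega)).le (by positivity)
    have hh : -(B * v ^ (m - 1)) ≤ ∑ l ∈ Finset.range m, ((-1) ^ l * b l) * v ^ l := by
      rw [hB, Finset.sum_mul, ← Finset.sum_neg_distrib]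
      refine Finset.sum_le_sum fun l hl => ?_
      have h3 : |((-1) ^ l * b l) * v ^ l| ≤ |b l| * v ^ (m - 1) := by
        rw [abs_mul, abs_mul, abs_pow, abs_neg, abs_one, one_pow, one_mul, abs_pow, abs_of_nonneg hv0]
        gcongr
        · have := Finset.mem_range.1 hl; omega
      exact (abs_le.1 h3).1
    linarith
  refine le_trans ?_ h1
  have h4 : |K| + B ≤ v * c := (div_le_iff₀ hcm).1 hv2
  have h5 : v ^ m = v * v ^ (m - 1) := by
    rw [← pow_succ']; congr 1; omega
  have h6 : K * v ^ N ≤ |K| * v ^ (m - 1) := by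
    refine mul_le_mul (le_abs_self K) (pow_le_pow_right₀ hv (by omega)) (by positivity)
      (abs_nonneg K)
  have h7 : 0 ≤ v ^ (m - 1) := by positivity
  rw [h5]
  nlinarith

/-- Termwise comparison with the exponential series. If a bound holds for every ε > 0, the growth is
slower than any exponential. -/
lemma abs_psum_neg_le {b : ℕ → ℝ} {ε K : ℝ} (hK : ∀ l, |b l| * (l.factorial : ℝ) ≤ K * ε ^ l) {v : ℝ} (hv : 0 ≤ v) :
    |psum b (-v)| ≤ K * Real.exp (ε * v) := by
  have h1 : HasSum (fun l : ℕ => K * ((ε * v) ^ l / l.factorial)) (K * Real.exp (ε * v)) := by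
    rw [Real.exp_eq_exp_ℝ]
    exact (NormedSpace.expSeries_div_hasSum_exp (ε * v)).mul_left K
  rw [psum, ← Real.norm_eq_abs]
  refine tsum_of_norm_bounded h1 fun l => ?_
  rw [Real.norm_eq_abs, abs_mul, abs_pow, abs_neg, abs_of_nonneg hv, mul_pow]
  have h2 : |b l| ≤ K * ε ^ l / l.factorial := by
    rw [le_div_iff₀ (by positivity)]
    exact hK l
  calc |b l| * v ^ l ≤ K * ε ^ l / l.factorial * v ^ l := by gcongr
    _ = _ := by ring


/-- If real-rooted polynomials converge to an entire function that grows faster than polynomials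
but slower than exponentials on the negative axis, no root escapes to `+∞`. -/
lemma not_tendsto_root_atTop {F : Filter ℕ} [F.NeBot] (hF : F ≤ atTop) {p : ℕ → ℝ[X]}
    {w : ℕ → ℕ → ℝ} {b C : ℕ → ℝ} (hdom : DomTendsto F (fun n => (p n).coeff) b C)
    (hroot : ∀ᶠ n in F, ∃ l, 0 < l ∧ ∀ x, (p n).eval x = l * ∏ k ∈ Finset.Icc 1 n, (w n k - x))
    (hmono : ∀ᶠ n in F, StrictMonoOn (w n) (Icc 1 n))
    {l₀ : ℕ} (hpos : ∀ l ≥ l₀, 0 < (-1) ^ l * b l)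
    (hsub : ∀ ε > 0, ∃ K, ∀ l, |b l| * (l.factorial : ℝ) ≤ K * ε ^ l)
    {N : ℕ} (hN : 1 ≤ N) {ζ : ℕ → ℝ}
    (hζ : ∀ k ∈ Finset.Ico 1 N, Tendsto (fun n => w n k) F (𝓝 (ζ k))) :
    ¬ Tendsto (fun n => w n N) F atTop := by
  intro hinf
  have hb : EntireCoeff b := hdom.entire
  -- The base point `-v₀` lies to the left of all the limits ζ_k with k < N, and the limit function
  -- is nonzero there, so ratios of values can be formed.
  obtain ⟨v₀, hv0, hg1, hζv⟩ : ∃ v₀ : ℝ, 0 ≤ v₀ ∧ 1 ≤ psum b (-v₀) ∧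
      ∀ k ∈ Finset.Ico 1 N, 0 < ζ k + v₀ := by
    have h1 := psum_neg_ge hb hpos 0 1
    have h2 : ∀ᶠ v : ℝ in atTop, ∀ k ∈ Finset.Ico 1 N, 0 < ζ k + v := by
      rw [Filter.eventually_all_finset]
      intro k _
      filter_upwards [eventually_gt_atTop (-ζ k)] with v hv
      linarith
    obtain ⟨v, h⟩ := ((eventually_ge_atTop (0 : ℝ)).and (h1.and h2)).exists
    exact ⟨v, h.1, by simpa using h.2.1, h.2.2⟩
  set g₀ := psum b (-v₀) with hg₀
  have hg0 : 0 < g₀ := by linarith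
  set A : ℝ → ℝ := fun t => ∏ k ∈ Finset.Ico 1 N, (1 + t * (1 / (ζ k + v₀))) with hA
  have hA1 : ∀ t, 0 ≤ t → 1 ≤ A t := fun t ht => by
    refine Finset.one_le_prod fun k hk => ?_
    have := hζv k hk
    have : 0 ≤ t * (1 / (ζ k + v₀)) := by positivity
    linarith
  -- Φ is the limit of the product over the roots of index at least N, obtained by dividing out the
  -- value at `-v₀` and the convergent factors `A`. If all those roots tend to infinity,
  -- `prod_limit_two_mul` applies and Φ(2^k) = Φ(1)^(2^k).
  set Φ : ℝ → ℝ := fun t => psum b (-(v₀ + t)) / g₀ / A t with hΦdef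
  set x : ℕ → ℕ → ℝ := fun n k => 1 / (w n k + v₀) with hx
  have hfar : ∀ᶠ n in F, ∀ k ∈ Finset.Ico N (n + 1), w n N ≤ w n k := by
    filter_upwards [hmono] with n hn k hk
    rw [Finset.mem_Ico] at hk
    exact hn.monotoneOn ⟨hN, by omega⟩ ⟨by omega, by omega⟩ hk.1
  have hposN : ∀ᶠ n in F, 0 < w n N := hinf.eventually_gt_atTop 0
  have hΦ : ∀ t, 0 ≤ t →
      Tendsto (fun n => ∏ k ∈ Finset.Ico N (n + 1), (1 + t * x n k)) F (𝓝 (Φ t)) := by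
    intro t ht
    have hnear : Tendsto (fun n => ∏ k ∈ Finset.Ico 1 N, (1 + t * x n k)) F (𝓝 (A t)) := by
      refine tendsto_finsetProd _ fun k hk => ?_
      have h1 : Tendsto (fun n => w n k + v₀) F (𝓝 (ζ k + v₀)) := (hζ k hk).add_const v₀
      exact ((tendsto_const_nhds.div h1 (hζv k hk).ne').const_mul t).const_add 1
    have hnum := hdom.tendsto_psum (w := fun _ => -(v₀ + t)) tendsto_const_nhds
    have hden := hdom.tendsto_psum (w := fun _ => -v₀) tendsto_const_nhds
    have hlim := (hnum.div hden hg0.ne').div hnear (by have := hA1 t ht; linarith)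
    refine hlim.congr' ?_
    have hnearpos : ∀ᶠ n in F, ∀ k ∈ Finset.Ico 1 N, 0 < w n k + v₀ := by
      rw [Filter.eventually_all_finset]
      intro k hk
      exact ((hζ k hk).add_const v₀).eventually (lt_mem_nhds (hζv k hk))
    filter_upwards [hroot, hfar, hposN, hnearpos, hF (eventually_ge_atTop N)]
      with n ⟨l, hl, hev⟩ hf hwN hnp hn
    simp only [psum_polynomial, Pi.div_apply]
    have hpw : ∀ k ∈ Finset.Ico 1 (n + 1), 0 < w n k + v₀ := by
      intro k hk
      rw [Finset.mem_Ico] at hk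
      by_cases hkN : k < N
      · exact hnp k (Finset.mem_Ico.2 ⟨hk.1, hkN⟩)
      · have := hf k (Finset.mem_Ico.2 ⟨by omega, hk.2⟩)
        linarith
    have hIcc : Finset.Icc 1 n = Finset.Ico 1 (n + 1) := by ext k; simp
    have e1 : (p n).eval (-(v₀ + t)) = (p n).eval (-v₀) * ((∏ k ∈ Finset.Ico 1 N, (1 + t * x n k))
        * ∏ k ∈ Finset.Ico N (n + 1), (1 + t * x n k)) := by
      rw [Finset.prod_Ico_consecutive _ hN (by omega), hev, hev, hIcc, mul_assoc,
        ← Finset.prod_mul_distrib]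
      congr 1
      refine Finset.prod_congr rfl fun k hk => ?_
      have := (hpw k hk).ne'
      simp only [hx]
      field_simp
      ring
    have hne1 : (p n).eval (-v₀) ≠ 0 := by
      rw [hev, hIcc]
      refine mul_ne_zero hl.ne' (Finset.prod_ne_zero_iff.2 fun k hk => ?_)
      have := hpw k hk
      intro h
      linarith
    have hne2 : ∏ k ∈ Finset.Ico 1 N, (1 + t * x n k) ≠ 0 := by
      refine Finset.prod_ne_zero_iff.2 fun k hk => ?_
      have h1 := hnp k hk
      have : 0 ≤ t * x n k := by simp only [hx]; positivity
      linarith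
    rw [e1]
    field_simp
  have hxn : ∀ᶠ n in F, ∀ k ∈ Finset.Ico N (n + 1), 0 ≤ x n k ∧ x n k ≤ 1 / (w n N + v₀) := by
    filter_upwards [hfar, hposN] with n hf hwN k hk
    have := hf k hk
    have h0 : 0 < w n N + v₀ := by linarith
    have h1 : 0 < w n k + v₀ := by linarith
    refine ⟨by simp only [hx]; positivity, ?_⟩
    simp only [hx]
    gcongr
  have he0 : ∀ᶠ n in F, 0 ≤ 1 / (w n N + v₀) := by
    filter_upwards [hposN] with n hn
    positivity
  have he : Tendsto (fun n => 1 / (w n N + v₀)) F (𝓝 0) := by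
    simp only [one_div]
    exact tendsto_inv_atTop_zero.comp (tendsto_atTop_add_const_right F v₀ hinf)
  have hdouble : ∀ t, 0 ≤ t → Φ (2 * t) = Φ t ^ 2 := fun t ht =>
    prod_limit_two_mul _ x _ he0 hxn he Φ hΦ ht
  have hpow : ∀ k : ℕ, Φ (2 ^ k) = Φ 1 ^ (2 ^ k) := by
    intro k
    induction k with
    | zero => simp
    | succ k ih => rw [pow_succ', hdouble _ (by positivity), ih, ← pow_mul, pow_succ]
  have hone : 1 ≤ Φ 1 := by
    refine ge_of_tendsto (hΦ 1 zero_le_one) ?_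
    filter_upwards [hxn] with n hn
    refine Finset.one_le_prod fun k hk => ?_
    have := (hn k hk).1
    linarith
  have h2k : Tendsto (fun k : ℕ => v₀ + (2 : ℝ) ^ k) atTop atTop :=
    tendsto_atTop_add_const_left _ _ (tendsto_pow_atTop_atTop_of_one_lt one_lt_two)
  -- Both alternatives contradict the growth of the limit: Φ(1) > 1 gives exponential growth along
  -- `v₀ + 2^k`, and Φ(1) = 1 gives at most the polynomial growth of `A`.
  rcases hone.lt_or_eq with hlt | heq
  · have hlog : 0 < Real.log (Φ 1) := Real.log_pos hlt
    -- Half of the exponential rate: Φ(1)^(2^k) = exp(2ε·2^k), against an upper bound of order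
    -- exp(ε·2^k).
    set ε := Real.log (Φ 1) / 2 with hε
    have hεpos : 0 < ε := by positivity
    obtain ⟨K, hK⟩ := hsub ε hεpos
    have hbound : ∀ k : ℕ, ε * k ≤ K * Real.exp (ε * v₀) / g₀ := by
      intro k
      have h1 : Φ 1 ^ (2 ^ k) ≤ psum b (-(v₀ + 2 ^ k)) / g₀ := by
        rw [← hpow]
        have hAk := hA1 (2 ^ k) (by positivity)
        have hΦ0 : 0 ≤ Φ (2 ^ k) := by rw [hpow]; positivity
        have h3 : Φ (2 ^ k) * A (2 ^ k) = psum b (-(v₀ + 2 ^ k)) / g₀ := by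
          simp only [hΦdef]
          have : A (2 ^ k) ≠ 0 := by linarith
          field_simp
        rw [← h3]
        nlinarith
      have h2 : psum b (-(v₀ + 2 ^ k)) ≤ K * Real.exp (ε * (v₀ + 2 ^ k)) :=
        (le_abs_self _).trans (abs_psum_neg_le hK (by positivity))
      have h3 : Φ 1 ^ (2 ^ k) = Real.exp (ε * 2 ^ k) * Real.exp (ε * 2 ^ k) := by
        rw [← Real.exp_add, ← Real.exp_log (by linarith : 0 < Φ 1), ← Real.exp_nat_mul]
        congr 1
        push_cast
        rw [hε]
        ring
      have h4 : Real.exp (ε * 2 ^ k) * Real.exp (ε * 2 ^ k)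
          ≤ K * Real.exp (ε * v₀) / g₀ * Real.exp (ε * 2 ^ k) := by
        rw [← h3]
        refine h1.trans ((div_le_div_of_nonneg_right h2 hg0.le).trans_eq ?_)
        rw [mul_add, Real.exp_add]
        ring
      have h5 := le_of_mul_le_mul_right h4 (Real.exp_pos _)
      have h6 : (k : ℝ) ≤ 2 ^ k := by exact_mod_cast (Nat.lt_two_pow_self (n := k)).le
      have h7 := Real.add_one_le_exp (ε * 2 ^ k)
      have h8 : ε * k ≤ ε * 2 ^ k := by gcongr
      linarith
    obtain ⟨k, hk⟩ := exists_nat_gt (K * Real.exp (ε * v₀) / g₀ / ε)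
    have := hbound k
    rw [div_lt_iff₀ hεpos] at hk
    linarith
  · have hval : ∀ k : ℕ, psum b (-(v₀ + 2 ^ k)) ≤ g₀ * A 1 * (v₀ + 2 ^ k) ^ (N - 1) := by
      intro k
      have h1 : Φ (2 ^ k) = 1 := by rw [hpow, ← heq, one_pow]
      have hAk := hA1 (2 ^ k) (by positivity)
      have h3 : psum b (-(v₀ + 2 ^ k)) = g₀ * A (2 ^ k) := by
        simp only [hΦdef] at h1
        have : A (2 ^ k) ≠ 0 := by linarith
        field_simp at h1
        linarith
      have h4 : A (2 ^ k) ≤ A 1 * (2 ^ k) ^ (N - 1) := by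
        have : ((2 : ℝ) ^ k) ^ (N - 1) = ∏ _i ∈ Finset.Ico 1 N, (2 : ℝ) ^ k := by simp
        rw [this, hA]
        simp only
        rw [← Finset.prod_mul_distrib]
        refine Finset.prod_le_prod (fun i hi => ?_) fun i hi => ?_
        · have := hζv i hi
          positivity
        · have := hζv i hi
          have h5 : (1 : ℝ) ≤ 2 ^ k := one_le_pow₀ one_le_two
          have h6 : 0 < 1 / (ζ i + v₀) := by positivity
          nlinarith
      rw [h3, mul_assoc]
      have h9 : (2 : ℝ) ^ k ≤ v₀ + 2 ^ k := by linarith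
      have hA11 : 0 ≤ A 1 := by linarith [hA1 1 zero_le_one]
      refine mul_le_mul_of_nonneg_left (h4.trans ?_) hg0.le
      gcongr
    have h10 := h2k.eventually (psum_neg_ge hb hpos (N - 1) (g₀ * A 1 + 1))
    obtain ⟨k, hk⟩ := h10.exists
    have := hval k
    have h11 : 0 < (v₀ + (2 : ℝ) ^ k) ^ (N - 1) := by positivity
    nlinarith

/-! ### A Hurwitz theorem for numbered real zeros. -/

lemma IsNthPosZero.unique {f : ℝ → ℝ} {i : ℕ} {s t : ℝ} (hs : IsNthPosZero f i s)
    (ht : IsNthPosZero f i t) : s = t := by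
  have key : ∀ {s t : ℝ}, IsNthPosZero f i s → IsNthPosZero f i t → ¬ s < t := by
    intro s t hs ht hlt
    have hsub : {x : ℝ | 0 < x ∧ x ≤ s ∧ f x = 0} ⊂ {x : ℝ | 0 < x ∧ x ≤ t ∧ f x = 0} := by
      refine ⟨fun x hx => ⟨hx.1, hx.2.1.trans hlt.le, hx.2.2⟩, fun h => ?_⟩
      have := h ⟨ht.1, le_rfl, ht.2.1⟩
      exact absurd this.2.1 (not_le.2 hlt)
    have hfin : {x : ℝ | 0 < x ∧ x ≤ s ∧ f x = 0}.Finite := by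
      rw [← Set.encard_lt_top_iff, hs.2.2]
      exact ENat.natCast_lt_top i
    have := hfin.encard_lt_encard hsub
    rw [hs.2.2, ht.2.2] at this
    exact lt_irrefl _ this
  rcases lt_trichotomy s t with h | h | h
  · exact absurd h (key hs ht)
  · exact h
  · exact absurd h (key ht hs)

section Zeros

variable {p : ℕ → ℝ[X]} {w : ℕ → ℕ → ℝ} {b C : ℕ → ℝ}

/-- By strong induction on the index, the k-th root does not tend to +∞. Along an ultrafilter this
already makes it eventually bounded above, and compactness of an interval gives a limit. -/
lemma exists_tendsto_root (U : Ultrafilter ℕ) (hU : (U : Filter ℕ) ≤ atTop)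
    (hdom : DomTendsto (U : Filter ℕ) (fun n => (p n).coeff) b C)
    (hroot : ∀ᶠ n in (U : Filter ℕ),
      ∃ l, 0 < l ∧ ∀ x, (p n).eval x = l * ∏ k ∈ Finset.Icc 1 n, (w n k - x))
    (hmono : ∀ᶠ n in (U : Filter ℕ), StrictMonoOn (w n) (Icc 1 n))
    {l₀ : ℕ} (hpos : ∀ l ≥ l₀, 0 < (-1) ^ l * b l)
    (hsub : ∀ ε > 0, ∃ K, ∀ l, |b l| * (l.factorial : ℝ) ≤ K * ε ^ l)
    {B : ℝ} (hB : ∀ᶠ n in (U : Filter ℕ), -B ≤ w n 1) :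
    ∃ ζ : ℕ → ℝ, ∀ k ≥ 1, Tendsto (fun n => w n k) U (𝓝 (ζ k)) := by
  have key : ∀ k ≥ 1, ∃ z, Tendsto (fun n => w n k) U (𝓝 z) := by
    intro k
    induction k using Nat.strong_induction_on with
    | _ k ih =>
      intro hk
      choose ζ hζ using ih
      set ζ' : ℕ → ℝ := fun i => if h : i < k ∧ 1 ≤ i then ζ i h.1 h.2 else 0 with hζ'
      have hnot := not_tendsto_root_atTop (F := (U : Filter ℕ)) hU hdom hroot hmono hpos hsub hk
        (ζ := ζ') fun i hi => by
          rw [Finset.mem_Ico] at hi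
          have : ζ' i = ζ i hi.2 hi.1 := by simp [hζ', hi.1, hi.2]
          rw [this]
          exact hζ i hi.2 hi.1
      rw [tendsto_atTop] at hnot
      push Not at hnot
      obtain ⟨K, hK⟩ := hnot
      have hmem : ∀ᶠ n in (U : Filter ℕ), w n k ∈ Icc (-B) K := by
        filter_upwards [hK, hB, hmono, hU (eventually_ge_atTop k)] with n h1 h2 h3 hn
        exact ⟨h2.trans (h3.monotoneOn ⟨le_rfl, by omega⟩ ⟨hk, hn⟩ hk), h1.le⟩
      obtain ⟨z, -, hz⟩ := isCompact_Icc.ultrafilter_le_nhds (U.map fun n => w n k)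
        (le_principal_iff.2 hmem)
      exact ⟨z, hz⟩
  choose ζ hζ using key
  refine ⟨fun k => if h : 1 ≤ k then ζ k h else 0, fun k hk => ?_⟩
  simp only [hk, dif_pos]
  exact hζ k hk

/-- A simple zero of the limit is a sign change, which the approximants inherit; the intermediate
value theorem then applies. -/
lemma exists_root_near (hdom : DomTendsto atTop (fun n => (p n).coeff) b C) {z ε : ℝ} (hε : 0 < ε)
    (hz : psum b z = 0) (hz' : psum (coeffDeriv b) z ≠ 0) :
    ∀ᶠ n in atTop, ∃ x ∈ Ioo (z - ε) (z + ε), (p n).eval x = 0 := by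
  have hb := hdom.entire
  have hd := hasDerivAt_psum hb z
  obtain ⟨x₁, h₁, x₂, h₂, hlt⟩ : ∃ x₁ ∈ Ioo (z - ε) (z + ε), ∃ x₂ ∈ Ioo (z - ε) (z + ε),
      psum b x₁ < 0 ∧ 0 < psum b x₂ := by
    have hnb : Ioo (z - ε) (z + ε) ∈ 𝓝 z := Ioo_mem_nhds (by linarith) (by linarith)
    have hsign : ∃ c : ℝ, c ≠ 0 ∧ ∀ᶠ x in 𝓝 z, SignType.sign (psum b x)
        = SignType.sign (c * (x - z)) := by
      rcases lt_or_gt_of_ne hz' with h | h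
      · refine ⟨-1, by norm_num, ?_⟩
        filter_upwards [eventually_nhdsWithin_sign_eq_of_deriv_neg (by rwa [hd.deriv]) hz]
          with x hx
        rw [hx]
        congr 1
        ring
      · refine ⟨1, by norm_num, ?_⟩
        filter_upwards [eventually_nhdsWithin_sign_eq_of_deriv_pos (by rwa [hd.deriv]) hz]
          with x hx
        rw [hx, one_mul]
    obtain ⟨c, hc, hs⟩ := hsign
    obtain ⟨δ, hδ, hball⟩ := Metric.eventually_nhds_iff.1 (hs.and hnb)
    have hr := hball (y := z + δ / 2) (by
      rw [Real.dist_eq, add_sub_cancel_left, abs_of_pos (by positivity)]; linarith)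
    have hl := hball (y := z - δ / 2) (by
      rw [Real.dist_eq, sub_sub_cancel_left, abs_neg, abs_of_pos (by positivity)]; linarith)
    have e1 : c * (z + δ / 2 - z) = c * (δ / 2) := by ring
    have e2 : c * (z - δ / 2 - z) = -(c * (δ / 2)) := by ring
    rw [e1] at hr
    rw [e2] at hl
    rcases lt_or_gt_of_ne hc with h | h
    · have h3 : c * (δ / 2) < 0 := mul_neg_of_neg_of_pos h (by positivity)
      rw [sign_neg h3, sign_eq_neg_one_iff] at hr
      rw [sign_pos (neg_pos.2 h3), sign_eq_one_iff] at hl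
      exact ⟨_, hr.2, _, hl.2, hr.1, hl.1⟩
    · have h3 : 0 < c * (δ / 2) := by positivity
      rw [sign_pos h3, sign_eq_one_iff] at hr
      rw [sign_neg (neg_neg_iff_pos.2 h3), sign_eq_neg_one_iff] at hl
      exact ⟨_, hl.2, _, hr.2, hl.1, hr.1⟩
  have e1 := (hdom.tendsto_psum (w := fun _ => x₁) tendsto_const_nhds).eventually
    (gt_mem_nhds hlt.1)
  have e2 := (hdom.tendsto_psum (w := fun _ => x₂) tendsto_const_nhds).eventually
    (lt_mem_nhds hlt.2)
  filter_upwards [e1, e2] with n hn1 hn2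
  rw [psum_polynomial] at hn1 hn2
  have := isPreconnected_Ioo.intermediate_value h₁ h₂ (f := fun x => (p n).eval x)
    (Polynomial.continuous _).continuousOn
  obtain ⟨x, hx, hx0⟩ := this ⟨hn1.le, hn2.le⟩
  exact ⟨x, hx, hx0⟩

/-- Real-rooted polynomials `p n` with roots `w n 1 < ⋯ < w n n`, all but the first `o ≤ 1`
positive, converging to the entire function `psum b`. -/
structure RootFamily (p : ℕ → ℝ[X]) (w : ℕ → ℕ → ℝ) (b C : ℕ → ℝ) (l₀ : ℕ) (B : ℝ) (o : ℕ) :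
    Prop where
  dom : DomTendsto atTop (fun n => (p n).coeff) b C
  root : ∀ᶠ n in atTop, ∃ l, 0 < l ∧ ∀ x, (p n).eval x = l * ∏ k ∈ Finset.Icc 1 n, (w n k - x)
  mono : ∀ᶠ n in atTop, StrictMonoOn (w n) (Icc 1 n)
  coeff_pos : ∀ l ≥ l₀, 0 < (-1) ^ l * b l
  coeff_small : ∀ ε > 0, ∃ K, ∀ l, |b l| * (l.factorial : ℝ) ≤ K * ε ^ l
  lower : ∀ᶠ n in atTop, -B ≤ w n 1
  le_one : o ≤ 1
  root_pos : ∀ᶠ n in atTop, ∀ k, o < k → k ≤ n → 0 < w n k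
  upper : o = 1 → ∀ ε > 0, ∀ᶠ n in atTop, w n 1 < ε
  zero : b 0 = 0 → o = 1 ∧ Tendsto (fun n => w n 1) atTop (𝓝 0)
  simple : ∀ x, 0 ≤ x → psum b x = 0 → psum (coeffDeriv b) x ≠ 0

/-- The limits ζ_k of the roots along `U` are strictly increasing, unbounded, positive exactly for k
> o, and contain every positive zero of the limit. Hence ζ_{i+o} is the i-th positive zero. -/
lemma RootFamily.exists_nthPosZero_ultrafilter {l₀ : ℕ} {B : ℝ} {o : ℕ}
    (h : RootFamily p w b C l₀ B o) (U : Ultrafilter ℕ) (hU : (U : Filter ℕ) ≤ atTop)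
    (i : ℕ) (hi : 1 ≤ i) :
    ∃ z, IsNthPosZero (psum b) i z ∧ Tendsto (fun n => w n (i + o)) U (𝓝 z) := by
  obtain ⟨ζ, hζ⟩ := exists_tendsto_root U hU (h.dom.mono hU) (hU h.root) (hU h.mono) h.coeff_pos
    h.coeff_small (hU h.lower)
  have hb : EntireCoeff b := h.dom.entire
  have hz : ∀ k ≥ 1, psum b (ζ k) = 0 := by
    intro k hk
    refine tendsto_nhds_unique ((h.dom.mono hU).tendsto_psum (hζ k hk))
      (tendsto_const_nhds.congr' ?_)
    filter_upwards [hU h.root, hU (eventually_ge_atTop k)] with n ⟨l, _, hev⟩ hn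
    rw [psum_polynomial, hev, Finset.prod_eq_zero (Finset.mem_Icc.2 ⟨hk, hn⟩) (sub_self _),
      mul_zero]
  have hζnonneg : ∀ k, o < k → 0 ≤ ζ k := by
    intro k hk
    refine ge_of_tendsto (hζ k (by omega)) ?_
    filter_upwards [hU h.root_pos, hU (eventually_ge_atTop k)] with n hn hkn
    exact (hn k hk hkn).le
  have hlt : ∀ k ≥ 1, ζ k < ζ (k + 1) := by
    intro k hk
    have hle : ζ k ≤ ζ (k + 1) := by
      refine le_of_tendsto_of_tendsto (hζ k hk) (hζ (k + 1) (by omega)) ?_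
      filter_upwards [hU h.mono, hU (eventually_ge_atTop (k + 1))] with n hn hkn
      exact (hn ⟨hk, by omega⟩ ⟨by omega, hkn⟩ (Nat.lt_succ_self k)).le
    -- If two consecutive roots had the same limit, Rolle's critical point between them would
    -- converge there too and make the zero multiple. Simplicity is available because k + 1 > o
    -- makes the common limit nonnegative.
    refine lt_of_le_of_ne hle fun heq => ?_
    have h0 : 0 ≤ ζ k := by
      rw [heq]
      exact hζnonneg _ (by have := h.le_one; omega)
    have hc : ∀ᶠ n in (U : Filter ℕ), ∃ c, w n k < c ∧ c < w n (k + 1) ∧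
        (derivative (p n)).eval c = 0 := by
      filter_upwards [hU h.mono, hU h.root, hU (eventually_ge_atTop (k + 1))]
        with n hn ⟨l, _, hev⟩ hkn
      have hroot : ∀ k', 1 ≤ k' → k' ≤ n → (p n).eval (w n k') = 0 := fun k' h1 h2 => by
        rw [hev, Finset.prod_eq_zero (Finset.mem_Icc.2 ⟨h1, h2⟩) (sub_self _), mul_zero]
      obtain ⟨c, hc, hc0⟩ := exists_deriv_eq_zero (f := fun x => (p n).eval x)
        (hn ⟨hk, by omega⟩ ⟨by omega, hkn⟩ (Nat.lt_succ_self k))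
        (Polynomial.continuous _).continuousOn
        (by rw [hroot k hk (by omega), hroot (k + 1) (by omega) hkn])
      rw [Polynomial.deriv] at hc0
      exact ⟨c, hc.1, hc.2, hc0⟩
    obtain ⟨c, hc⟩ := Filter.Eventually.choice hc
    have hct : Tendsto c U (𝓝 (ζ k)) := by
      refine tendsto_of_tendsto_of_tendsto_of_le_of_le' (hζ k hk)
        (by rw [heq]; exact hζ (k + 1) (by omega)) ?_ ?_
      · filter_upwards [hc] with n hn using hn.1.le
      · filter_upwards [hc] with n hn using hn.2.1.le
    refine h.simple (ζ k) h0 (hz k hk) ?_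
    refine tendsto_nhds_unique ((h.dom.mono hU).deriv.tendsto_psum hct)
      (tendsto_const_nhds.congr' ?_)
    filter_upwards [hc] with n hn
    rw [coeffDeriv_polynomial, psum_polynomial, hn.2.2]
  have hζmono : StrictMonoOn ζ (Ici 1) := by
    intro a ha c hc hac
    induction c, hac using Nat.le_induction with
    | base => exact hlt a ha
    | succ c hac ih =>
      have hc1 : 1 ≤ c := le_trans ha (by omega)
      exact (ih hc1).trans (hlt c hc1)
  have hζpos : ∀ k, o < k → 0 < ζ k := by
    intro k hk
    refine lt_of_le_of_ne (hζnonneg k hk) fun h0 => ?_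
    have hb0 : b 0 = 0 := by
      have := hz k (by omega)
      rwa [← h0, psum_zero] at this
    obtain ⟨ho, ht⟩ := h.zero hb0
    have h1 : ζ 1 = 0 := tendsto_nhds_unique (hζ 1 le_rfl) (ht.mono_left hU)
    have := hζmono (mem_Ici.2 le_rfl) (mem_Ici.2 (by omega : 1 ≤ k)) (by omega)
    linarith
  have hζle : ∀ k, 1 ≤ k → k ≤ o → ζ k ≤ 0 := by
    intro k hk hko
    have hk1 : k = 1 := by have := h.le_one; omega
    subst hk1
    refine le_of_forall_pos_le_add fun ε hε => ?_
    rw [zero_add]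
    refine le_of_tendsto (hζ 1 le_rfl) ?_
    filter_upwards [hU (h.upper (by have := h.le_one; omega) ε hε)] with n hn using hn.le
  -- Bounded ζ_k would accumulate at a nonnegative zero of the limit, and a simple zero is isolated.
  have hunb : ∀ K, ∃ k ≥ 1, K < ζ k := by
    intro K
    by_contra! hK
    have hm : Monotone fun k => ζ (k + 1) :=
      monotone_nat_of_le_succ fun k => (hlt (k + 1) (by omega)).le
    have hbdd : BddAbove (range fun k => ζ (k + 1)) :=
      ⟨K, by rintro _ ⟨k, rfl⟩; exact hK (k + 1) (by omega)⟩
    have ht := tendsto_atTop_ciSup hm hbdd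
    set L := ⨆ k, ζ (k + 1) with hL
    have hltL : ∀ k, ζ (k + 1) < L := fun k =>
      (hlt (k + 1) (by omega)).trans_le (le_ciSup hbdd (k + 1))
    have hLz : psum b L = 0 := by
      refine tendsto_nhds_unique (((continuous_psum hb).tendsto L).comp ht)
        (tendsto_const_nhds.congr fun k => ?_)
      exact (hz (k + 1) (by omega)).symm
    have hL0 : 0 ≤ L := (hζnonneg (o + 1) (Nat.lt_succ_self o)).trans (hltL o).le
    have hne := (hasDerivAt_psum hb L).eventually_ne (c := 0) (h.simple L hL0 hLz)
    have ht' : Tendsto (fun k => ζ (k + 1)) atTop (𝓝[≠] L) :=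
      tendsto_nhdsWithin_iff.2 ⟨ht, Eventually.of_forall fun k => (hltL k).ne⟩
    obtain ⟨k, hk⟩ := (ht'.eventually hne).exists
    exact hk (hz (k + 1) (by omega))
  have hall : ∀ z, 0 < z → psum b z = 0 → ∃ k ≥ 1, ζ k = z := by
    intro z hz0 hzz
    obtain ⟨K, hK1, hK⟩ := hunb (z + 1)
    have hclose : ∀ ε, 0 < ε → ε ≤ 1 → ∃ k ∈ Finset.Icc 1 K, |ζ k - z| ≤ ε := by
      intro ε hε hε1
      have hev : ∀ᶠ n in (U : Filter ℕ), ∃ k ∈ Finset.Icc 1 K, |w n k - z| ≤ ε := by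
        have hKn : ∀ᶠ n in (U : Filter ℕ), z + 1 < w n K := (hζ K hK1).eventually (lt_mem_nhds hK)
        filter_upwards [hU (exists_root_near h.dom hε hzz (h.simple z hz0.le hzz)), hKn,
          hU h.root, hU h.mono, hU (eventually_ge_atTop K)] with n ⟨x, hx, hx0⟩ hwK ⟨l, hl, hev⟩ hm hn
        rw [hev, mul_eq_zero, or_iff_right hl.ne', Finset.prod_eq_zero_iff] at hx0
        obtain ⟨k, hk, hkx⟩ := hx0
        rw [Finset.mem_Icc] at hk
        have hkx' : w n k = x := by linarith
        refine ⟨k, Finset.mem_Icc.2 ⟨hk.1, ?_⟩, ?_⟩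
        · by_contra! hKk
          have := hm ⟨hK1, hn⟩ ⟨hk.1, hk.2⟩ hKk
          linarith [hx.2]
        · rw [hkx', abs_le]
          constructor <;> linarith [hx.1, hx.2]
      by_contra! hno
      have : ∀ᶠ n in (U : Filter ℕ), ∀ k ∈ Finset.Icc 1 K, ε < |w n k - z| := by
        rw [Filter.eventually_all_finset]
        intro k hk
        exact (((hζ k (Finset.mem_Icc.1 hk).1).sub_const z).abs).eventually
          (lt_mem_nhds (hno k hk))
      obtain ⟨n, ⟨k, hk, hk1⟩, h2⟩ := (hev.and this).exists
      exact absurd hk1 (not_le.2 (h2 k hk))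
    -- Only the indices up to `K` can come near `z`, because ζ_K > z + 1. A positive minimal
    -- distance over this finite set contradicts `hclose`.
    by_contra! hno
    obtain ⟨k₀, hk₀, hmin⟩ := Finset.exists_min_image (Finset.Icc 1 K) (fun k => |ζ k - z|)
      ⟨1, Finset.mem_Icc.2 ⟨le_rfl, hK1⟩⟩
    have hd : 0 < |ζ k₀ - z| :=
      abs_pos.2 (sub_ne_zero.2 (hno k₀ (Finset.mem_Icc.1 hk₀).1))
    obtain ⟨k, hk, hk2⟩ := hclose (min 1 (|ζ k₀ - z| / 2)) (by positivity) (min_le_left _ _)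
    have h3 := hmin k hk
    have h4 := min_le_right 1 (|ζ k₀ - z| / 2)
    linarith
  refine ⟨ζ (i + o), ⟨hζpos _ (by omega), hz _ (by omega), ?_⟩, hζ _ (by omega)⟩
  have hset : {s : ℝ | 0 < s ∧ s ≤ ζ (i + o) ∧ psum b s = 0}
      = ζ '' (Finset.Icc (o + 1) (o + i) : Finset ℕ) := by
    ext s
    simp only [mem_ofPred_eq, Finset.coe_Icc, mem_image, mem_Icc]
    constructor
    · rintro ⟨h0, h1, h2⟩
      obtain ⟨k, hk, rfl⟩ := hall s h0 h2
      refine ⟨k, ⟨?_, ?_⟩, rfl⟩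
      · by_contra! hko
        exact absurd h0 (not_lt.2 (hζle k hk (by omega)))
      · by_contra! hki
        exact absurd h1 (not_le.2 (hζmono (mem_Ici.2 (by omega)) (mem_Ici.2 hk) (by omega)))
    · rintro ⟨k, ⟨h1, h2⟩, rfl⟩
      exact ⟨hζpos k (by omega), hζmono.monotoneOn (mem_Ici.2 (by omega)) (mem_Ici.2 (by omega))
        (by omega), hz k (by omega)⟩
  rw [hset, InjOn.encard_image, Set.encard_coe_eq_coe_finsetCard, Nat.card_Icc]
  · congr 1
    omega
  · refine hζmono.injOn.mono fun k hk => ?_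
    simp only [Finset.coe_Icc, mem_Icc] at hk
    exact mem_Ici.2 (by omega)

/-- The roots of the approximating polynomials converge to the positive zeros of the limit. -/
theorem RootFamily.exists_nthPosZero {l₀ : ℕ} {B : ℝ} {o : ℕ} (h : RootFamily p w b C l₀ B o)
    (i : ℕ) (hi : 1 ≤ i) :
    ∃ z, IsNthPosZero (psum b) i z ∧ Tendsto (fun n => w n (i + o)) atTop (𝓝 z) := by
  obtain ⟨z, hz, -⟩ := h.exists_nthPosZero_ultrafilter (Ultrafilter.of atTop)
    (Ultrafilter.of_le atTop) i hi
  refine ⟨z, hz, ?_⟩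
  -- The limit along every ultrafilter is the i-th positive zero, which is unique, so there is
  -- convergence along `atTop`.
  rw [Filter.tendsto_iff_ultrafilter]
  intro U hU
  obtain ⟨z', hz', ht⟩ := h.exists_nthPosZero_ultrafilter U hU i hi
  rwa [hz.unique hz']

end Zeros

/-! ### The Jacobi functional and its Beta moments. -/

/-- The functional `f ↦ ∫₀¹ f(t) t^α (1-t)^β dt` on real polynomials. -/
def jacobiFunctional (α β : ℝ) (f : ℝ[X]) : ℝ :=
  ∫ t in (0 : ℝ)..1, f.eval t * (t ^ α * (1 - t) ^ β)

lemma ofReal_beta_integrand {α β : ℝ} {t : ℝ} (ht : t ∈ Ioo (0 : ℝ) 1) :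
    (t : ℂ) ^ ((α + 1 : ℂ) - 1) * (1 - (t : ℂ)) ^ ((β + 1 : ℂ) - 1)
      = ((t ^ α * (1 - t) ^ β : ℝ) : ℂ) := by
  have h1 : (1 : ℂ) - (t : ℂ) = ((1 - t : ℝ) : ℂ) := by push_cast; ring
  rw [add_sub_cancel_right, add_sub_cancel_right, h1, ← Complex.ofReal_cpow ht.1.le,
    ← Complex.ofReal_cpow (by linarith [ht.2]), ← Complex.ofReal_mul]

lemma intervalIntegrable_weight {α β : ℝ} (hα : -1 < α) (hβ : -1 < β) :
    IntervalIntegrable (fun t : ℝ => t ^ α * (1 - t) ^ β) MeasureTheory.volume 0 1 := by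
  have h := Complex.betaIntegral_convergent (u := (α : ℂ) + 1) (v := (β : ℂ) + 1)
    (by simp; linarith) (by simp; linarith)
  have h2 : IntervalIntegrable (fun t : ℝ => ((t ^ α * (1 - t) ^ β : ℝ) : ℂ))
      MeasureTheory.volume 0 1 := by
    refine h.congr_uIoo ?_
    rw [uIoo_of_le zero_le_one]
    exact fun t ht => ofReal_beta_integrand ht
  rw [intervalIntegrable_iff] at h2 ⊢
  exact h2.re

lemma integral_weight {α β : ℝ} (hα : -1 < α) (hβ : -1 < β) :
    ∫ t in (0 : ℝ)..1, t ^ α * (1 - t) ^ β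
      = Real.Gamma (α + 1) * Real.Gamma (β + 1) / Real.Gamma (α + β + 2) := by
  have h := Complex.betaIntegral_eq_Gamma_mul_div ((α : ℂ) + 1) ((β : ℂ) + 1)
    (by simp; linarith) (by simp; linarith)
  have h2 : Complex.betaIntegral ((α : ℂ) + 1) ((β : ℂ) + 1)
      = ((∫ t in (0 : ℝ)..1, t ^ α * (1 - t) ^ β : ℝ) : ℂ) := by
    rw [Complex.betaIntegral, ← intervalIntegral.integral_ofReal]
    exact intervalIntegral.integral_congr_Ioo_of_le zero_le_one
      fun t ht => ofReal_beta_integrand ht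
  rw [h2] at h
  have e1 : (α : ℂ) + 1 + (β + 1) = ((α + β + 2 : ℝ) : ℂ) := by push_cast; ring
  have e2 : (α : ℂ) + 1 = ((α + 1 : ℝ) : ℂ) := by push_cast; ring
  have e3 : (β : ℂ) + 1 = ((β + 1 : ℝ) : ℂ) := by push_cast; ring
  rw [e1, e2, e3, Complex.Gamma_ofReal, Complex.Gamma_ofReal, Complex.Gamma_ofReal] at h
  exact_mod_cast h

section Functional

variable {α β : ℝ}

lemma intervalIntegrable_eval_mul_weight (hα : -1 < α) (hβ : -1 < β) (f : ℝ[X]) :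
    IntervalIntegrable (fun t : ℝ => f.eval t * (t ^ α * (1 - t) ^ β))
      MeasureTheory.volume 0 1 :=
  (intervalIntegrable_weight hα hβ).continuousOn_mul f.continuous.continuousOn

lemma jacobiFunctional_add (hα : -1 < α) (hβ : -1 < β) (f g : ℝ[X]) :
    jacobiFunctional α β (f + g) = jacobiFunctional α β f + jacobiFunctional α β g := by
  rw [jacobiFunctional, jacobiFunctional, jacobiFunctional, ← intervalIntegral.integral_add
    (intervalIntegrable_eval_mul_weight hα hβ f) (intervalIntegrable_eval_mul_weight hα hβ g)]
  simp only [eval_add, add_mul]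

lemma jacobiFunctional_C_mul (c : ℝ) (f : ℝ[X]) :
    jacobiFunctional α β (C c * f) = c * jacobiFunctional α β f := by
  rw [jacobiFunctional, jacobiFunctional, ← intervalIntegral.integral_const_mul]
  simp only [eval_mul, eval_C, mul_assoc]

lemma jacobiFunctional_sub (hα : -1 < α) (hβ : -1 < β) (f g : ℝ[X]) :
    jacobiFunctional α β (f - g) = jacobiFunctional α β f - jacobiFunctional α β g := by
  have h : f - g = f + C (-1) * g := by simp [sub_eq_add_neg]
  rw [h, jacobiFunctional_add hα hβ, jacobiFunctional_C_mul]
  ring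

lemma jacobiFunctional_zero : jacobiFunctional α β 0 = 0 := by simp [jacobiFunctional]

lemma jacobiFunctional_sum (hα : -1 < α) (hβ : -1 < β) {ι : Type*} (s : Finset ι) (f : ι → ℝ[X]) :
    jacobiFunctional α β (∑ i ∈ s, f i) = ∑ i ∈ s, jacobiFunctional α β (f i) := by
  classical
  induction s using Finset.induction_on with
  | empty => simp [jacobiFunctional_zero]
  | insert a s ha ih =>
    rw [Finset.sum_insert ha, Finset.sum_insert ha, jacobiFunctional_add hα hβ, ih]

lemma jacobiFunctional_moment (hα : -1 < α) (hβ : -1 < β) (i p : ℕ) :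
    jacobiFunctional α β (X ^ i * (1 - X) ^ p)
      = Real.Gamma (α + i + 1) * Real.Gamma (β + p + 1) / Real.Gamma (α + β + 1 + p + 1 + i) := by
  have h := integral_weight (α := α + i) (β := β + p)
    (by have := i.cast_nonneg (α := ℝ); linarith) (by have := p.cast_nonneg (α := ℝ); linarith)
  have e : α + β + 1 + p + 1 + i = α + i + (β + p) + 2 := by ring
  rw [e, ← h, jacobiFunctional]
  refine intervalIntegral.integral_congr_Ioo_of_le zero_le_one fun t ht => ?_
  have h1 : 0 < t := ht.1
  have h2 : 0 < 1 - t := by linarith [ht.2]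
  simp only [eval_mul, eval_pow, eval_X, eval_sub, eval_one]
  rw [Real.rpow_add h1, Real.rpow_add h2, Real.rpow_natCast, Real.rpow_natCast]
  ring

lemma jacobiFunctional_pos (hα : -1 < α) (hβ : -1 < β) {f : ℝ[X]} (hf : f ≠ 0)
    (h0 : ∀ t ∈ Ioo (0 : ℝ) 1, 0 ≤ f.eval t) : 0 < jacobiFunctional α β f := by
  have hpos : ∀ t ∈ Ioo (0 : ℝ) 1, 0 < t ^ α * (1 - t) ^ β := fun t ht =>
    mul_pos (Real.rpow_pos_of_pos ht.1 _) (Real.rpow_pos_of_pos (by linarith [ht.2]) _)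
  rw [jacobiFunctional, intervalIntegral.integral_of_le zero_le_one,
    MeasureTheory.integral_Ioc_eq_integral_Ioo]
  have hint := (intervalIntegrable_eval_mul_weight hα hβ f)
  rw [intervalIntegrable_iff_integrableOn_Ioo_of_le zero_le_one] at hint
  rw [MeasureTheory.setIntegral_pos_iff_support_of_nonneg_ae _ hint]
  · have hsub : Ioo (0 : ℝ) 1 \ (f.roots.toFinset : Set ℝ)
        ⊆ Function.support (fun t => f.eval t * (t ^ α * (1 - t) ^ β)) ∩ Ioo 0 1 := by
      rintro t ⟨ht, hr⟩
      refine ⟨mul_ne_zero ?_ (hpos t ht).ne', ht⟩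
      simpa [hf] using hr
    refine lt_of_lt_of_le ?_ (MeasureTheory.measure_mono hsub)
    rw [MeasureTheory.measure_sdiff_null (Finset.measure_zero _ _)]
    simp
  · refine MeasureTheory.ae_restrict_of_forall_mem measurableSet_Ioo fun t ht => ?_
    exact mul_nonneg (h0 t ht) (hpos t ht).le

end Functional

/-! ### Finite differences, Jacobi polynomials, orthogonality and norms. -/

/-- The rising factorial `x (x+1) ⋯ (x+n-1)`. -/
def risingFac (x : ℝ) (n : ℕ) : ℝ := ∏ s ∈ Finset.range n, (x + s)

lemma risingFac_succ (x : ℝ) (n : ℕ) : risingFac x (n + 1) = risingFac x n * (x + n) :=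
  Finset.prod_range_succ _ _

lemma risingFac_succ' (x : ℝ) (n : ℕ) : risingFac x (n + 1) = x * risingFac (x + 1) n := by
  rw [risingFac, Finset.prod_range_succ', risingFac, mul_comm]
  push_cast
  rw [add_zero]
  congr 1
  exact Finset.prod_congr rfl fun s _ => by ring

lemma risingFac_pos {x : ℝ} (hx : 0 < x) (n : ℕ) : 0 < risingFac x n :=
  Finset.prod_pos fun s _ => by positivity

lemma Gamma_add_nat {x : ℝ} (hx : 0 < x) (n : ℕ) :
    Real.Gamma (x + n) = risingFac x n * Real.Gamma x := by
  induction n with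
  | zero => simp [risingFac]
  | succ n ih =>
    rw [risingFac_succ]
    push_cast
    rw [← add_assoc, Real.Gamma_add_one (by positivity), ih]
    ring

/-- Up to sign this is the n-th finite difference at 0, which annihilates polynomials of degree
below n. It yields the orthogonality of the Jacobi polynomials. -/
lemma sum_neg_one_pow_choose_mul_eval {P : ℝ[X]} {n : ℕ} (hP : P.natDegree < n) :
    ∑ i ∈ Finset.range (n + 1), (-1 : ℝ) ^ i * (n.choose i : ℝ) * P.eval (i : ℝ) = 0 := by
  have h := congrFun (Polynomial.fwdDiff_iter_eq_zero_of_degree_lt hP) 0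
  rw [fwdDiff_iter_eq_sum_shift] at h
  have h2 : (-1 : ℝ) ^ n * ∑ i ∈ Finset.range (n + 1), (-1 : ℝ) ^ i * (n.choose i : ℝ) * P.eval (i : ℝ)
      = 0 := by
    rw [Pi.zero_apply] at h
    rw [← h, Finset.mul_sum]
    refine Finset.sum_congr rfl fun i hi => ?_
    have hin : i ≤ n := by have := Finset.mem_range.1 hi; omega
    have e : (-1 : ℝ) ^ n = (-1) ^ (n - i) * (-1) ^ i := by rw [← pow_add, Nat.sub_add_cancel hin]
    have e2 : (-1 : ℝ) ^ i * (-1) ^ i = 1 := by rw [← mul_pow]; simp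
    rw [zsmul_eq_mul, e]
    push_cast
    rw [zero_add, nsmul_eq_mul, mul_one]
    linear_combination ((-1) ^ (n - i) * (n.choose i : ℝ) * eval (i : ℝ) P) * e2
  exact (mul_eq_zero.1 h2).resolve_left (pow_ne_zero _ (by norm_num))

/-- The n-th finite difference of 1/y, computed by induction. It is the sum that remains in the norm
of the Jacobi polynomial. -/
lemma sum_neg_one_pow_choose_div {x : ℝ} (hx : 0 < x) (n : ℕ) :
    ∑ i ∈ Finset.range (n + 1), (-1 : ℝ) ^ i * (n.choose i : ℝ) / (x + i)
      = (n.factorial : ℝ) / risingFac x (n + 1) := by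
  have key : ∀ n : ℕ, ∀ x : ℝ, 0 < x → (fwdDiff 1)^[n] (fun y : ℝ => y⁻¹) x
      = (-1) ^ n * (n.factorial : ℝ) / risingFac x (n + 1) := by
    intro n
    induction n with
    | zero => intro x hx; simp [risingFac]
    | succ n ih =>
      intro x hx
      rw [Function.iterate_succ_apply', fwdDiff, ih x hx, ih (x + 1) (by positivity)]
      have h1 := risingFac_succ' x (n + 1)
      have h2 := risingFac_succ x (n + 1)
      have h3 := risingFac_succ' x n
      have h4 := risingFac_succ (x + 1) n
      have hp := risingFac_pos (by positivity : 0 < x + 1) n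
      rw [h1, h4, h3, Nat.factorial_succ]
      push_cast
      have : x + 1 + n ≠ 0 := by positivity
      field_simp
      ring
  have h := key n x hx
  rw [fwdDiff_iter_eq_sum_shift] at h
  have h1 : (-1 : ℝ) ^ n * (-1) ^ n = 1 := by rw [← mul_pow]; simp
  have h2 : (-1 : ℝ) ^ n * ∑ i ∈ Finset.range (n + 1), (-1 : ℝ) ^ i * (n.choose i : ℝ) / (x + i)
      = (-1) ^ n * (n.factorial : ℝ) / risingFac x (n + 1) := by
    rw [← h, Finset.mul_sum]
    refine Finset.sum_congr rfl fun i hi => ?_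
    have hin : i ≤ n := by have := Finset.mem_range.1 hi; omega
    have e : (-1 : ℝ) ^ n = (-1) ^ (n - i) * (-1) ^ i := by rw [← pow_add, Nat.sub_add_cancel hin]
    have e2 : (-1 : ℝ) ^ i * (-1) ^ i = 1 := by rw [← mul_pow]; simp
    rw [zsmul_eq_mul, e]
    push_cast
    rw [nsmul_eq_mul, mul_one, div_eq_mul_inv]
    linear_combination ((-1) ^ (n - i) * (n.choose i : ℝ) * (x + i)⁻¹) * e2
  have h3 := congrArg (fun y => (-1 : ℝ) ^ n * y) h2
  rw [← mul_assoc, h1, one_mul] at h3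
  rw [h3, ← mul_div_assoc, ← mul_assoc, h1, one_mul]

/-- The coefficients of the Jacobi polynomial `₂F₁(-n, n+α+β+1; α+1; t)`. -/
def jacobiCoeff (α β : ℝ) (n i : ℕ) : ℝ :=
  ∏ s ∈ Finset.range i, (((s : ℝ) - n) * (n + (α + β + 1) + s) / ((α + 1 + s) * (s + 1)))

/-- The Jacobi polynomial of degree `n` in the variable `t = (1-x)/2`, normalized at `t = 0`. -/
def jacobiPoly (α β : ℝ) (n : ℕ) : ℝ[X] :=
  ∑ i ∈ Finset.range (n + 1), C (jacobiCoeff α β n i) * X ^ i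

section Jacobi

variable {α β : ℝ}

lemma jacobiCoeff_zero (n : ℕ) : jacobiCoeff α β n 0 = 1 := by simp [jacobiCoeff]

lemma jacobiCoeff_succ (n i : ℕ) : jacobiCoeff α β n (i + 1)
    = jacobiCoeff α β n i * (((i : ℝ) - n) * (n + (α + β + 1) + i) / ((α + 1 + i) * (i + 1))) :=
  Finset.prod_range_succ _ _

lemma jacobiCoeff_eq_zero {n i : ℕ} (h : n < i) : jacobiCoeff α β n i = 0 :=
  Finset.prod_eq_zero (Finset.mem_range.2 h) (by simp)

lemma jacobiCoeff_eq (hα : -1 < α) (n i : ℕ) : jacobiCoeff α β n i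
    = (-1) ^ i * (n.choose i : ℝ) * risingFac (n + (α + β + 1)) i / risingFac (α + 1) i := by
  induction i with
  | zero => simp [jacobiCoeff, risingFac]
  | succ i ih =>
    rw [jacobiCoeff_succ, ih, risingFac_succ, risingFac_succ]
    have h1 : 0 < α + 1 + i := by have := i.cast_nonneg (α := ℝ); linarith
    have h2 := risingFac_pos (by linarith : 0 < α + 1) i
    have h3 : (n.choose (i + 1) : ℝ) * (i + 1) = n.choose i * ((n : ℝ) - i) := by
      rcases le_or_gt i n with h | h
      · have := Nat.choose_succ_right_eq n i
        rw [← Nat.cast_sub h]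
        exact_mod_cast this
      · rw [Nat.choose_eq_zero_of_lt h, Nat.choose_eq_zero_of_lt (by omega)]
        simp
    have h4 : (n.choose (i + 1) : ℝ) = n.choose i * ((n : ℝ) - i) / (i + 1) := by
      field_simp
      exact h3
    rw [h4, pow_succ]
    field_simp
    ring

lemma coeff_jacobiPoly (n i : ℕ) : (jacobiPoly α β n).coeff i = jacobiCoeff α β n i := by
  rw [jacobiPoly, finsetSum_coeff]
  simp only [coeff_C_mul, coeff_X_pow, mul_ite, mul_one, mul_zero]
  rw [Finset.sum_ite_eq]
  split_ifs with h
  · rfl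
  · exact (jacobiCoeff_eq_zero (by simpa using h)).symm

lemma jacobiCoeff_sign (hα : -1 < α) (hβ : -1 < β) {n i : ℕ} (hn : 1 ≤ n) (hi : i ≤ n) :
    0 < (-1) ^ i * jacobiCoeff α β n i := by
  have hn' : (1 : ℝ) ≤ n := by exact_mod_cast hn
  rw [jacobiCoeff_eq hα]
  have h1 := risingFac_pos (by linarith : 0 < α + 1) i
  have h2 := risingFac_pos (by linarith : 0 < (n : ℝ) + (α + β + 1)) i
  have h3 : 0 < (n.choose i : ℝ) := by exact_mod_cast Nat.choose_pos hi
  have e2 : (-1 : ℝ) ^ i * (-1) ^ i = 1 := by rw [← mul_pow]; simp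
  have : (-1 : ℝ) ^ i * ((-1) ^ i * (n.choose i : ℝ) * risingFac (n + (α + β + 1)) i
      / risingFac (α + 1) i) = (n.choose i : ℝ) * risingFac (n + (α + β + 1)) i
      / risingFac (α + 1) i := by
    rw [← mul_div_assoc, ← mul_assoc, ← mul_assoc, e2, one_mul]
  rw [this]
  positivity

lemma jacobiCoeff_self_ne_zero (hα : -1 < α) (hβ : -1 < β) (n : ℕ) : jacobiCoeff α β n n ≠ 0 := by
  rcases Nat.eq_zero_or_pos n with rfl | hn
  · simp [jacobiCoeff]
  · intro h
    have := jacobiCoeff_sign hα hβ hn le_rfl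
    rw [h, mul_zero] at this
    exact lt_irrefl _ this

lemma degree_jacobiPoly (hα : -1 < α) (hβ : -1 < β) (n : ℕ) : (jacobiPoly α β n).degree = n := by
  refine le_antisymm (degree_le_iff_coeff_zero _ _ |>.2 fun m hm => ?_) (le_degree_of_ne_zero ?_)
  · rw [coeff_jacobiPoly]
    exact jacobiCoeff_eq_zero (by exact_mod_cast hm)
  · rw [coeff_jacobiPoly]
    exact jacobiCoeff_self_ne_zero hα hβ n

/-- In the basis (1-X)^p the Beta moments cancel the factors (α+1)_i of the coefficients, leaving an
alternating binomial sum of Gamma quotients. The condition n ≥ 1 makes n+α+β+1 positive. -/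
lemma jacobiFunctional_jacobiPoly_mul (hα : -1 < α) (hβ : -1 < β) {n : ℕ} (hn : 1 ≤ n) (p : ℕ) :
    jacobiFunctional α β (jacobiPoly α β n * (1 - X) ^ p)
      = Real.Gamma (α + 1) * Real.Gamma (β + p + 1) / Real.Gamma (n + (α + β + 1))
        * ∑ i ∈ Finset.range (n + 1), (-1 : ℝ) ^ i * (n.choose i : ℝ)
          * (Real.Gamma (n + (α + β + 1) + i) / Real.Gamma (α + β + 1 + p + 1 + i)) := by
  have hn' : (1 : ℝ) ≤ n := by exact_mod_cast hn
  have hσ : 0 < (n : ℝ) + (α + β + 1) := by linarith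
  rw [jacobiPoly, Finset.sum_mul, jacobiFunctional_sum hα hβ, Finset.mul_sum]
  refine Finset.sum_congr rfl fun i _ => ?_
  rw [mul_assoc, jacobiFunctional_C_mul, jacobiFunctional_moment hα hβ, jacobiCoeff_eq hα,
    Gamma_add_nat hσ, show α + (i : ℝ) + 1 = α + 1 + i by ring, Gamma_add_nat (by linarith)]
  have h1 := risingFac_pos (by linarith : 0 < α + 1) i
  have h2 := Real.Gamma_pos_of_pos hσ
  field_simp

lemma jacobiFunctional_jacobiPoly_mul_eq_zero (hα : -1 < α) (hβ : -1 < β) {n p : ℕ} (hp : p < n) :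
    jacobiFunctional α β (jacobiPoly α β n * (1 - X) ^ p) = 0 := by
  rw [jacobiFunctional_jacobiPoly_mul hα hβ (by omega)]
  -- For p < n the quotient of Gammas is this polynomial evaluated at i, of degree n-1-p < n, so the
  -- n-th difference vanishes.
  set P : ℝ[X] := ∏ s ∈ Finset.range (n - 1 - p), (X + C (α + β + 1 + p + 1 + s)) with hP
  have hdeg : P.natDegree < n := by
    refine lt_of_le_of_lt (natDegree_prod_le _ _) ?_
    refine lt_of_le_of_lt (Finset.sum_le_sum fun s _ => (natDegree_X_add_C _).le) ?_
    simp
    omega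
  have h := sum_neg_one_pow_choose_mul_eval hdeg
  rw [mul_eq_zero]
  right
  rw [← h]
  refine Finset.sum_congr rfl fun i _ => ?_
  congr 1
  have hx : 0 < α + β + 1 + p + 1 + i := by
    have h1 := p.cast_nonneg (α := ℝ)
    have h2 := i.cast_nonneg (α := ℝ)
    linarith
  have e : (n : ℝ) + (α + β + 1) + i = α + β + 1 + p + 1 + i + ((n - 1 - p : ℕ) : ℝ) := by
    rw [Nat.sub_sub, Nat.cast_sub (by omega)]
    push_cast
    ring
  rw [e, Gamma_add_nat hx, mul_div_cancel_right₀ _ (Real.Gamma_pos_of_pos hx).ne', hP, eval_prod,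
    risingFac]
  refine Finset.prod_congr rfl fun s _ => ?_
  simp
  ring

lemma jacobiFunctional_jacobiPoly_mul_self_pow (hα : -1 < α) (hβ : -1 < β) {n : ℕ} (hn : 1 ≤ n) :
    jacobiFunctional α β (jacobiPoly α β n * (1 - X) ^ n)
      = Real.Gamma (α + 1) * Real.Gamma (β + n + 1) / Real.Gamma (n + (α + β + 1))
        * ((n.factorial : ℝ) / risingFac (n + (α + β + 1)) (n + 1)) := by
  have hn' : (1 : ℝ) ≤ n := by exact_mod_cast hn
  have hσ : 0 < (n : ℝ) + (α + β + 1) := by linarith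
  rw [jacobiFunctional_jacobiPoly_mul hα hβ hn, ← sum_neg_one_pow_choose_div hσ]
  congr 1
  refine Finset.sum_congr rfl fun i _ => ?_
  have hx : 0 < (n : ℝ) + (α + β + 1) + i := by positivity
  have hg := Real.Gamma_pos_of_pos hx
  rw [show α + β + 1 + n + 1 + (i : ℝ) = n + (α + β + 1) + i + 1 by ring,
    Real.Gamma_add_one hx.ne']
  field_simp

lemma exists_eq_sum_one_sub_X_pow {f : ℝ[X]} {n : ℕ} (hf : f.degree < n) :
    ∃ c : ℕ → ℝ, f = ∑ p ∈ Finset.range n, C (c p) * (1 - X) ^ p := by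
  rcases Nat.eq_zero_or_pos n with rfl | hn
  · refine ⟨0, ?_⟩
    have : f = 0 := by
      rw [← degree_eq_bot]
      simpa using hf
    simp [this]
  · set g := f.comp (1 - X) with hg
    have h1 : g.comp (1 - X) = f := by
      rw [hg, comp_assoc]
      simp
    have hnd : g.natDegree < n := by
      rw [hg]
      refine lt_of_le_of_lt natDegree_comp_le ?_
      have h2 : f.natDegree < n := by
        by_cases h0 : f = 0
        · simpa [h0] using hn
        · exact (natDegree_lt_iff_degree_lt h0).2 hf
      have h3 : (1 - X : ℝ[X]).natDegree ≤ 1 := by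
        refine (natDegree_sub_le _ _).trans ?_
        simp
      nlinarith
    refine ⟨g.coeff, ?_⟩
    conv_lhs => rw [← h1, g.as_sum_range_C_mul_X_pow' hnd]
    rw [Polynomial.sum_comp]
    simp

lemma jacobiFunctional_jacobiPoly_mul_of_degree_lt (hα : -1 < α) (hβ : -1 < β) {n : ℕ} {f : ℝ[X]}
    (hf : f.degree < n) : jacobiFunctional α β (jacobiPoly α β n * f) = 0 := by
  obtain ⟨c, rfl⟩ := exists_eq_sum_one_sub_X_pow hf
  rw [Finset.mul_sum, jacobiFunctional_sum hα hβ]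
  refine Finset.sum_eq_zero fun p hp => ?_
  rw [mul_left_comm, jacobiFunctional_C_mul,
    jacobiFunctional_jacobiPoly_mul_eq_zero hα hβ (Finset.mem_range.1 hp), mul_zero]

/-- The squared norm of the Jacobi polynomial. -/
def jacobiNorm (α β : ℝ) (n : ℕ) : ℝ :=
  jacobiFunctional α β (jacobiPoly α β n * jacobiPoly α β n)

lemma jacobiNorm_pos (hα : -1 < α) (hβ : -1 < β) (n : ℕ) : 0 < jacobiNorm α β n := by
  have h0 : jacobiPoly α β n ≠ 0 := by
    intro h
    have := degree_jacobiPoly hα hβ n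
    rw [h, degree_zero] at this
    exact absurd this (by simp)
  refine jacobiFunctional_pos hα hβ (mul_ne_zero h0 h0) fun t _ => ?_
  rw [eval_mul]
  exact mul_self_nonneg _

lemma jacobiNorm_eq (hα : -1 < α) (hβ : -1 < β) {n : ℕ} (hn : 1 ≤ n) :
    jacobiNorm α β n = Real.Gamma (α + 1) * Real.Gamma (β + n + 1) * (n.factorial : ℝ)
      / (Real.Gamma (n + (α + β + 1)) * risingFac (α + 1) n * (2 * n + (α + β + 1))) := by
  have hn' : (1 : ℝ) ≤ n := by exact_mod_cast hn
  have hσ : 0 < (n : ℝ) + (α + β + 1) := by linarith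
  set c := (-1) ^ n * jacobiCoeff α β n n with hc
  have hsq : (-1 : ℝ) ^ n * (-1) ^ n = 1 := by rw [← mul_pow]; simp
  have hcoe : ((1 - X : ℝ[X]) ^ n).coeff n = (-1) ^ n := by
    have h := coeff_pow_of_natDegree_le (p := (1 - X : ℝ[X])) (m := n) (n := 1)
      ((natDegree_sub_le _ _).trans (by simp))
    rw [mul_one] at h
    rw [h]
    simp [coeff_one]
  -- The constant c matches the leading coefficients. Modulo lower degree, one factor of the squared
  -- norm may be replaced by c(1-X)^n.
  have hdeg : (jacobiPoly α β n - C c * (1 - X) ^ n).degree < (n : WithBot ℕ) := by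
    rw [degree_lt_iff_coeff_zero]
    intro m hm
    rw [coeff_sub, coeff_C_mul, coeff_jacobiPoly]
    rcases hm.eq_or_lt with h | h
    · subst h
      rw [hcoe, hc]
      linear_combination (-jacobiCoeff α β n n) * hsq
    · rw [jacobiCoeff_eq_zero h, coeff_eq_zero_of_natDegree_lt, mul_zero, sub_zero]
      refine lt_of_le_of_lt (natDegree_pow_le.trans ?_) h
      have : (1 - X : ℝ[X]).natDegree ≤ 1 := (natDegree_sub_le _ _).trans (by simp)
      nlinarith
  have h1 := jacobiFunctional_jacobiPoly_mul_of_degree_lt hα hβ hdeg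
  rw [mul_sub, jacobiFunctional_sub hα hβ, mul_left_comm, jacobiFunctional_C_mul,
    jacobiFunctional_jacobiPoly_mul_self_pow hα hβ hn, sub_eq_zero] at h1
  rw [jacobiNorm, h1, hc, jacobiCoeff_eq hα, Nat.choose_self, risingFac_succ]
  have h2 := risingFac_pos (by linarith : 0 < α + 1) n
  have h3 := risingFac_pos hσ n
  have h4 := Real.Gamma_pos_of_pos hσ
  have h5 : (n : ℝ) + (α + β + 1) + n ≠ 0 := by positivity
  have h6 : 2 * (n : ℝ) + (α + β + 1) = n + (α + β + 1) + n := by ring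
  rw [h6]
  push_cast
  field_simp
  linear_combination Real.Gamma (α + 1) * Real.Gamma (β + n + 1) * hsq

end Jacobi

/-! ### The reproducing kernel and the formula for the Sobolev polynomials. -/

/-- The polynomial `∑_{k<n} R_k^{(j)}(0)/j! R_k / ‖R_k‖²`, which represents the `j`-th coefficient
on polynomials of degree less than `n`. -/
def jacobiKernel (α β : ℝ) (j n : ℕ) : ℝ[X] :=
  ∑ k ∈ Finset.range n, C (jacobiCoeff α β k j / jacobiNorm α β k) * jacobiPoly α β k

section Kernel

variable {α β : ℝ}

lemma jacobiFunctional_jacobiPoly_mul_jacobiPoly (hα : -1 < α) (hβ : -1 < β) (k l : ℕ) :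
    jacobiFunctional α β (jacobiPoly α β k * jacobiPoly α β l)
      = if k = l then jacobiNorm α β k else 0 := by
  split_ifs with h
  · rw [h, jacobiNorm]
  · rcases lt_or_gt_of_ne h with h | h
    · rw [mul_comm]
      exact jacobiFunctional_jacobiPoly_mul_of_degree_lt hα hβ
        (by rw [degree_jacobiPoly hα hβ]; exact_mod_cast h)
    · exact jacobiFunctional_jacobiPoly_mul_of_degree_lt hα hβ
        (by rw [degree_jacobiPoly hα hβ]; exact_mod_cast h)

lemma exists_eq_sum_jacobiPoly (hα : -1 < α) (hβ : -1 < β) (n : ℕ) :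
    ∀ f : ℝ[X], f.degree < (n : WithBot ℕ) →
      ∃ c : ℕ → ℝ, f = ∑ k ∈ Finset.range n, C (c k) * jacobiPoly α β k := by
  induction n with
  | zero =>
    intro f hf
    refine ⟨0, ?_⟩
    have : f = 0 := by
      rw [← degree_eq_bot]
      simpa using hf
    simp [this]
  | succ n ih =>
    intro f hf
    have h0 := jacobiCoeff_self_ne_zero hα hβ n
    set a := f.coeff n / jacobiCoeff α β n n with ha
    have hdeg : (f - C a * jacobiPoly α β n).degree < (n : WithBot ℕ) := by
      rw [degree_lt_iff_coeff_zero]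
      intro m hm
      rw [coeff_sub, coeff_C_mul, coeff_jacobiPoly]
      rcases hm.eq_or_lt with h | h
      · subst h
        rw [ha, div_mul_cancel₀ _ h0, sub_self]
      · rw [jacobiCoeff_eq_zero h, mul_zero, sub_zero]
        exact (degree_lt_iff_coeff_zero f (n + 1)).1 hf m h
    obtain ⟨c, hc⟩ := ih _ hdeg
    refine ⟨fun k => if k = n then a else c k, ?_⟩
    beta_reduce
    rw [Finset.sum_range_succ, if_pos rfl, ← sub_eq_iff_eq_add, hc]
    refine Finset.sum_congr rfl fun k hk => ?_
    rw [if_neg (Finset.mem_range.1 hk).ne]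

lemma jacobiFunctional_jacobiKernel_mul (hα : -1 < α) (hβ : -1 < β) (j : ℕ) {n : ℕ} {f : ℝ[X]}
    (hf : f.degree < (n : WithBot ℕ)) :
    jacobiFunctional α β (jacobiKernel α β j n * f) = f.coeff j := by
  obtain ⟨c, rfl⟩ := exists_eq_sum_jacobiPoly hα hβ n f hf
  rw [jacobiKernel, Finset.sum_mul, jacobiFunctional_sum hα hβ, finsetSum_coeff]
  refine Finset.sum_congr rfl fun k hk => ?_
  rw [mul_assoc, jacobiFunctional_C_mul, Finset.mul_sum, jacobiFunctional_sum hα hβ]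
  have : ∀ l ∈ Finset.range n, jacobiFunctional α β (jacobiPoly α β k * (C (c l) * jacobiPoly α β l))
      = if k = l then c l * jacobiNorm α β k else 0 := fun l _ => by
    rw [mul_left_comm, jacobiFunctional_C_mul, jacobiFunctional_jacobiPoly_mul_jacobiPoly hα hβ]
    split_ifs <;> simp
  rw [Finset.sum_congr rfl this, Finset.sum_ite_eq, if_pos hk, coeff_C_mul, coeff_jacobiPoly]
  have := (jacobiNorm_pos hα hβ k).ne'
  field_simp

lemma coeff_jacobiKernel (j n i : ℕ) : (jacobiKernel α β j n).coeff i
    = ∑ k ∈ Finset.range n, jacobiCoeff α β k j / jacobiNorm α β k * jacobiCoeff α β k i := by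
  rw [jacobiKernel, finsetSum_coeff]
  simp only [coeff_C_mul, coeff_jacobiPoly]

lemma degree_jacobiKernel_lt (j n : ℕ) : (jacobiKernel α β j n).degree < (n : WithBot ℕ) := by
  rw [degree_lt_iff_coeff_zero]
  intro m hm
  rw [coeff_jacobiKernel]
  refine Finset.sum_eq_zero fun k hk => ?_
  rw [jacobiCoeff_eq_zero (lt_of_lt_of_le (Finset.mem_range.1 hk) hm), mul_zero]

lemma coeff_jacobiKernel_self_nonneg (hα : -1 < α) (hβ : -1 < β) (j n : ℕ) :
    0 ≤ (jacobiKernel α β j n).coeff j := by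
  rw [coeff_jacobiKernel]
  refine Finset.sum_nonneg fun k _ => ?_
  rw [div_mul_eq_mul_div]
  exact div_nonneg (mul_self_nonneg _) (jacobiNorm_pos hα hβ k).le

/-- An orthogonal polynomial of the discrete Sobolev form in terms of Jacobi polynomials. -/
lemma eq_jacobiPoly_sub_jacobiKernel (hα : -1 < α) (hβ : -1 < β) {j n : ℕ} {μ : ℝ} (hμ : 0 ≤ μ)
    {q : ℝ[X]} (hdeg : q.degree = n)
    (horth : ∀ f : ℝ[X], f.degree < (n : WithBot ℕ) →
      jacobiFunctional α β (q * f) + μ * q.coeff j * f.coeff j = 0) :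
    ∃ a, a ≠ 0 ∧ q = C a * (jacobiPoly α β n
      - C (μ * jacobiCoeff α β n j / (1 + μ * (jacobiKernel α β j n).coeff j))
        * jacobiKernel α β j n) := by
  have h0 := jacobiCoeff_self_ne_zero hα hβ n
  set k := jacobiKernel α β j n with hk
  -- Adding this multiple of the kernel absorbs the mass term, so `s` is orthogonal to all lower
  -- degrees and must be a multiple of the Jacobi polynomial.
  set s := q + C (μ * q.coeff j) * k with hs
  have hkn : k.coeff n = 0 := coeff_eq_zero_of_degree_lt (degree_jacobiKernel_lt j n)
  have hqn : q.coeff n ≠ 0 := coeff_ne_zero_of_eq_degree hdeg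
  set a := q.coeff n / jacobiCoeff α β n n with ha
  have ha0 : a ≠ 0 := div_ne_zero hqn h0
  have hsorth : ∀ f : ℝ[X], f.degree < (n : WithBot ℕ) → jacobiFunctional α β (s * f) = 0 := by
    intro f hf
    rw [hs, add_mul, jacobiFunctional_add hα hβ, mul_assoc, jacobiFunctional_C_mul,
      jacobiFunctional_jacobiKernel_mul hα hβ j hf]
    exact horth f hf
  have hd : (s - C a * jacobiPoly α β n).degree < (n : WithBot ℕ) := by
    rw [degree_lt_iff_coeff_zero]
    intro m hm
    rw [hs, coeff_sub, coeff_add, coeff_C_mul, coeff_C_mul, coeff_jacobiPoly]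
    rcases hm.eq_or_lt with h | h
    · subst h
      rw [hkn, ha, div_mul_cancel₀ _ h0]
      ring
    · have hnm : (n : WithBot ℕ) < m := by exact_mod_cast h
      rw [jacobiCoeff_eq_zero h, coeff_eq_zero_of_degree_lt (hdeg.trans_lt hnm),
        coeff_eq_zero_of_degree_lt ((degree_jacobiKernel_lt j n).trans hnm)]
      ring
  have hs0 : s = C a * jacobiPoly α β n := by
    rw [← sub_eq_zero]
    by_contra hne
    have hpos := jacobiFunctional_pos hα hβ (mul_ne_zero hne hne)
      (fun t _ => by rw [eval_mul]; exact mul_self_nonneg _)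
    rw [sub_mul s, jacobiFunctional_sub hα hβ, hsorth _ hd, mul_assoc, jacobiFunctional_C_mul,
      jacobiFunctional_jacobiPoly_mul_of_degree_lt hα hβ hd] at hpos
    simp at hpos
  have hq : q = C a * jacobiPoly α β n - C (μ * q.coeff j) * k := by
    rw [← hs0, hs, add_sub_cancel_right]
  have hK := coeff_jacobiKernel_self_nonneg hα hβ j n
  have hpos : 0 < 1 + μ * k.coeff j := by positivity
  -- The still unknown j-th coefficient of `q` is found by reading off the j-th coefficient of `hq`
  -- itself.
  have hqj : q.coeff j = a * jacobiCoeff α β n j / (1 + μ * k.coeff j) := by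
    have := congrArg (fun f => coeff f j) hq
    simp only [coeff_sub, coeff_C_mul, coeff_jacobiPoly] at this
    rw [eq_div_iff hpos.ne']
    linarith
  refine ⟨a, ha0, ?_⟩
  have : C (μ * q.coeff j) = C a * C (μ * jacobiCoeff α β n j / (1 + μ * k.coeff j)) := by
    rw [← C_mul, hqj]
    congr 1
    ring
  calc q = C a * jacobiPoly α β n - C (μ * q.coeff j) * k := hq
    _ = _ := by rw [this]; ring

end Kernel

/-! ### Sign changes and real zeros. -/

section Roots

/-- Strict alternation of the coefficients is used to correct a test polynomial so that its j-th
coefficient vanishes. -/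
lemma coeff_prod_C_sub_X (S : Finset ℝ) (hS : ∀ s ∈ S, 0 < s) :
    (∀ i ≤ S.card, 0 < (-1) ^ i * (∏ s ∈ S, (C s - X)).coeff i) ∧
      ∀ i, S.card < i → (∏ s ∈ S, (C s - X)).coeff i = 0 := by
  induction S using Finset.induction_on with
  | empty =>
    simp only [Finset.card_empty, Finset.prod_empty, coeff_one]
    refine ⟨fun i hi => ?_, fun i hi => ?_⟩
    · simp [Nat.le_zero.1 hi]
    · simp [hi.ne']
  | insert a S ha ih =>
    obtain ⟨h1, h2⟩ := ih fun s hs => hS s (Finset.mem_insert_of_mem hs)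
    have ha0 := hS a (Finset.mem_insert_self a S)
    rw [Finset.prod_insert ha, Finset.card_insert_of_notMem ha]
    set P := ∏ s ∈ S, (C s - X) with hP
    have hc0 : ((C a - X) * P).coeff 0 = a * P.coeff 0 := by
      simp [sub_mul]
    have hc : ∀ i, ((C a - X) * P).coeff (i + 1) = a * P.coeff (i + 1) - P.coeff i := fun i => by
      rw [sub_mul, coeff_sub, coeff_C_mul, coeff_X_mul]
    refine ⟨fun i hi => ?_, fun i hi => ?_⟩
    · cases i with
      | zero =>
        rw [hc0]
        have := h1 0 (Nat.zero_le _)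
        simp only [pow_zero, one_mul] at this ⊢
        positivity
      | succ i =>
        rw [hc]
        have h3 := h1 i (by omega)
        have h4 : 0 ≤ (-1) ^ (i + 1) * P.coeff (i + 1) := by
          rcases Nat.lt_or_ge S.card (i + 1) with h | h
          · rw [h2 _ h, mul_zero]
          · exact (h1 _ h).le
        have h5 : (-1 : ℝ) ^ (i + 1) * (a * P.coeff (i + 1) - P.coeff i)
            = a * ((-1) ^ (i + 1) * P.coeff (i + 1)) + (-1) ^ i * P.coeff i := by
          rw [pow_succ]; ring
        rw [h5]
        positivity
    · cases i with
      | zero => omega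
      | succ i => rw [hc, h2 _ (by omega), h2 _ (by omega)]; simp

/-- Splitting off the sign changes of a polynomial in `(0, 1)`. -/
lemma exists_sign_change_decomposition (n : ℕ) : ∀ q : ℝ[X], q ≠ 0 → q.natDegree = n →
    ∃ (S : Finset ℝ) (u v : ℝ[X]), (∀ s ∈ S, s ∈ Ioo (0 : ℝ) 1) ∧
      q = (∏ s ∈ S, (C s - X)) * u ^ 2 * v ∧ ∀ t ∈ Ioo (0 : ℝ) 1, v.eval t ≠ 0 := by
  induction n using Nat.strong_induction_on with
  | _ n ih =>
    intro q hq hn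
    by_cases h : ∀ t ∈ Ioo (0 : ℝ) 1, q.eval t ≠ 0
    · exact ⟨∅, 1, q, by simp, by simp, h⟩
    · push Not at h
      obtain ⟨r, hr, hr0⟩ := h
      obtain ⟨q', hq'⟩ := dvd_iff_isRoot.2 (show q.IsRoot r from hr0)
      have hq0 : q' ≠ 0 := by
        rintro rfl
        exact hq (by rw [hq', mul_zero])
      have hdeg : q'.natDegree < n := by
        rw [← hn, hq', natDegree_mul (X_sub_C_ne_zero r) hq0, natDegree_X_sub_C]
        omega
      obtain ⟨S, u, v, hS, he, hv⟩ := ih _ hdeg q' hq0 rfl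
      -- A root that already occurs in S pairs with its earlier occurrence into a square; otherwise
      -- it is a new sign change. In both cases the sign goes into v.
      by_cases hrS : r ∈ S
      · refine ⟨S.erase r, u * (C r - X), -v, fun s hs => hS s (Finset.mem_of_mem_erase hs), ?_,
          fun t ht => by rw [eval_neg]; exact neg_ne_zero.2 (hv t ht)⟩
        rw [hq', he, ← Finset.mul_prod_erase S _ hrS]
        ring
      · refine ⟨insert r S, u, -v, fun s hs => ?_, ?_,
          fun t ht => by rw [eval_neg]; exact neg_ne_zero.2 (hv t ht)⟩
        · rcases Finset.mem_insert.1 hs with rfl | hs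
          · exact hr
          · exact hS s hs
        · rw [hq', he, Finset.prod_insert hrS]
          ring

lemma eval_pos_or_neg_of_ne_zero {v : ℝ[X]} (hv : ∀ t ∈ Ioo (0 : ℝ) 1, v.eval t ≠ 0) :
    (∀ t ∈ Ioo (0 : ℝ) 1, 0 < v.eval t) ∨ ∀ t ∈ Ioo (0 : ℝ) 1, v.eval t < 0 := by
  by_contra! h
  obtain ⟨⟨s, hs, hs0⟩, ⟨t, ht, ht0⟩⟩ := h
  obtain ⟨x, hx, hx0⟩ := isPreconnected_Ioo.intermediate_value hs ht (f := fun x => v.eval x)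
    v.continuous.continuousOn ⟨hs0, ht0⟩
  exact hv x hx hx0

/-- T has at most one element more than the set S of positive roots, so only its smallest element
can fail to be positive. -/
lemma exists_enumeration {q : ℝ[X]} {S T : Finset ℝ} {a : ℝ} {n : ℕ} (ha : a ≠ 0)
    (hq : q = C a * ∏ s ∈ T, (C s - X)) (hT : T.card = n) (hS : ∀ s ∈ S, 0 < s)
    (hST : S ⊆ T) (hcard : n ≤ S.card + 1) :
    ∃ w : ℕ → ℝ, StrictMonoOn w (Icc 1 n) ∧ (∀ k, 1 < k → k ≤ n → 0 < w k) ∧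
      ∃ l, l ≠ 0 ∧ ∀ x, q.eval x = l * ∏ k ∈ Finset.Icc 1 n, (w k - x) := by
  set e := T.orderEmbOfFin hT with he
  set w : ℕ → ℝ := fun k => if h : 1 ≤ k ∧ k ≤ n then e ⟨k - 1, by omega⟩ else 0 with hw
  have hwe : ∀ k (h1 : 1 ≤ k) (h2 : k ≤ n), w k = e ⟨k - 1, by omega⟩ := fun k h1 h2 => by
    simp [hw, h1, h2]
  have hmono : StrictMonoOn w (Icc 1 n) := by
    intro k hk l hl hkl
    rw [hwe k hk.1 hk.2, hwe l hl.1 hl.2]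
    refine e.strictMono (Fin.mk_lt_mk.2 ?_)
    have := hk.1
    omega
  have hmem : ∀ k ∈ Finset.Icc 1 n, w k ∈ T := fun k hk => by
    rw [Finset.mem_Icc] at hk
    rw [hwe k hk.1 hk.2]
    exact T.orderEmbOfFin_mem hT _
  have himage : (Finset.Icc 1 n).image w = T := by
    refine Finset.eq_of_subset_of_card_le (Finset.image_subset_iff.2 hmem) ?_
    rw [Finset.card_image_of_injOn]
    · simp [hT]
    · rw [Finset.coe_Icc]
      exact hmono.injOn
  refine ⟨w, hmono, fun k hk hkn => ?_, a, ha, fun x => ?_⟩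
  · by_contra! h0
    have h1 := hmono ⟨le_rfl, by omega⟩ ⟨hk.le, hkn⟩ hk
    have hsub : ({w 1, w k} : Finset ℝ) ⊆ T \ S := by
      intro x hx
      rw [Finset.mem_insert, Finset.mem_singleton] at hx
      rw [Finset.mem_sdiff]
      rcases hx with rfl | rfl
      · exact ⟨hmem 1 (Finset.mem_Icc.2 ⟨le_rfl, by omega⟩), fun h => by linarith [hS _ h]⟩
      · exact ⟨hmem k (Finset.mem_Icc.2 ⟨hk.le, hkn⟩), fun h => by linarith [hS _ h]⟩
    have h2 := Finset.card_le_card hsub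
    rw [Finset.card_pair h1.ne, Finset.card_sdiff_of_subset hST] at h2
    omega
  · rw [hq, eval_mul, eval_C, eval_prod, ← himage, Finset.prod_image]
    · simp
    · rw [Finset.coe_Icc]
      exact hmono.injOn

/-- A polynomial of degree `n` orthogonal to all polynomials of smaller degree whose `j`-th
coefficient vanishes has `n` distinct real roots, at most one of which is not positive. -/
theorem exists_roots_of_orthogonal {α β : ℝ} (hα : -1 < α) (hβ : -1 < β) {j n : ℕ} (hj : 1 ≤ j)
    {q : ℝ[X]} (hdeg : q.degree = n)
    (horth : ∀ f : ℝ[X], f.degree < (n : WithBot ℕ) → f.coeff j = 0 →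
      jacobiFunctional α β (q * f) = 0) :
    ∃ w : ℕ → ℝ, StrictMonoOn w (Icc 1 n) ∧ (∀ k, 1 < k → k ≤ n → 0 < w k) ∧
      ∃ l, l ≠ 0 ∧ ∀ x, q.eval x = l * ∏ k ∈ Finset.Icc 1 n, (w k - x) := by
  have hq0 : q ≠ 0 := by
    rintro rfl
    simp at hdeg
  have hnat : q.natDegree = n := natDegree_eq_of_degree_eq_some hdeg
  obtain ⟨S, u, v, hS, he, hv⟩ := exists_sign_change_decomposition n q hq0 hnat
  set P := ∏ s ∈ S, (C s - X) with hP
  have hP0 : P ≠ 0 := by rintro h; exact hq0 (by rw [he, h]; simp)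
  have hu0 : u ≠ 0 := by rintro h; exact hq0 (by rw [he, h]; simp)
  have hv0 : v ≠ 0 := by rintro h; exact hq0 (by rw [he, h]; simp)
  obtain ⟨hc1, hc2⟩ := coeff_prod_C_sub_X S fun s hs => (hS s hs).1
  have hPdeg : P.natDegree = S.card := by
    refine le_antisymm (natDegree_le_iff_coeff_eq_zero.2 hc2) (le_natDegree_of_ne_zero fun h => ?_)
    have := hc1 S.card le_rfl
    rw [h, mul_zero] at this
    exact lt_irrefl _ this
  have hsum : n = S.card + 2 * u.natDegree + v.natDegree := by
    rw [← hnat, he, natDegree_mul (mul_ne_zero hP0 (pow_ne_zero 2 hu0)) hv0,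
      natDegree_mul hP0 (pow_ne_zero 2 hu0), natDegree_pow, hPdeg]
  have hcontra : ∀ g : ℝ[X], g ≠ 0 → (∀ t ∈ Ioo (0 : ℝ) 1, 0 ≤ g.eval t) →
      jacobiFunctional α β (q * (P * g)) ≠ 0 := by
    intro g hg0 hg
    have hne : q * (P * g) ≠ 0 := mul_ne_zero hq0 (mul_ne_zero hP0 hg0)
    have hev : ∀ t, (q * (P * g)).eval t
        = (P.eval t * u.eval t) ^ 2 * g.eval t * v.eval t := fun t => by
      rw [he]
      simp only [eval_mul, eval_pow]
      ring
    rcases eval_pos_or_neg_of_ne_zero hv with h | h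
    · refine (jacobiFunctional_pos hα hβ hne fun t ht => ?_).ne'
      rw [hev]
      exact mul_nonneg (mul_nonneg (sq_nonneg _) (hg t ht)) (h t ht).le
    · have h2 := jacobiFunctional_pos hα hβ (f := C (-1) * (q * (P * g)))
        (mul_ne_zero (by simp) hne) fun t ht => by
          rw [eval_mul, eval_C, hev]
          have := mul_nonneg (mul_nonneg (sq_nonneg (P.eval t * u.eval t)) (hg t ht))
            (neg_nonneg.2 (h t ht).le)
          linarith
      rw [jacobiFunctional_C_mul] at h2
      intro h3
      rw [h3, mul_zero] at h2
      exact lt_irrefl _ h2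
  -- With fewer than n-1 sign changes there is an admissible test polynomial P·g, with g positive on
  -- (0,1), against which q does not change sign there.
  have hcard : n ≤ S.card + 1 := by
    by_contra! hlt
    rcases Nat.lt_or_ge S.card j with h | h
    · refine hcontra 1 one_ne_zero (by simp) ?_
      rw [mul_one]
      refine horth P ?_ (hc2 j h)
      rw [degree_eq_natDegree hP0, hPdeg]
      exact_mod_cast (by omega : S.card < n)
    · have h1 := hc1 j h
      have h2 := hc1 (j - 1) (by omega)
      have hPj : P.coeff j ≠ 0 := by
        intro h0
        rw [h0, mul_zero] at h1
        exact lt_irrefl _ h1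
      -- The value of d that makes the j-th coefficient of P·(X+d) vanish. Alternation makes d
      -- positive, so X+d adds no sign change on (0,1).
      set d := -P.coeff (j - 1) / P.coeff j with hd
      have hdpos : 0 < d := by
        have e1 : d = ((-1) ^ (j - 1) * P.coeff (j - 1)) / ((-1) ^ j * P.coeff j) := by
          obtain ⟨i, rfl⟩ : ∃ i, j = i + 1 := ⟨j - 1, by omega⟩
          rw [hd, pow_succ, Nat.add_sub_cancel]
          have : (-1 : ℝ) ^ i ≠ 0 := pow_ne_zero _ (by norm_num)
          field_simp
        rw [e1]
        exact div_pos h2 h1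
      have hX0 : (X + C d : ℝ[X]) ≠ 0 := X_add_C_ne_zero d
      refine hcontra (X + C d) hX0 (fun t ht => by simp; linarith [ht.1]) (horth _ ?_ ?_)
      · rw [degree_eq_natDegree (mul_ne_zero hP0 hX0), natDegree_mul hP0 hX0, hPdeg,
          natDegree_X_add_C]
        exact_mod_cast hlt
      · obtain ⟨i, rfl⟩ : ∃ i, j = i + 1 := ⟨j - 1, by omega⟩
        rw [mul_add, coeff_add, coeff_mul_X, coeff_mul_C, hd, Nat.add_sub_cancel]
        field_simp
        ring
  -- The degree count leaves u constant and v of degree at most 1. A root of a linear v lies outside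
  -- (0,1), hence differs from the elements of S.
  have hu1 : u.natDegree = 0 := by omega
  obtain ⟨c, hc⟩ := natDegree_eq_zero.1 hu1
  have hc0 : c ≠ 0 := by
    rintro rfl
    exact hu0 (by rw [← hc, C_0])
  have hSpos : ∀ s ∈ S, 0 < s := fun s hs => (hS s hs).1
  by_cases hv1 : v.natDegree = 0
  · obtain ⟨b, hb⟩ := natDegree_eq_zero.1 hv1
    have hb0 : b ≠ 0 := by
      rintro rfl
      exact hv0 (by rw [← hb, C_0])
    refine exists_enumeration (S := S) (T := S) (a := c ^ 2 * b)
      (mul_ne_zero (pow_ne_zero 2 hc0) hb0) ?_ (by omega) hSpos subset_rfl hcard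
    rw [he, ← hc, ← hb, C_mul, C_pow]
    ring
  · have hv2 : v.natDegree = 1 := by omega
    obtain ⟨a, ha, b, hb⟩ := natDegree_eq_one.1 hv2
    have hroot : v = C (-a) * (C (-b / a) - X) := by
      rw [← hb, mul_sub, ← C_mul, C_neg]
      have : -a * (-b / a) = b := by field_simp
      rw [this]
      ring
    have hnot : -b / a ∉ S := by
      intro h
      refine hv _ (hS _ h) ?_
      rw [hroot]
      simp
    refine exists_enumeration (S := S) (T := insert (-b / a) S) (a := c ^ 2 * -a)
      (mul_ne_zero (pow_ne_zero 2 hc0) (neg_ne_zero.2 ha)) ?_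
      (by rw [Finset.card_insert_of_notMem hnot]; omega) hSpos (Finset.subset_insert _ _) hcard
    rw [he, ← hc, Finset.prod_insert hnot, hroot, C_mul, C_pow]
    ring

end Roots

/-! ### Gamma quotients, Stolz–Cesàro, and asymptotics of Jacobi coefficients and norms. -/

lemma summable_prod_range {d : ℕ → ℝ} (hd : Tendsto d atTop (𝓝 0)) :
    Summable fun l => ∏ s ∈ Finset.range l, d s := by
  refine summable_of_ratio_norm_eventually_le (r := 1 / 2) (by norm_num) ?_
  have h := hd.norm.eventually (gt_mem_nhds (by simp : ‖(0 : ℝ)‖ < 1 / 2))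
  filter_upwards [h] with n hn
  rw [Finset.prod_range_succ, norm_mul, mul_comm]
  gcongr

lemma tendsto_Gamma_ratio_of_pos {s : ℝ} (hs : 0 < s) :
    Tendsto (fun n : ℕ => Real.Gamma (s + n + 1) / ((n : ℝ) ^ s * n.factorial)) atTop (𝓝 1) := by
  have hG := Real.Gamma_pos_of_pos hs
  have h := (tendsto_const_nhds (x := Real.Gamma s)).div (Real.GammaSeq_tendsto_Gamma s) hG.ne'
  rw [div_self hG.ne'] at h
  refine h.congr' ?_
  filter_upwards [eventually_ge_atTop 1] with n hn
  have hn' : (0 : ℝ) < n := by exact_mod_cast hn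
  have h1 : 0 < (n : ℝ) ^ s := Real.rpow_pos_of_pos hn' s
  have h2 : Real.Gamma (s + n + 1) = risingFac s (n + 1) * Real.Gamma s := by
    rw [← Gamma_add_nat hs (n + 1)]
    push_cast
    rw [add_assoc]
  have h3 := risingFac_pos hs (n + 1)
  have h4 : (0 : ℝ) < n.factorial := by positivity
  rw [Pi.div_apply, Real.GammaSeq, h2]
  change _ / (_ / risingFac s (n + 1)) = _
  field_simp

lemma tendsto_natCast_div_add (c : ℝ) :
    Tendsto (fun n : ℕ => (n : ℝ) / (n + c)) atTop (𝓝 1) := by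
  have h := (tendsto_const_div_atTop_nhds_zero_nat c).const_add 1
  rw [add_zero] at h
  have h2 := h.inv₀ one_ne_zero
  rw [inv_one] at h2
  refine h2.congr' ?_
  filter_upwards [eventually_ge_atTop 1] with n hn
  have hn' : (n : ℝ) ≠ 0 := by positivity
  rw [one_add_div hn', inv_div]

/-- Euler's limit covers s > 0, and the functional equation is used twice to reach s > -2, as needed
for s = α + β. -/
lemma tendsto_Gamma_ratio {s : ℝ} (hs : -2 < s) :
    Tendsto (fun n : ℕ => Real.Gamma (s + n + 1) / ((n : ℝ) ^ s * n.factorial)) atTop (𝓝 1) := by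
  have hshift : ∀ s : ℝ, -2 < s →
      Tendsto (fun n : ℕ => Real.Gamma (s + 1 + n + 1) / ((n : ℝ) ^ (s + 1) * n.factorial))
        atTop (𝓝 1) →
      Tendsto (fun n : ℕ => Real.Gamma (s + n + 1) / ((n : ℝ) ^ s * n.factorial)) atTop (𝓝 1) := by
    intro s hs h
    have h2 := h.mul (tendsto_natCast_div_add (s + 1))
    rw [mul_one] at h2
    refine h2.congr' ?_
    filter_upwards [eventually_ge_atTop 1] with n hn
    have hn' : (1 : ℝ) ≤ n := by exact_mod_cast hn
    have hn0 : (0 : ℝ) < n := by linarith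
    have h1 : 0 < (n : ℝ) ^ s := Real.rpow_pos_of_pos hn0 s
    have h3 : 0 < s + n + 1 := by linarith
    rw [show s + 1 + n + 1 = s + n + 1 + 1 by ring, Real.Gamma_add_one h3.ne',
      Real.rpow_add hn0, Real.rpow_one, show (n : ℝ) + (s + 1) = s + n + 1 by ring]
    field_simp
  exact hshift s hs (hshift (s + 1) (by linarith) (tendsto_Gamma_ratio_of_pos (by linarith)))

/-- After factoring out k^p this is the difference quotient of x^p at 1 with increment 1/k. -/
lemma tendsto_rpow_succ_sub (p : ℝ) :
    Tendsto (fun k : ℕ => (((k : ℝ) + 1) ^ p - (k : ℝ) ^ p) / (k : ℝ) ^ (p - 1)) atTop (𝓝 p) := by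
  have hd : HasDerivAt (fun x : ℝ => x ^ p) p 1 := by
    have := Real.hasDerivAt_rpow_const (x := 1) (p := p) (Or.inl one_ne_zero)
    simpa using this
  have h1 := hasDerivAt_iff_tendsto_slope.1 hd
  have h2 : Tendsto (fun k : ℕ => 1 + 1 / (k : ℝ)) atTop (𝓝[≠] 1) := by
    refine tendsto_nhdsWithin_iff.2 ⟨?_, ?_⟩
    · simpa using (tendsto_const_div_atTop_nhds_zero_nat (1 : ℝ)).const_add 1
    · filter_upwards [eventually_ge_atTop 1] with k hk
      have : (0 : ℝ) < k := by exact_mod_cast hk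
      simp [this.ne']
  refine (h1.comp h2).congr' ?_
  filter_upwards [eventually_ge_atTop 1] with k hk
  have hk0 : (0 : ℝ) < k := by exact_mod_cast hk
  have e1 : (k : ℝ) + 1 = k * (1 + 1 / k) := by field_simp
  have h3 : 0 < (k : ℝ) ^ p := Real.rpow_pos_of_pos hk0 p
  rw [Function.comp_apply, slope_def_field, e1, Real.mul_rpow hk0.le (by positivity),
    Real.rpow_sub hk0, Real.rpow_one, Real.one_rpow]
  field_simp
  ring

/-- Stolz–Cesàro for power weights. -/
lemma tendsto_sum_div_rpow {a : ℕ → ℝ} {c p : ℝ} (hp : 0 < p)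
    (ha : Tendsto (fun k : ℕ => a k / (k : ℝ) ^ (p - 1)) atTop (𝓝 c)) :
    Tendsto (fun n : ℕ => (∑ k ∈ Finset.range n, a k) / (n : ℝ) ^ p) atTop (𝓝 (c / p)) := by
  set g : ℕ → ℝ := fun k => ((k : ℝ) + 1) ^ p - (k : ℝ) ^ p with hg
  have hgpos : ∀ k, 0 < g k := fun k => by
    have : (k : ℝ) ^ p < ((k : ℝ) + 1) ^ p := Real.rpow_lt_rpow (by positivity) (by linarith) hp
    simp only [hg]
    linarith
  have hgsum : ∀ n, ∑ k ∈ Finset.range n, g k = (n : ℝ) ^ p := fun n => by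
    have := Finset.sum_range_sub (fun k : ℕ => (k : ℝ) ^ p) n
    simp only [Nat.cast_zero, Real.zero_rpow hp.ne', sub_zero, Nat.cast_add, Nat.cast_one] at this
    exact this
  have hgt := tendsto_rpow_succ_sub p
  -- The increments g of k^p telescope, so it suffices that a - (c/p)g is o(g); this is preserved by
  -- summation because ∑ g diverges.
  have hlittle : (fun k => a k - c / p * g k) =o[atTop] g := by
    refine Asymptotics.isLittleO_of_tendsto (fun k hk => absurd hk (hgpos k).ne') ?_
    have h1 := (ha.div hgt hp.ne').sub_const (c / p)
    rw [sub_self] at h1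
    refine h1.congr' ?_
    filter_upwards [eventually_ge_atTop 1] with k hk
    have hk0 : (0 : ℝ) < k := by exact_mod_cast hk
    have h3 : 0 < (k : ℝ) ^ (p - 1) := Real.rpow_pos_of_pos hk0 _
    have h4 := (hgpos k).ne'
    simp only [Pi.div_apply]
    change a k / (k : ℝ) ^ (p - 1) / (g k / (k : ℝ) ^ (p - 1)) - c / p = _
    field_simp
  have hinf : Tendsto (fun n => ∑ k ∈ Finset.range n, g k) atTop atTop := by
    simp only [hgsum]
    exact (tendsto_rpow_atTop hp).comp tendsto_natCast_atTop_atTop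
  have hs := hlittle.sum_range (fun k => (hgpos k).le) hinf
  have ht := hs.tendsto_div_nhds_zero
  have h5 := ht.add_const (c / p)
  rw [zero_add] at h5
  refine h5.congr' ?_
  filter_upwards [eventually_ge_atTop 1] with n hn
  have hn0 : (0 : ℝ) < n := by exact_mod_cast hn
  have h3 : 0 < (n : ℝ) ^ p := Real.rpow_pos_of_pos hn0 _
  rw [hgsum, Finset.sum_sub_distrib, ← Finset.mul_sum, hgsum]
  field_simp
  ring

section Jacobi

variable {α β : ℝ}

lemma tendsto_jacobiNorm (hα : -1 < α) (hβ : -1 < β) :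
    Tendsto (fun n : ℕ => jacobiNorm α β n * (n : ℝ) ^ (2 * α + 1)) atTop
      (𝓝 (Real.Gamma (α + 1) ^ 2 / 2)) := by
  have h1 := tendsto_Gamma_ratio (s := β) (by linarith)
  have h2 := tendsto_Gamma_ratio (s := α + β) (by linarith)
  have h3 := tendsto_Gamma_ratio (s := α) (by linarith)
  have h4 := (tendsto_natCast_div_add ((α + β + 1) / 2))
  have h := (((h1.div (h2.mul h3) (by norm_num)).mul h4).const_mul (Real.Gamma (α + 1) ^ 2 / 2))
  norm_num at h
  refine h.congr' ?_
  filter_upwards [eventually_ge_atTop 1] with n hn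
  have hn' : (1 : ℝ) ≤ n := by exact_mod_cast hn
  have hn0 : (0 : ℝ) < n := by linarith
  have hσ : 0 < (n : ℝ) + (α + β + 1) := by linarith
  have hG1 := Real.Gamma_pos_of_pos hσ
  have hG2 := Real.Gamma_pos_of_pos (by linarith : 0 < α + 1)
  have hG3 := risingFac_pos (by linarith : 0 < α + 1) n
  have hf : (0 : ℝ) < n.factorial := by positivity
  have hp1 := Real.rpow_pos_of_pos hn0 α
  have hp2 := Real.rpow_pos_of_pos hn0 β
  have hσ2 : (n : ℝ) * 2 + (α + β + 1) ≠ 0 := by linarith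
  rw [jacobiNorm_eq hα hβ hn, show α + (n : ℝ) + 1 = α + 1 + n by ring,
    Gamma_add_nat (by linarith : 0 < α + 1), show α + β + (n : ℝ) + 1 = n + (α + β + 1) by ring,
    show β + (n : ℝ) + 1 = β + n + 1 by ring, Real.rpow_add hn0 α β,
    Real.rpow_add hn0 (2 * α) 1, Real.rpow_one, two_mul α, Real.rpow_add hn0 α α]
  have e : (n : ℝ) + (α + β + 1) / 2 = (n * 2 + (α + β + 1)) / 2 := by ring
  rw [e, mul_comm (2 : ℝ) (n : ℝ)]
  field_simp

/-- The limits of `jacobiCoeff α β n i / n^(2i)`. -/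
def jacobiCoeffLim (α : ℝ) (i : ℕ) : ℝ :=
  ∏ s ∈ Finset.range i, (-1 / ((α + 1 + s) * ((s : ℝ) + 1)))

lemma jacobiCoeffLim_ne_zero (hα : -1 < α) (i : ℕ) : jacobiCoeffLim α i ≠ 0 := by
  refine Finset.prod_ne_zero_iff.2 fun s _ => ?_
  have : 0 < α + 1 + s := by have := s.cast_nonneg (α := ℝ); linarith
  exact div_ne_zero (by norm_num) (by positivity)

lemma jacobiCoeffLim_eq (hα : -1 < α) (i : ℕ) :
    jacobiCoeffLim α i = (-1) ^ i / (risingFac (α + 1) i * i.factorial) := by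
  induction i with
  | zero => simp [jacobiCoeffLim, risingFac]
  | succ i ih =>
    rw [jacobiCoeffLim, Finset.prod_range_succ, ← jacobiCoeffLim, ih, risingFac_succ,
      Nat.factorial_succ, pow_succ]
    have h1 := risingFac_pos (by linarith : 0 < α + 1) i
    have : 0 < α + 1 + i := by have := i.cast_nonneg (α := ℝ); linarith
    push_cast
    field_simp

lemma tendsto_jacobiCoeff (i : ℕ) :
    Tendsto (fun n : ℕ => jacobiCoeff α β n i / (n : ℝ) ^ (2 * i)) atTop
      (𝓝 (jacobiCoeffLim α i)) := by
  have hfac : ∀ s : ℕ, Tendsto (fun n : ℕ => (((s : ℝ) - n) * (n + (α + β + 1) + s)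
      / ((α + 1 + s) * (s + 1))) / (n : ℝ) ^ 2) atTop (𝓝 (-1 / ((α + 1 + s) * ((s : ℝ) + 1)))) := by
    intro s
    have h1 := (tendsto_const_div_atTop_nhds_zero_nat (s : ℝ)).sub_const 1
    have h2 := (tendsto_const_div_atTop_nhds_zero_nat ((α + β + 1) + s)).const_add 1
    have h3 := (h1.mul h2).div_const ((α + 1 + s) * ((s : ℝ) + 1))
    rw [zero_sub, add_zero, mul_one] at h3
    refine h3.congr' ?_
    filter_upwards [eventually_ge_atTop 1] with n hn
    have hn0 : (n : ℝ) ≠ 0 := by positivity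
    rw [div_right_comm]
    congr 1
    field_simp
    ring
  refine (tendsto_finsetProd (Finset.range i) fun s _ => hfac s).congr fun n => ?_
  rw [Finset.prod_div_distrib, jacobiCoeff, Finset.prod_const, Finset.card_range, pow_mul]

lemma abs_jacobiCoeff_le_of_le (hα : -1 < α) (hβ : -1 < β) {k n : ℕ} (hk : 1 ≤ k) (hkn : k ≤ n)
    (i : ℕ) : |jacobiCoeff α β k i| ≤ |jacobiCoeff α β n i| := by
  rcases Nat.lt_or_ge k i with h | h
  · rw [jacobiCoeff_eq_zero h, abs_zero]
    exact abs_nonneg _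
  · rw [jacobiCoeff, jacobiCoeff, Finset.abs_prod, Finset.abs_prod]
    refine Finset.prod_le_prod (fun s _ => abs_nonneg _) fun s hs => ?_
    have hs' : ((s : ℝ) + 1) ≤ k := by
      have := Finset.mem_range.1 hs
      exact_mod_cast (by omega : s + 1 ≤ k)
    have hk' : (1 : ℝ) ≤ k := by exact_mod_cast hk
    have hkn' : (k : ℝ) ≤ n := by exact_mod_cast hkn
    have hs0 := s.cast_nonneg (α := ℝ)
    rw [abs_div, abs_div, abs_mul ((s : ℝ) - k), abs_mul ((s : ℝ) - n),
      abs_of_nonpos (by linarith : (s : ℝ) - k ≤ 0), abs_of_nonpos (by linarith : (s : ℝ) - n ≤ 0),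
      abs_of_nonneg (by linarith : 0 ≤ (k : ℝ) + (α + β + 1) + s),
      abs_of_nonneg (by linarith : 0 ≤ (n : ℝ) + (α + β + 1) + s)]
    refine div_le_div_of_nonneg_right ?_ (abs_nonneg _)
    exact mul_le_mul (by linarith) (by linarith) (by linarith) (by linarith)

/-- A dominating sequence for the scaled coefficients of the Jacobi polynomials. -/
def jacobiBound (α β : ℝ) (i : ℕ) : ℝ :=
  ∏ s ∈ Finset.range i, ((2 + |α + β + 1|) / 4 / ((α + 1 + s) * ((s : ℝ) + 1)))

lemma jacobiBound_nonneg (hα : -1 < α) (i : ℕ) : 0 ≤ jacobiBound α β i := by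
  refine Finset.prod_nonneg fun s _ => ?_
  have : 0 < α + 1 + s := by have := s.cast_nonneg (α := ℝ); linarith
  positivity

/-- For s < n one has (n-s)(n+σ+s) ≤ (2+|σ|)n² with σ = α+β+1. This is the source of the constant in
`jacobiBound`, which is independent of n. -/
lemma abs_jacobiCoeff_div_le (hα : -1 < α) (hβ : -1 < β) {n : ℕ} (hn : 1 ≤ n) (i : ℕ) :
    |jacobiCoeff α β n i / (4 * (n : ℝ) ^ 2) ^ i| ≤ jacobiBound α β i := by
  have hn' : (1 : ℝ) ≤ n := by exact_mod_cast hn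
  rcases Nat.lt_or_ge n i with h | h
  · rw [jacobiCoeff_eq_zero h, zero_div, abs_zero]
    exact jacobiBound_nonneg hα i
  · have e : (4 * (n : ℝ) ^ 2) ^ i = ∏ _s ∈ Finset.range i, (4 * (n : ℝ) ^ 2) := by simp
    rw [e, jacobiCoeff, ← Finset.prod_div_distrib, Finset.abs_prod, jacobiBound]
    refine Finset.prod_le_prod (fun s _ => abs_nonneg _) fun s hs => ?_
    have hs' : ((s : ℝ) + 1) ≤ n := by
      have := Finset.mem_range.1 hs
      exact_mod_cast (by omega : s + 1 ≤ n)
    have hs0 := s.cast_nonneg (α := ℝ)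
    have hd : 0 < (α + 1 + s) * ((s : ℝ) + 1) := mul_pos (by linarith) (by linarith)
    rw [abs_div, abs_div, abs_mul, abs_of_nonpos (by linarith : (s : ℝ) - n ≤ 0),
      abs_of_nonneg (by linarith : 0 ≤ (n : ℝ) + (α + β + 1) + s), abs_of_pos hd,
      abs_of_pos (by positivity), div_right_comm]
    refine div_le_div_of_nonneg_right ?_ hd.le
    rw [div_le_div_iff₀ (by positivity) (by norm_num)]
    have h1 : α + β + 1 ≤ |α + β + 1| * n := by
      have := le_abs_self (α + β + 1)
      have h2 := abs_nonneg (α + β + 1)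
      nlinarith
    have h3 : -((s : ℝ) - n) * (n + (α + β + 1) + s) ≤ n * ((2 + |α + β + 1|) * n) :=
      mul_le_mul (by linarith) (by linarith) (by linarith) (by linarith)
    nlinarith

lemma tendsto_const_div_add_mul (c a : ℝ) :
    Tendsto (fun s : ℕ => c / ((a + s) * ((s : ℝ) + 1))) atTop (𝓝 0) := by
  refine tendsto_const_nhds.div_atTop ?_
  exact (tendsto_atTop_add_const_left _ _ tendsto_natCast_atTop_atTop).atTop_mul_atTop₀
    (tendsto_atTop_add_const_right _ _ tendsto_natCast_atTop_atTop)

lemma entireCoeff_jacobiBound (hα : -1 < α) : EntireCoeff (jacobiBound α β) := by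
  intro r _
  have h := summable_prod_range (tendsto_const_div_add_mul ((2 + |α + β + 1|) / 4 * r) (α + 1))
  refine h.congr fun l => ?_
  rw [abs_of_nonneg (jacobiBound_nonneg hα l), jacobiBound]
  have e : r ^ l = ∏ _s ∈ Finset.range l, r := by simp
  rw [e, ← Finset.prod_mul_distrib]
  exact Finset.prod_congr rfl fun s _ => by ring

lemma jacobiBound_mul_factorial_le (hα : -1 < α) {ε : ℝ} (hε : 0 < ε) :
    ∃ K, ∀ l, jacobiBound α β l * (l.factorial : ℝ) ≤ K * ε ^ l := by
  have hd : Tendsto (fun s : ℕ => (2 + |α + β + 1|) / 4 / ε / (α + 1 + (s : ℝ))) atTop (𝓝 0) :=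
    tendsto_const_nhds.div_atTop
      (tendsto_atTop_add_const_left _ _ tendsto_natCast_atTop_atTop)
  have h := (summable_prod_range hd).tendsto_atTop_zero.bddAbove_range
  obtain ⟨K, hK⟩ := h
  refine ⟨K, fun l => ?_⟩
  have hKl := hK ⟨l, rfl⟩
  simp only at hKl
  refine le_trans (le_of_eq ?_) (mul_le_mul_of_nonneg_right hKl (by positivity))
  have e : ε ^ l = ∏ _s ∈ Finset.range l, ε := by simp
  have e2 : (l.factorial : ℝ) = ∏ s ∈ Finset.range l, ((s : ℝ) + 1) := by
    rw [← Finset.prod_range_add_one_eq_factorial]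
    push_cast
    rfl
  rw [e, e2, jacobiBound, ← Finset.prod_mul_distrib, ← Finset.prod_mul_distrib]
  refine Finset.prod_congr rfl fun s _ => ?_
  have : 0 < α + 1 + s := by have := s.cast_nonneg (α := ℝ); linarith
  field_simp

end Jacobi

/-! ### Scaled limits of the kernel and of the orthogonal polynomials. -/

section KernelLimit

variable {α β : ℝ}

/-- The k-th summand is of order k^(2α+1+2j+2i), and Stolz–Cesàro sums it. The resulting divisor
α+j+1+i is what distinguishes the limit of the kernel from a Bessel series. -/
lemma tendsto_coeff_jacobiKernel (hα : -1 < α) (hβ : -1 < β) (j i : ℕ) :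
    Tendsto (fun n : ℕ => (jacobiKernel α β j n).coeff i
        / (n : ℝ) ^ (2 * (α + j + 1 + i) : ℝ)) atTop
      (𝓝 (jacobiCoeffLim α i * jacobiCoeffLim α j
        / (Real.Gamma (α + 1) ^ 2 * (α + j + 1 + i)))) := by
  have hi := i.cast_nonneg (α := ℝ)
  have hj := j.cast_nonneg (α := ℝ)
  have hG := Real.Gamma_pos_of_pos (by linarith : 0 < α + 1)
  have hp : 0 < 2 * (α + j + 1 + i) := by linarith
  have h := ((tendsto_jacobiCoeff (α := α) (β := β) j).div (tendsto_jacobiNorm hα hβ)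
    (by positivity)).mul (tendsto_jacobiCoeff (α := α) (β := β) i)
  have key := tendsto_sum_div_rpow (a := fun k => jacobiCoeff α β k j / jacobiNorm α β k
    * jacobiCoeff α β k i) (c := jacobiCoeffLim α j / (Real.Gamma (α + 1) ^ 2 / 2)
      * jacobiCoeffLim α i) hp ?_
  · simp only [coeff_jacobiKernel]
    convert key using 2
    field_simp
  · refine h.congr' ?_
    filter_upwards [eventually_ge_atTop 1] with k hk
    have hk0 : (0 : ℝ) < k := by exact_mod_cast hk
    have h1 := (jacobiNorm_pos hα hβ k).ne'
    have e : (k : ℝ) ^ (2 * (α + j + 1 + i) - 1 : ℝ)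
        = (k : ℝ) ^ (2 * α + 1) * (k : ℝ) ^ (2 * j) * (k : ℝ) ^ (2 * i) := by
      rw [← Real.rpow_natCast, ← Real.rpow_natCast, ← Real.rpow_add hk0, ← Real.rpow_add hk0]
      congr 1
      push_cast
      ring
    have h2 : (k : ℝ) ^ (2 * α + 1) ≠ 0 := (Real.rpow_pos_of_pos hk0 _).ne'
    simp only [Pi.div_apply]
    rw [e]
    field_simp

lemma jacobiCoeff_sign_nonneg (hα : -1 < α) (hβ : -1 < β) {k i : ℕ} (hk : 1 ≤ k) :
    0 ≤ (-1) ^ i * jacobiCoeff α β k i := by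
  rcases Nat.lt_or_ge k i with h | h
  · rw [jacobiCoeff_eq_zero h, mul_zero]
  · exact (jacobiCoeff_sign hα hβ hk h).le

lemma abs_jacobiCoeff (hα : -1 < α) (hβ : -1 < β) {k i : ℕ} (hk : 1 ≤ k) :
    |jacobiCoeff α β k i| = (-1) ^ i * jacobiCoeff α β k i := by
  have h := jacobiCoeff_sign_nonneg hα hβ (i := i) hk
  rw [← abs_of_nonneg h, abs_mul, abs_pow, abs_neg, abs_one, one_pow, one_mul]

lemma coeff_zero_jacobiKernel_sign (hα : -1 < α) (hβ : -1 < β) {j n : ℕ} (hj : 1 ≤ j) (hn : j < n) :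
    0 < (-1) ^ j * (jacobiKernel α β j n).coeff 0 := by
  rw [coeff_jacobiKernel, Finset.mul_sum]
  have hterm : ∀ k ∈ Finset.range n, (-1 : ℝ) ^ j * (jacobiCoeff α β k j / jacobiNorm α β k
      * jacobiCoeff α β k 0) = (-1) ^ j * jacobiCoeff α β k j / jacobiNorm α β k := fun k _ => by
    rw [jacobiCoeff_zero]
    ring
  rw [Finset.sum_congr rfl hterm]
  refine Finset.sum_pos' (fun k _ => ?_) ⟨j, Finset.mem_range.2 hn, ?_⟩
  · rcases Nat.eq_zero_or_pos k with rfl | hk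
    · rw [jacobiCoeff_eq_zero (by omega)]
      simp
    · exact div_nonneg (jacobiCoeff_sign_nonneg hα hβ hk) (jacobiNorm_pos hα hβ k).le
  · exact div_pos (jacobiCoeff_sign hα hβ hj le_rfl) (jacobiNorm_pos hα hβ j)

lemma coeff_self_jacobiKernel_pos (hα : -1 < α) (hβ : -1 < β) {j n : ℕ} (hn : j < n) :
    0 < (jacobiKernel α β j n).coeff j := by
  rw [coeff_jacobiKernel]
  refine Finset.sum_pos' (fun k _ => ?_) ⟨j, Finset.mem_range.2 hn, ?_⟩
  · rw [div_mul_eq_mul_div]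
    exact div_nonneg (mul_self_nonneg _) (jacobiNorm_pos hα hβ k).le
  · rw [div_mul_eq_mul_div]
    exact div_pos (mul_self_pos.2 (jacobiCoeff_self_ne_zero hα hβ j)) (jacobiNorm_pos hα hβ j)

/-- Since R_k(0) = 1, the constant coefficient is a sum of terms all of sign (-1)^j. The i-th
coefficients |r_{k,i}| increase with k and can be replaced by |r_{n,i}|. The term k = 0 vanishes
because j ≥ 1. -/
lemma abs_coeff_jacobiKernel_le (hα : -1 < α) (hβ : -1 < β) {j n : ℕ} (hj : 1 ≤ j) (i : ℕ) :
    |(jacobiKernel α β j n).coeff i|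
      ≤ |jacobiCoeff α β n i| * |(jacobiKernel α β j n).coeff 0| := by
  have h0 : |jacobiCoeff α β n i| * ((-1) ^ j * (jacobiKernel α β j n).coeff 0)
      ≤ |jacobiCoeff α β n i| * |(jacobiKernel α β j n).coeff 0| := by
    refine mul_le_mul_of_nonneg_left ((le_abs_self _).trans_eq ?_) (abs_nonneg _)
    rw [abs_mul, abs_pow, abs_neg, abs_one, one_pow, one_mul]
  refine le_trans ?_ h0
  rw [coeff_jacobiKernel, coeff_jacobiKernel, Finset.mul_sum, Finset.mul_sum]
  refine (Finset.abs_sum_le_sum_abs _ _).trans (Finset.sum_le_sum fun k hk => ?_)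
  rcases Nat.eq_zero_or_pos k with rfl | hk1
  · rw [jacobiCoeff_eq_zero (by omega : 0 < j)]
    simp
  · have hN := jacobiNorm_pos hα hβ k
    rw [abs_mul, abs_div, abs_of_pos hN, abs_jacobiCoeff hα hβ hk1 (i := j), jacobiCoeff_zero,
      mul_comm, mul_one, ← mul_div_assoc ((-1 : ℝ) ^ j)]
    refine mul_le_mul_of_nonneg_right (abs_jacobiCoeff_le_of_le hα hβ hk1
      (Finset.mem_range.1 hk).le i) (div_nonneg (jacobiCoeff_sign_nonneg hα hβ hk1) hN.le)

/-- The coefficients of `∑ (-w/4)^i / ((α+1)_i i!)`. -/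
def besselCoeff (α : ℝ) (i : ℕ) : ℝ := jacobiCoeffLim α i / 4 ^ i

lemma tendsto_jacobiCoeff_scaled (i : ℕ) :
    Tendsto (fun n : ℕ => jacobiCoeff α β n i / (4 * (n : ℝ) ^ 2) ^ i) atTop
      (𝓝 (besselCoeff α i)) := by
  refine ((tendsto_jacobiCoeff (α := α) (β := β) i).div_const (4 ^ i)).congr fun n => ?_
  rw [mul_pow, ← pow_mul, div_div, mul_comm ((n : ℝ) ^ (2 * i))]

/-- The normalized and scaled coefficients of the kernel polynomial. -/
def kernelCoeff (α β : ℝ) (j n i : ℕ) : ℝ :=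
  (jacobiKernel α β j n).coeff i / (jacobiKernel α β j n).coeff 0 / (4 * (n : ℝ) ^ 2) ^ i

lemma tendsto_kernelCoeff (hα : -1 < α) (hβ : -1 < β) (j i : ℕ) :
    Tendsto (fun n : ℕ => kernelCoeff α β j n i) atTop
      (𝓝 (besselCoeff α i * ((α + j + 1) / (α + j + 1 + i)))) := by
  have hi := i.cast_nonneg (α := ℝ)
  have hj := j.cast_nonneg (α := ℝ)
  have hA : 0 < α + j + 1 := by linarith
  have hG := Real.Gamma_pos_of_pos (by linarith : 0 < α + 1)
  have hl := jacobiCoeffLim_ne_zero hα j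
  have h0 : jacobiCoeffLim α 0 = 1 := by simp [jacobiCoeffLim]
  have h := ((tendsto_coeff_jacobiKernel hα hβ j i).div (tendsto_coeff_jacobiKernel hα hβ j 0)
    (by rw [h0]; simp only [Nat.cast_zero, add_zero, one_mul]; positivity)).div_const (4 ^ i)
  have e : jacobiCoeffLim α i * jacobiCoeffLim α j / (Real.Gamma (α + 1) ^ 2 * (α + j + 1 + i))
      / (jacobiCoeffLim α 0 * jacobiCoeffLim α j
        / (Real.Gamma (α + 1) ^ 2 * (α + j + 1 + (0 : ℕ)))) / 4 ^ i
      = besselCoeff α i * ((α + j + 1) / (α + j + 1 + i)) := by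
    rw [h0, besselCoeff]
    simp only [Nat.cast_zero, add_zero, one_mul]
    field_simp
  rw [e] at h
  refine h.congr' ?_
  filter_upwards [eventually_ge_atTop 1] with n hn
  have hn0 : (0 : ℝ) < n := by exact_mod_cast hn
  rw [kernelCoeff, Pi.div_apply]
  have e2 : (n : ℝ) ^ (2 * (α + j + 1 + i) : ℝ)
      = (n : ℝ) ^ (2 * (α + j + 1 + (0 : ℕ)) : ℝ) * (n : ℝ) ^ (2 * i) := by
    rw [← Real.rpow_natCast, ← Real.rpow_add hn0]
    congr 1
    push_cast
    ring
  have h2 : (n : ℝ) ^ (2 * (α + j + 1 + (0 : ℕ)) : ℝ) ≠ 0 := (Real.rpow_pos_of_pos hn0 _).ne'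
  rw [e2, mul_pow, ← pow_mul]
  field_simp

lemma abs_kernelCoeff_le (hα : -1 < α) (hβ : -1 < β) {j n : ℕ} (hj : 1 ≤ j) (hn : j < n) (i : ℕ) :
    |kernelCoeff α β j n i| ≤ jacobiBound α β i := by
  refine le_trans ?_ (abs_jacobiCoeff_div_le hα hβ (by omega : 1 ≤ n) i)
  have h0 : (jacobiKernel α β j n).coeff 0 ≠ 0 := by
    intro h
    have := coeff_zero_jacobiKernel_sign hα hβ hj hn
    rw [h, mul_zero] at this
    exact lt_irrefl _ this
  rw [kernelCoeff, abs_div, abs_div, abs_div]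
  refine div_le_div_of_nonneg_right ?_ (abs_nonneg _)
  rw [div_le_iff₀ (abs_pos.2 h0)]
  exact abs_coeff_jacobiKernel_le hα hβ hj i

lemma domTendsto_kernelCoeff (hα : -1 < α) (hβ : -1 < β) {j : ℕ} (hj : 1 ≤ j) :
    DomTendsto atTop (fun n => kernelCoeff α β j n)
      (fun i => besselCoeff α i * ((α + j + 1) / (α + j + 1 + i))) (jacobiBound α β) :=
  ⟨entireCoeff_jacobiBound hα, (eventually_gt_atTop j).mono fun _ hn i =>
    abs_kernelCoeff_le hα hβ hj hn i, tendsto_kernelCoeff hα hβ j⟩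

lemma domTendsto_jacobiCoeff (hα : -1 < α) (hβ : -1 < β) :
    DomTendsto atTop (fun n i => jacobiCoeff α β n i / (4 * (n : ℝ) ^ 2) ^ i)
      (besselCoeff α) (jacobiBound α β) :=
  ⟨entireCoeff_jacobiBound hα, (eventually_ge_atTop 1).mono fun _ hn i =>
    abs_jacobiCoeff_div_le hα hβ hn i, tendsto_jacobiCoeff_scaled⟩

/-- The scaled, normalized orthogonal polynomial of the discrete Sobolev form. -/
def scaledPoly (α β : ℝ) (j : ℕ) (μ : ℝ) (n : ℕ) : ℝ[X] :=
  (jacobiPoly α β n - C (μ * jacobiCoeff α β n j / (1 + μ * (jacobiKernel α β j n).coeff j))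
    * jacobiKernel α β j n).comp (C (1 / (4 * (n : ℝ) ^ 2)) * X)

/-- The coefficients of the limit function. -/
def limitSeries (α : ℝ) (j : ℕ) (c : ℝ) (i : ℕ) : ℝ :=
  besselCoeff α i * (1 - c * ((α + 2 * j + 1) / (α + j + 1 + i)))

/-- The correction is split into three factors with finite limits: the relative mass, a ratio
independent of the mass, and the normalized kernel coefficient. -/
lemma coeff_scaledPoly (hα : -1 < α) (hβ : -1 < β) {j n : ℕ} (hj : 1 ≤ j) (hn : j < n) (μ : ℝ)
    (i : ℕ) :
    (scaledPoly α β j μ n).coeff i = jacobiCoeff α β n i / (4 * (n : ℝ) ^ 2) ^ i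
      - (μ * (jacobiKernel α β j n).coeff j / (1 + μ * (jacobiKernel α β j n).coeff j))
        * (jacobiCoeff α β n j * (jacobiKernel α β j n).coeff 0 / (jacobiKernel α β j n).coeff j)
        * kernelCoeff α β j n i := by
  have h0 : (jacobiKernel α β j n).coeff 0 ≠ 0 := by
    intro h
    have := coeff_zero_jacobiKernel_sign hα hβ hj hn
    rw [h, mul_zero] at this
    exact lt_irrefl _ this
  have hK := (coeff_self_jacobiKernel_pos hα hβ hn).ne'
  rw [scaledPoly, comp_C_mul_X_coeff, coeff_sub, coeff_C_mul, coeff_jacobiPoly, kernelCoeff,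
    one_div, inv_pow]
  field_simp

lemma tendsto_kernel_ratio (hα : -1 < α) (hβ : -1 < β) (j : ℕ) :
    Tendsto (fun n : ℕ => jacobiCoeff α β n j * (jacobiKernel α β j n).coeff 0
      / (jacobiKernel α β j n).coeff j) atTop (𝓝 ((α + 2 * j + 1) / (α + j + 1))) := by
  have hj := j.cast_nonneg (α := ℝ)
  have hA : 0 < α + j + 1 := by linarith
  have hA2 : 0 < α + j + 1 + j := by linarith
  have hG := Real.Gamma_pos_of_pos (by linarith : 0 < α + 1)
  have hl := jacobiCoeffLim_ne_zero hα j
  have h0 : jacobiCoeffLim α 0 = 1 := by simp [jacobiCoeffLim]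
  have h := ((tendsto_jacobiCoeff (α := α) (β := β) j).mul
    (tendsto_coeff_jacobiKernel hα hβ j 0)).div (tendsto_coeff_jacobiKernel hα hβ j j)
    (by positivity)
  have e : jacobiCoeffLim α j * (jacobiCoeffLim α 0 * jacobiCoeffLim α j
      / (Real.Gamma (α + 1) ^ 2 * (α + j + 1 + (0 : ℕ))))
      / (jacobiCoeffLim α j * jacobiCoeffLim α j / (Real.Gamma (α + 1) ^ 2 * (α + j + 1 + j)))
      = (α + 2 * j + 1) / (α + j + 1) := by
    rw [h0]
    simp only [Nat.cast_zero, add_zero, one_mul]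
    field_simp
    ring
  rw [e] at h
  refine h.congr' ?_
  filter_upwards [eventually_ge_atTop 1] with n hn
  have hn0 : (0 : ℝ) < n := by exact_mod_cast hn
  rw [Pi.div_apply]
  have e2 : (n : ℝ) ^ (2 * (α + j + 1 + j) : ℝ)
      = (n : ℝ) ^ (2 * (α + j + 1 + (0 : ℕ)) : ℝ) * (n : ℝ) ^ (2 * j) := by
    rw [← Real.rpow_natCast, ← Real.rpow_add hn0]
    congr 1
    push_cast
    ring
  have h2 : (n : ℝ) ^ (2 * (α + j + 1 + (0 : ℕ)) : ℝ) ≠ 0 := (Real.rpow_pos_of_pos hn0 _).ne'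
  rw [e2]
  field_simp

lemma domTendsto_scaledPoly (hα : -1 < α) (hβ : -1 < β) {j : ℕ} (hj : 1 ≤ j) {μ : ℕ → ℝ}
    {c : ℝ}
    (hc : Tendsto (fun n => μ n * (jacobiKernel α β j n).coeff j
      / (1 + μ n * (jacobiKernel α β j n).coeff j)) atTop (𝓝 c)) :
    ∃ K, DomTendsto atTop (fun n => (scaledPoly α β j (μ n) n).coeff) (limitSeries α j c)
      (fun i => K * jacobiBound α β i) := by
  have hρ := tendsto_kernel_ratio hα hβ j
  have hprod := hc.mul hρ
  set y : ℕ → ℝ := fun n => (μ n * (jacobiKernel α β j n).coeff j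
      / (1 + μ n * (jacobiKernel α β j n).coeff j))
      * (jacobiCoeff α β n j * (jacobiKernel α β j n).coeff 0 / (jacobiKernel α β j n).coeff j)
    with hy
  obtain ⟨K, hK⟩ := hprod.abs.bddAbove_range
  have hj' := j.cast_nonneg (α := ℝ)
  have hA : 0 < α + j + 1 := by linarith
  refine ⟨1 + K, (entireCoeff_jacobiBound hα).const_mul _, ?_, fun i => ?_⟩
  · filter_upwards [eventually_gt_atTop j] with n hn i
    rw [coeff_scaledPoly hα hβ hj hn]
    have h1 := abs_jacobiCoeff_div_le hα hβ (by omega : 1 ≤ n) i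
    have h2 := abs_kernelCoeff_le hα hβ hj hn i
    have h3 : |y n| ≤ K := hK ⟨n, rfl⟩
    refine (abs_sub _ _).trans ?_
    rw [abs_mul]
    have h4 : |y n| * |kernelCoeff α β j n i| ≤ K * jacobiBound α β i :=
      mul_le_mul h3 h2 (abs_nonneg _) ((abs_nonneg _).trans h3)
    change _ + |y n| * _ ≤ _
    linarith
  · have h := (tendsto_jacobiCoeff_scaled (α := α) (β := β) i).sub
      (hprod.mul (tendsto_kernelCoeff hα hβ j i))
    have hi := i.cast_nonneg (α := ℝ)
    have e : besselCoeff α i - c * ((α + 2 * j + 1) / (α + j + 1))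
        * (besselCoeff α i * ((α + j + 1) / (α + j + 1 + i))) = limitSeries α j c i := by
      rw [limitSeries]
      have : α + j + 1 + i ≠ 0 := by linarith
      field_simp
    rw [e] at h
    refine h.congr' ?_
    filter_upwards [eventually_gt_atTop j] with n hn
    rw [coeff_scaledPoly hα hβ hj hn]

end KernelLimit

/-! ### The Bessel series and the simplicity of its zeros. -/

section Bessel

variable {α : ℝ}

lemma besselCoeff_zero : besselCoeff α 0 = 1 := by simp [besselCoeff, jacobiCoeffLim]

lemma besselCoeff_succ (hα : -1 < α) (i : ℕ) :
    ((i : ℝ) + 1) * ((i : ℝ) + 1 + α) * besselCoeff α (i + 1) = -(besselCoeff α i) / 4 := by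
  have h : 0 < α + 1 + i := by have := i.cast_nonneg (α := ℝ); linarith
  rw [besselCoeff, besselCoeff, jacobiCoeffLim, Finset.prod_range_succ, ← jacobiCoeffLim, pow_succ]
  field_simp
  ring

lemma besselCoeff_ne_zero (hα : -1 < α) (i : ℕ) : besselCoeff α i ≠ 0 :=
  div_ne_zero (jacobiCoeffLim_ne_zero hα i) (by positivity)

lemma entireCoeff_besselCoeff (hα : -1 < α) : EntireCoeff (besselCoeff α) :=
  (domTendsto_jacobiCoeff (β := 0) hα (by norm_num)).entire

lemma bessel_ode (hα : -1 < α) (w : ℝ) :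
    w * psum (coeffDeriv (coeffDeriv (besselCoeff α))) w
      + (1 + α) * psum (coeffDeriv (besselCoeff α)) w + psum (besselCoeff α) w / 4 = 0 := by
  have h := entireCoeff_besselCoeff hα
  rw [← psum_nat_mul h.deriv, ← psum_const_mul, ← psum_add h.deriv.nat_mul (h.deriv.const_mul _),
    div_eq_mul_inv, mul_comm _ (4 : ℝ)⁻¹, ← psum_const_mul, ← psum_add]
  · rw [psum]
    refine (tsum_congr fun i => ?_).trans tsum_zero
    have := besselCoeff_succ hα i
    simp only [coeffDeriv]
    linear_combination (w ^ i) * this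
  · intro r hr
    refine ((h.deriv.nat_mul r hr).add ((h.deriv.const_mul (1 + α)) r hr)).of_nonneg_of_le
      (fun l => by positivity) fun l => ?_
    rw [← add_mul]
    exact mul_le_mul_of_nonneg_right (abs_add_le _ _) (by positivity)
  · exact h.const_mul _

/-- The function `∑ (-w/4)^i / ((α+1)_i i!)` has no multiple positive zero. -/
lemma bessel_simple (hα : -1 < α) {w₀ : ℝ} (hw : 0 < w₀) (h0 : psum (besselCoeff α) w₀ = 0)
    (h1 : psum (coeffDeriv (besselCoeff α)) w₀ = 0) : False := by
  have h := entireCoeff_besselCoeff hα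
  set g := psum (besselCoeff α) with hg
  set g' := psum (coeffDeriv (besselCoeff α)) with hg'
  -- An energy for the differential equation, with E' = -(1+2α)g'². The weight w^p with p = |1+2α|
  -- makes w^p·E nondecreasing whatever the sign of 1+2α. A multiple zero at w₀ then forces E, hence
  -- g, to vanish on (0, w₀], although g(0) = 1.
  set E : ℝ → ℝ := fun w => w * g' w ^ 2 + g w ^ 2 / 4 with hE
  set p := |1 + 2 * α| with hp
  have hEd : ∀ w, HasDerivAt E (-(1 + 2 * α) * g' w ^ 2) w := by
    intro w
    have d1 := hasDerivAt_psum h w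
    have d2 := hasDerivAt_psum h.deriv w
    have hd := ((hasDerivAt_id w).mul (d2.pow 2)).add ((d1.pow 2).div_const 4)
    refine hd.congr_deriv ?_
    have ode := bessel_ode hα w
    simp only [id, Nat.cast_ofNat, Nat.add_one_sub_one, pow_one, Pi.pow_apply]
    linear_combination (2 * g' w) * ode
  have hEnn : ∀ w, 0 < w → 0 ≤ E w := fun w hw => by simp only [hE]; positivity
  have hmono : MonotoneOn (fun w => w ^ p * E w) (Ioi 0) := by
    refine monotoneOn_of_deriv_nonneg (convex_Ioi 0) ?_ ?_ ?_
    · refine ContinuousOn.mul (fun w hw => ?_) fun w _ => (hEd w).continuousAt.continuousWithinAt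
      exact (Real.continuousAt_rpow_const _ _ (Or.inl (ne_of_gt hw))).continuousWithinAt
    · rw [interior_Ioi]
      intro w hw
      exact ((Real.hasDerivAt_rpow_const (Or.inl (ne_of_gt hw))).mul
        (hEd w)).differentiableAt.differentiableWithinAt
    · rw [interior_Ioi]
      intro w hw
      have hw0 : 0 < w := hw
      have hd := (Real.hasDerivAt_rpow_const (x := w) (p := p) (Or.inl hw0.ne')).mul (hEd w)
      have hd' : deriv (fun w => w ^ p * E w) w
          = p * w ^ (p - 1) * E w + w ^ p * (-(1 + 2 * α) * g' w ^ 2) := hd.deriv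
      rw [hd']
      have e : w ^ p = w ^ (p - 1) * w := by
        rw [← Real.rpow_add_one hw0.ne', sub_add_cancel]
      have hpw : 0 < w ^ (p - 1) := Real.rpow_pos_of_pos hw0 _
      have h3 : p * w ^ (p - 1) * E w + w ^ p * (-(1 + 2 * α) * g' w ^ 2)
          = w ^ (p - 1) * (p * (g w ^ 2 / 4) + (p - (1 + 2 * α)) * (w * g' w ^ 2)) := by
        rw [e]
        simp only [hE]
        ring
      rw [h3]
      have h4 : 0 ≤ p - (1 + 2 * α) := sub_nonneg.2 (le_abs_self _)
      have h5 : 0 ≤ p := abs_nonneg _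
      positivity
  have hE0 : E w₀ = 0 := by simp [hE, h0, h1]
  have hgz : ∀ w ∈ Ioc 0 w₀, g w = 0 := by
    intro w hw'
    have h3 := hmono hw'.1 hw hw'.2
    simp only [hE0, mul_zero] at h3
    have hpw : 0 < w ^ p := Real.rpow_pos_of_pos hw'.1 _
    have h4 : E w ≤ 0 := by
      by_contra! hlt
      have := mul_pos hpw hlt
      linarith
    simp only [hE] at h4
    have h5 : 0 ≤ w * g' w ^ 2 := mul_nonneg hw'.1.le (sq_nonneg _)
    have h6 : g w ^ 2 = 0 := le_antisymm (by linarith) (sq_nonneg _)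
    exact pow_eq_zero_iff (two_ne_zero) |>.1 h6
  have hlim : Tendsto g (𝓝[>] 0) (𝓝 (g 0)) :=
    ((continuous_psum h).tendsto 0).mono_left nhdsWithin_le_nhds
  have hlim0 : Tendsto g (𝓝[>] 0) (𝓝 0) := by
    refine tendsto_const_nhds.congr' ?_
    filter_upwards [Ioc_mem_nhdsGT hw] with w hw'
    exact (hgz w hw').symm
  have h7 := tendsto_nhds_unique hlim hlim0
  rw [hg, psum_zero, besselCoeff_zero] at h7
  exact one_ne_zero h7

end Bessel

/-! ### Laguerre inequality and simplicity of the zeros of the limit functions. -/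

section LaguerreInequality

/-- `(θp)² - p θ²p` with `θ = w d/dw`, at the point `w`. -/
def laguerreExpr (p : ℝ[X]) (w : ℝ) : ℝ :=
  ((X * derivative p).eval w) ^ 2
    - p.eval w * (X * derivative (X * derivative p)).eval w

lemma laguerreExpr_mul (p q : ℝ[X]) (w : ℝ) : laguerreExpr (p * q) w
    = p.eval w ^ 2 * laguerreExpr q w + q.eval w ^ 2 * laguerreExpr p w := by
  simp only [laguerreExpr, derivative_mul, derivative_add, derivative_X, eval_add, eval_mul, eval_X,
    one_mul]
  ring

lemma laguerreExpr_linear (x w : ℝ) : laguerreExpr (1 - C x * X) w = x * w := by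
  simp [laguerreExpr]
  ring

/-- Away from zeros of p, the expression is -p²·θ² log p, additive over factors after division by
p², and a factor 1 - xw contributes xw/(1-xw)² with (1-xw)² ≤ (1+Bw)². The form without division
holds at zeros as well and passes to the limit. -/
lemma laguerreExpr_prod_ge {s : Finset ℕ} {x : ℕ → ℝ} {B w : ℝ} (hw : 0 ≤ w)
    (hx : ∀ k ∈ s, 0 ≤ x k ∧ x k ≤ B) :
    w * (∑ k ∈ s, x k) * (∏ k ∈ s, (1 - C (x k) * X)).eval w ^ 2
      ≤ laguerreExpr (∏ k ∈ s, (1 - C (x k) * X)) w * (1 + B * w) ^ 2 := by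
  induction s using Finset.induction_on with
  | empty => simp [laguerreExpr]
  | insert a s ha ih =>
    have h1 := ih fun k hk => hx k (Finset.mem_insert_of_mem hk)
    obtain ⟨h2, h3⟩ := hx a (Finset.mem_insert_self _ _)
    rw [Finset.prod_insert ha, Finset.sum_insert ha, laguerreExpr_mul, laguerreExpr_linear,
      eval_mul]
    set P := (∏ k ∈ s, (1 - C (x k) * X)) with hP
    have e1 : (1 - C (x a) * X : ℝ[X]).eval w = 1 - x a * w := by simp
    rw [e1]
    have h4 : (1 - x a * w) ^ 2 ≤ (1 + B * w) ^ 2 := by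
      have h5 : 0 ≤ x a * w := by positivity
      have h6 : x a * w ≤ B * w := by gcongr
      nlinarith
    have h7 : x a * w * (1 - x a * w) ^ 2 ≤ x a * w * (1 + B * w) ^ 2 := by gcongr
    have h8 := mul_le_mul_of_nonneg_left h1 (sq_nonneg (1 - x a * w))
    have h9 := mul_le_mul_of_nonneg_left h7 (sq_nonneg (P.eval w))
    nlinarith

lemma coeff_prod_one_sub (s : Finset ℕ) (x : ℕ → ℝ) :
    (∏ k ∈ s, (1 - C (x k) * X)).coeff 0 = 1 ∧
      (∏ k ∈ s, (1 - C (x k) * X)).coeff 1 = -∑ k ∈ s, x k := by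
  induction s using Finset.induction_on with
  | empty => simp [coeff_one]
  | insert a s ha ih =>
    rw [Finset.prod_insert ha, Finset.sum_insert ha, sub_mul, one_mul, coeff_sub, coeff_sub,
      mul_assoc, coeff_C_mul, coeff_C_mul, coeff_X_mul, ih.1, ih.2]
    simp
    ring

lemma coeff_X_mul_derivative (p : ℝ[X]) : (X * derivative p).coeff = fun l => l * p.coeff l := by
  ext l
  cases l with
  | zero => simp
  | succ l =>
    rw [coeff_X_mul, coeff_derivative]
    push_cast
    ring

lemma laguerreExpr_eq_psum (p : ℝ[X]) (w : ℝ) : laguerreExpr p w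
    = psum (fun l => l * p.coeff l) w ^ 2
      - psum p.coeff w * psum (fun l => l * (l * p.coeff l)) w := by
  rw [laguerreExpr, ← psum_polynomial, ← psum_polynomial, ← psum_polynomial,
    coeff_X_mul_derivative (X * derivative p), coeff_X_mul_derivative]

end LaguerreInequality

lemma coeff_of_eval_eq_prod {q : ℝ[X]} {l : ℝ} {w : ℕ → ℝ} {n : ℕ}
    (h : ∀ x, q.eval x = l * ∏ k ∈ Finset.Icc 1 n, (w k - x)) : q.coeff n = l * (-1) ^ n := by
  have hq : q = C l * ∏ k ∈ Finset.Icc 1 n, (C (w k) - X) := by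
    refine Polynomial.funext fun x => ?_
    rw [h, eval_mul, eval_C, eval_prod]
    simp
  have h2 := coeff_prod_of_natDegree_le (s := Finset.Icc 1 n) (fun k => C (w k) - X) 1
    fun k _ => (natDegree_sub_le _ _).trans (by simp)
  rw [Nat.card_Icc, Nat.add_sub_cancel, mul_one] at h2
  rw [hq, coeff_C_mul, h2]
  simp

section Kernel

variable {α β : ℝ}

/-- The scaled kernel polynomial, normalized at `0`. -/
def scaledKernel (α β : ℝ) (j n : ℕ) : ℝ[X] :=
  C (1 / (jacobiKernel α β j n).coeff 0)
    * (jacobiKernel α β j n).comp (C (1 / (4 * (n : ℝ) ^ 2)) * X)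

lemma coeff_scaledKernel (j n : ℕ) : (scaledKernel α β j n).coeff = kernelCoeff α β j n := by
  ext i
  rw [scaledKernel, coeff_C_mul, comp_C_mul_X_coeff, kernelCoeff, one_div, one_div, inv_pow]
  ring

/-- By the reproducing property the kernel is orthogonal to lower degrees with vanishing j-th
coefficient, so all its n-1 roots are real and at most the first is not positive. The signs of the
leading and constant coefficients make the product of the roots positive, hence every root. -/
lemma scaledKernel_eq_prod (hα : -1 < α) (hβ : -1 < β) {j n : ℕ} (hj : 1 ≤ j) (hn : j < n) :
    ∃ x : ℕ → ℝ, (∀ k ∈ Finset.Icc 1 (n - 1), 0 ≤ x k) ∧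
      scaledKernel α β j n = ∏ k ∈ Finset.Icc 1 (n - 1), (1 - C (x k) * X) := by
  set q := jacobiKernel α β j n with hq
  have hn0 : (0 : ℝ) < n := by exact_mod_cast (by omega : 0 < n)
  have hlead : q.coeff (n - 1)
      = jacobiCoeff α β (n - 1) j / jacobiNorm α β (n - 1) * jacobiCoeff α β (n - 1) (n - 1) := by
    rw [hq, coeff_jacobiKernel, Finset.sum_eq_single_of_mem (n - 1)
      (Finset.mem_range.2 (by omega))]
    intro k hk hkn
    rw [jacobiCoeff_eq_zero (i := n - 1) (by have := Finset.mem_range.1 hk; omega), mul_zero]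
  have hs1 := jacobiCoeff_sign hα hβ (n := n - 1) (i := j) (by omega) (by omega)
  have hs2 := jacobiCoeff_sign hα hβ (n := n - 1) (i := n - 1) (by omega) le_rfl
  have hN := jacobiNorm_pos hα hβ (n - 1)
  have hleadsign : 0 < (-1) ^ j * ((-1) ^ (n - 1) * q.coeff (n - 1)) := by
    have e : (-1) ^ j * ((-1) ^ (n - 1) * q.coeff (n - 1))
        = ((-1) ^ j * jacobiCoeff α β (n - 1) j) / jacobiNorm α β (n - 1)
          * ((-1) ^ (n - 1) * jacobiCoeff α β (n - 1) (n - 1)) := by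
      rw [hlead]
      ring
    rw [e]
    positivity
  have hdeg : q.degree = (n - 1 : ℕ) := by
    refine le_antisymm ?_ (le_degree_of_ne_zero fun h => ?_)
    · rw [degree_le_iff_coeff_zero]
      intro m hm
      refine coeff_eq_zero_of_degree_lt ((degree_jacobiKernel_lt j n).trans_le ?_)
      have : n - 1 < m := by exact_mod_cast hm
      exact_mod_cast (by omega : n ≤ m)
    · rw [h] at hleadsign
      simp at hleadsign
  have horth : ∀ f : ℝ[X], f.degree < ((n - 1 : ℕ) : WithBot ℕ) → f.coeff j = 0 →
      jacobiFunctional α β (q * f) = 0 := by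
    intro f hf hfj
    rw [hq, jacobiFunctional_jacobiKernel_mul hα hβ j (hf.trans_le ?_), hfj]
    exact_mod_cast (by omega : n - 1 ≤ n)
  obtain ⟨w, -, hw, l, hl, hev⟩ := exists_roots_of_orthogonal hα hβ hj hdeg horth
  have hl2 := coeff_of_eval_eq_prod hev
  have h0 := coeff_zero_jacobiKernel_sign hα hβ hj hn
  rw [← hq, coeff_zero_eq_eval_zero, hev] at h0
  simp only [sub_zero] at h0
  have hlj : 0 < (-1) ^ j * l := by
    rw [hl2] at hleadsign
    have e2 : (-1 : ℝ) ^ (n - 1) * (-1) ^ (n - 1) = 1 := by rw [← mul_pow]; simp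
    have e : (-1 : ℝ) ^ j * ((-1) ^ (n - 1) * (l * (-1) ^ (n - 1))) = (-1) ^ j * l := by
      linear_combination ((-1) ^ j * l) * e2
    rwa [e] at hleadsign
  have hprod : 0 < ∏ k ∈ Finset.Icc 1 (n - 1), w k := by
    rw [← mul_assoc] at h0
    exact (pos_iff_pos_of_mul_pos h0).1 hlj
  have hwpos : ∀ k ∈ Finset.Icc 1 (n - 1), 0 < w k := by
    intro k hk
    rcases (Finset.mem_Icc.1 hk).1.eq_or_lt with h | h
    · subst h
      rw [← Finset.mul_prod_erase _ _ hk] at hprod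
      refine (pos_iff_pos_of_mul_pos hprod).2 (Finset.prod_pos fun i hi => ?_)
      have h1 := Finset.mem_erase.1 hi
      have h2 := Finset.mem_Icc.1 h1.2
      exact hw i (by omega) h2.2
    · exact hw k h (Finset.mem_Icc.1 hk).2
  refine ⟨fun k => 1 / (4 * (n : ℝ) ^ 2) / w k, fun k hk => ?_, ?_⟩
  · have := hwpos k hk
    positivity
  · refine Polynomial.funext fun y => ?_
    rw [scaledKernel, ← hq, eval_mul, eval_C, eval_comp, hev, coeff_zero_eq_eval_zero, hev,
      eval_prod]
    simp only [sub_zero, eval_mul, eval_C, eval_X, eval_sub, eval_one]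
    have h3 : ∏ k ∈ Finset.Icc 1 (n - 1), (w k - 1 / (4 * (n : ℝ) ^ 2) * y)
        = (∏ k ∈ Finset.Icc 1 (n - 1), w k)
          * ∏ k ∈ Finset.Icc 1 (n - 1), (1 - 1 / (4 * (n : ℝ) ^ 2) / w k * y) := by
      rw [← Finset.prod_mul_distrib]
      refine Finset.prod_congr rfl fun k hk => ?_
      have := (hwpos k hk).ne'
      field_simp
    rw [h3]
    have := hprod.ne'
    field_simp

/-- The coefficients of the limit of the scaled kernel polynomials. -/
def kernelSeries (α : ℝ) (j : ℕ) (i : ℕ) : ℝ := besselCoeff α i * ((α + j + 1) / (α + j + 1 + i))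

/-- Equality in the limiting Laguerre inequality forces a zero of H, because the sum of the
reciprocal roots tends to minus the coefficient of H at 1, which is positive. -/
lemma kernelSeries_laguerre (hα : -1 < α) {j : ℕ} (hj : 1 ≤ j) {w : ℝ} (hw : 0 < w)
    (h : psum (fun l => l * kernelSeries α j l) w ^ 2
      - psum (kernelSeries α j) w * psum (fun l => l * (l * kernelSeries α j l)) w = 0) :
    psum (kernelSeries α j) w = 0 := by
  -- The limit series does not depend on β, so the approximating kernels may be taken with β = 0.
  have hβ : (-1 : ℝ) < 0 := by norm_num
  have hdom := domTendsto_kernelCoeff hα hβ hj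
  change DomTendsto atTop (fun n => kernelCoeff α 0 j n) (kernelSeries α j) _ at hdom
  set B := -kernelSeries α j 1 + 1 with hB
  have hwc : Tendsto (fun _ : ℕ => w) atTop (𝓝 w) := tendsto_const_nhds
  have t0 := hdom.tendsto_psum hwc
  have t1 := hdom.nat_mul.tendsto_psum hwc
  have t2 := hdom.nat_mul.nat_mul.tendsto_psum hwc
  have hlhs := (((hdom.2.2 1).neg.const_mul w).mul (t0.pow 2))
  have hrhs := ((t1.pow 2).sub (t0.mul t2)).mul_const ((1 + B * w) ^ 2)
  have hA : 0 < α + j + 1 := by have := j.cast_nonneg (α := ℝ); linarith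
  have hk1 : 0 < -kernelSeries α j 1 := by
    have h1 := besselCoeff_succ hα 0
    rw [besselCoeff_zero] at h1
    simp only [Nat.cast_zero, zero_add, one_mul] at h1
    have h2 : besselCoeff α 1 < 0 := by
      by_contra! hge
      have : 0 ≤ (1 + α) * besselCoeff α 1 := mul_nonneg (by linarith) hge
      linarith
    rw [kernelSeries, ← neg_mul]
    have : 0 < -besselCoeff α 1 := by linarith
    positivity
  have hle := le_of_tendsto_of_tendsto hlhs hrhs (by
    have hBev := (hdom.2.2 1).neg.eventually (gt_mem_nhds (lt_add_one (-kernelSeries α j 1)))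
    filter_upwards [eventually_gt_atTop j, hBev] with n hn hnB
    obtain ⟨x, hx, he⟩ := scaledKernel_eq_prod hα hβ hj hn
    have hc := (coeff_prod_one_sub (Finset.Icc 1 (n - 1)) x).2
    rw [← he, coeff_scaledKernel] at hc
    have hxB : ∀ k ∈ Finset.Icc 1 (n - 1), 0 ≤ x k ∧ x k ≤ B := fun k hk => by
      refine ⟨hx k hk, ?_⟩
      have h1 := Finset.single_le_sum (f := x) hx hk
      rw [hc, neg_neg] at hnB
      exact h1.trans hnB.le
    have hl := laguerreExpr_prod_ge hw.le hxB
    rw [← he, laguerreExpr_eq_psum, ← psum_polynomial, coeff_scaledKernel] at hl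
    rw [hc, neg_neg]
    exact hl)
  rw [h, zero_mul] at hle
  have h3 : psum (kernelSeries α j) w ^ 2 ≤ 0 := by
    by_contra! hlt
    have := mul_pos (mul_pos hw hk1) hlt
    linarith
  exact pow_eq_zero_iff two_ne_zero |>.1 (le_antisymm h3 (sq_nonneg _))

lemma entireCoeff_kernelSeries (hα : -1 < α) {j : ℕ} (hj : 1 ≤ j) :
    EntireCoeff (kernelSeries α j) :=
  (domTendsto_kernelCoeff (β := 0) hα (by norm_num) hj).entire

/-- The limit function has only simple zeros on `[0, ∞)`. -/
theorem limitSeries_simple (hα : -1 < α) {j : ℕ} (hj : 1 ≤ j) (c : ℝ) {w : ℝ} (hw : 0 ≤ w)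
    (h0 : psum (limitSeries α j c) w = 0) : psum (coeffDeriv (limitSeries α j c)) w ≠ 0 := by
  have hjr : (0 : ℝ) ≤ j := j.cast_nonneg
  have hA : 0 < α + j + 1 := by linarith
  have hAi : ∀ i : ℕ, 0 < α + j + 1 + i := fun i => by
    have := i.cast_nonneg (α := ℝ)
    linarith
  have hH := entireCoeff_kernelSeries hα hj
  intro h1
  rcases hw.eq_or_lt with rfl | hw
  · rw [psum_zero] at h0 h1
    simp only [coeffDeriv, limitSeries, Nat.cast_zero, zero_add, add_zero, one_mul, Nat.cast_one]
      at h0 h1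
    have e1 := (mul_eq_zero.1 h0).resolve_left (besselCoeff_ne_zero hα 0)
    have e2 := (mul_eq_zero.1 h1).resolve_left (besselCoeff_ne_zero hα 1)
    have : α + j + 1 + 1 ≠ 0 := by linarith
    field_simp at e1 e2
    linarith
  -- With A = α+j+1, coefficientwise A·F_c = λH + θH and A·g = A·H + θH for the Bessel series g.
  · set lam := α + j + 1 - c * (α + 2 * j + 1) with hlam
    have hser : ∀ i, (α + j + 1) * limitSeries α j c i
        = lam * kernelSeries α j i + i * kernelSeries α j i := by
      intro i
      have := (hAi i).ne'
      rw [limitSeries, kernelSeries, hlam]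
      field_simp
      ring
    have hbes : ∀ i, (α + j + 1) * besselCoeff α i
        = (α + j + 1) * kernelSeries α j i + i * kernelSeries α j i := by
      intro i
      have := (hAi i).ne'
      rw [kernelSeries]
      field_simp
    set H := psum (kernelSeries α j) w with hHdef
    set H1 := psum (fun l => l * kernelSeries α j l) w with hH1
    set H2 := psum (fun l => l * (l * kernelSeries α j l)) w with hH2
    have E1 : lam * H + H1 = 0 := by
      rw [hHdef, hH1, ← psum_const_mul, ← psum_add (hH.const_mul _) hH.nat_mul]
      simp only [← hser]
      rw [psum_const_mul, h0, mul_zero]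
    have hent : EntireCoeff (limitSeries α j c) := by
      have h2 : EntireCoeff (fun i => (α + j + 1) * limitSeries α j c i) := by
        simp only [hser]
        intro r hr
        refine (((hH.const_mul lam) r hr).add (hH.nat_mul r hr)).of_nonneg_of_le
          (fun l => by positivity) fun l => ?_
        rw [← add_mul]
        exact mul_le_mul_of_nonneg_right (abs_add_le _ _) (by positivity)
      refine (h2.const_mul (α + j + 1)⁻¹).of_le fun l => ?_
      rw [inv_mul_cancel_left₀ hA.ne']
    have E2 : lam * H1 + H2 = 0 := by
      rw [hH1, hH2, ← psum_const_mul, ← psum_add (hH.nat_mul.const_mul _) hH.nat_mul.nat_mul]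
      have : (fun l : ℕ => lam * (l * kernelSeries α j l) + l * (l * kernelSeries α j l))
          = fun l : ℕ => (α + j + 1) * (l * limitSeries α j c l) := by
        ext l
        linear_combination (-(l : ℝ)) * hser l
      rw [this, psum_const_mul, psum_nat_mul hent, h1]
      ring
    -- A multiple zero gives λH + θH = 0 and λθH + θ²H = 0; eliminating λ gives (θH)² - H·θ²H = 0.
    -- Then H, θH and θ²H all vanish, which makes the point a multiple zero of g.
    have hzero : H = 0 := by
      refine kernelSeries_laguerre hα hj hw ?_
      rw [← hHdef, ← hH1, ← hH2]
      linear_combination H1 * E1 - H * E2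
    have hH1z : H1 = 0 := by rw [hzero] at E1; linarith
    have hH2z : H2 = 0 := by rw [hH1z] at E2; linarith
    have hg : psum (besselCoeff α) w = 0 := by
      have : (α + j + 1) * psum (besselCoeff α) w = 0 := by
        rw [← psum_const_mul]
        simp only [hbes]
        rw [psum_add (hH.const_mul _) hH.nat_mul, psum_const_mul, ← hHdef, ← hH1, hzero, hH1z]
        ring
      exact (mul_eq_zero.1 this).resolve_left hA.ne'
    have hg1 : w * psum (coeffDeriv (besselCoeff α)) w = 0 := by
      rw [← psum_nat_mul (entireCoeff_besselCoeff hα)]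
      have : (α + j + 1) * psum (fun l => l * besselCoeff α l) w = 0 := by
        rw [← psum_const_mul]
        have e : (fun l : ℕ => (α + j + 1) * (l * besselCoeff α l))
            = fun l : ℕ => (α + j + 1) * (l * kernelSeries α j l)
              + l * (l * kernelSeries α j l) := by
          ext l
          linear_combination (l : ℝ) * hbes l
        rw [e, psum_add (hH.nat_mul.const_mul _) hH.nat_mul.nat_mul, psum_const_mul, ← hH1, ← hH2,
          hH1z, hH2z]
        ring
      exact (mul_eq_zero.1 this).resolve_left hA.ne'
    exact bessel_simple hα hw hg ((mul_eq_zero.1 hg1).resolve_left hw.ne')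

end Kernel

/-! ### Identification of the limit series with the Bessel combinations. -/

section BesselFunctions

lemma besselJ_eq {ν x : ℝ} (hν : -1 < ν) (hx : 0 < x) :
    besselJ ν x = (x / 2) ^ ν / Real.Gamma (ν + 1) * psum (besselCoeff ν) (x ^ 2) := by
  rw [besselJ, psum, ← tsum_mul_left]
  refine tsum_congr fun k => ?_
  have hx2 : 0 < x / 2 := by positivity
  have h1 := risingFac_pos (by linarith : 0 < ν + 1) k
  have h2 := Real.Gamma_pos_of_pos (by linarith : 0 < ν + 1)
  have e1 : (x / 2) ^ (2 * (k : ℝ) + ν) = (x / 2) ^ (2 * k) * (x / 2) ^ ν := by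
    rw [Real.rpow_add hx2, ← Real.rpow_natCast (x / 2) (2 * k)]
    push_cast
    rfl
  rw [e1, show (k : ℝ) + ν + 1 = ν + 1 + k by ring, Gamma_add_nat (by linarith), besselCoeff,
    jacobiCoeffLim_eq hν, pow_mul, div_pow x 2 2, div_pow]
  norm_num
  field_simp

/-- Multiplication of a power series by `w^i`. -/
def shiftCoeff (i : ℕ) (a : ℕ → ℝ) (l : ℕ) : ℝ := if i ≤ l then a (l - i) else 0

lemma hasSum_shiftCoeff {a : ℕ → ℝ} (ha : EntireCoeff a) (i : ℕ) (w : ℝ) :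
    HasSum (fun l => shiftCoeff i a l * w ^ l) (w ^ i * psum a w) := by
  have h := ((ha.summable w).hasSum.mul_left (w ^ i))
  have hinj : Function.Injective fun k : ℕ => k + i := add_left_injective i
  refine (hinj.hasSum_iff ?_).1 ?_
  · intro l hl
    have : ¬ i ≤ l := fun hil => hl ⟨l - i, Nat.sub_add_cancel hil⟩
    simp [shiftCoeff, this]
  · have e : ((fun l => shiftCoeff i a l * w ^ l) ∘ fun k => k + i)
        = fun k => w ^ i * (a k * w ^ k) := by
      funext k
      simp only [Function.comp_apply, shiftCoeff, Nat.le_add_left, if_true, Nat.add_sub_cancel]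
      rw [pow_add]
      ring
    rw [e]
    exact h

lemma prod_sub_eq_choose_mul_factorial (l i : ℕ) :
    ∏ s ∈ Finset.range i, ((l : ℝ) - s) = (l.choose i : ℝ) * (i.factorial : ℝ) := by
  rw [← Nat.cast_mul, mul_comm, ← Nat.descFactorial_eq_factorial_mul_choose]
  induction i with
  | zero => simp
  | succ i ih =>
    rw [Finset.prod_range_succ, ih, Nat.descFactorial_succ]
    rcases Nat.lt_or_ge l i with h | h
    · rw [Nat.descFactorial_of_lt h]
      simp
    · push_cast
      rw [Nat.cast_sub h]
      ring

/-- The recursive definition of b_l solves a triangular linear system. The terms with i > l carry a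
vanishing binomial coefficient. -/
lemma limitCoeff_sum {α : ℝ} (hα : -1 < α) (θ : ℕ → ℝ) {j l : ℕ} (hl : l ≤ j + 1) :
    ∑ i ∈ Finset.range (j + 2), limitCoeff α θ i * (-2) ^ i
      * ((l.choose i : ℝ) * (i.factorial : ℝ)) / risingFac (α + l + 1) i = θ l := by
  have hl0 : 0 < α + l + 1 := by have := l.cast_nonneg (α := ℝ); linarith
  have hG := Real.Gamma_pos_of_pos hl0
  have hG2 : ∀ k : ℕ, Real.Gamma (α + l + k + 1) = risingFac (α + l + 1) k * Real.Gamma (α + l + 1) :=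
    fun k => by
      rw [← Gamma_add_nat hl0]
      congr 1
      ring
  have hr : ∀ k, 0 < risingFac (α + l + 1) k := risingFac_pos hl0
  rw [← Finset.sum_subset (Finset.range_subset_range.2 (by omega : l + 1 ≤ j + 2))]
  · rw [Finset.sum_range_succ]
    have hrec : limitCoeff α θ l * ((l.factorial : ℝ)
        * (2 ^ l * Real.Gamma (α + l + 1) / Real.Gamma (α + 2 * l + 1)))
        = (-1) ^ l * (θ l - Real.Gamma (α + l + 1) *
        ∑ k : Fin l, limitCoeff α θ k * (l.choose k : ℝ) *
          ((-1 : ℝ) ^ (k : ℕ) * ((k : ℕ).factorial : ℝ) * 2 ^ (k : ℕ)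
            / Real.Gamma (α + l + (k : ℕ) + 1))) := by
      have hG3 : 0 < Real.Gamma (α + 2 * l + 1) := by
        rw [show α + 2 * (l : ℝ) + 1 = α + l + l + 1 by ring, hG2]
        exact mul_pos (hr l) hG
      conv_lhs => rw [limitCoeff]
      rw [div_mul_cancel₀]
      positivity
    rw [show α + 2 * (l : ℝ) + 1 = α + l + l + 1 by ring, hG2,
      Fin.sum_univ_eq_sum_range (fun k => limitCoeff α θ k * (l.choose k : ℝ) *
          ((-1 : ℝ) ^ k * (k.factorial : ℝ) * 2 ^ k / Real.Gamma (α + l + k + 1)))] at hrec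
    have hsum : Real.Gamma (α + l + 1) * ∑ k ∈ Finset.range l, limitCoeff α θ k
        * (l.choose k : ℝ) * ((-1 : ℝ) ^ k * (k.factorial : ℝ) * 2 ^ k
          / Real.Gamma (α + l + k + 1))
        = ∑ i ∈ Finset.range l, limitCoeff α θ i * (-2) ^ i
          * ((l.choose i : ℝ) * (i.factorial : ℝ)) / risingFac (α + l + 1) i := by
      rw [Finset.mul_sum]
      refine Finset.sum_congr rfl fun k _ => ?_
      rw [hG2, show (-2 : ℝ) ^ k = (-1) ^ k * 2 ^ k by rw [← mul_pow]; norm_num]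
      have := (hr k).ne'
      field_simp
    rw [hsum] at hrec
    set S := ∑ i ∈ Finset.range l, limitCoeff α θ i * (-2) ^ i
          * ((l.choose i : ℝ) * (i.factorial : ℝ)) / risingFac (α + l + 1) i with hS
    have h1 : (-1 : ℝ) ^ l * (-1) ^ l = 1 := by rw [← mul_pow]; simp
    have e : limitCoeff α θ l * (-2) ^ l * ((l.choose l : ℝ) * (l.factorial : ℝ))
        / risingFac (α + l + 1) l = (-1) ^ l * (limitCoeff α θ l * ((l.factorial : ℝ)
        * (2 ^ l * Real.Gamma (α + l + 1)
          / (risingFac (α + l + 1) l * Real.Gamma (α + l + 1))))) := by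
      rw [show (-2 : ℝ) ^ l = (-1) ^ l * 2 ^ l by rw [← mul_pow]; norm_num, Nat.choose_self]
      have := (hr l).ne'
      push_cast
      field_simp
    rw [e, hrec, ← mul_assoc, h1]
    ring
  · intro i _ hi
    rw [Nat.choose_eq_zero_of_lt (by simpa using hi)]
    simp

/-- Multiplied by (α+l+1)_{j+1}, whose last factor α+l+j+1 clears the denominator of θ, both sides
become polynomials in l of degree at most j+1. They agree at l = 0, …, j+1, hence everywhere; this
is why j+2 Bessel functions suffice. -/
lemma limitCoeff_sum_all {α : ℝ} (hα : -1 < α) {j : ℕ} (τ : ℝ) (l : ℕ) :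
    ∑ i ∈ Finset.range (j + 2), limitCoeff α (fun i => 1 - τ / (α + j + 1 + i)) i * (-2) ^ i
      * ((l.choose i : ℝ) * (i.factorial : ℝ)) / risingFac (α + l + 1) i
      = 1 - τ / (α + j + 1 + l) := by
  set θ : ℕ → ℝ := fun i => 1 - τ / (α + j + 1 + i) with hθ
  set N : ℝ[X] := ∑ i ∈ Finset.range (j + 2), C (limitCoeff α θ i * (-2) ^ i)
    * ((∏ s ∈ Finset.range i, (X - C (s : ℝ))) * ∏ s ∈ Finset.Ico i (j + 1), (X + C (α + 1 + s)))
    with hN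
  set D : ℝ[X] := (X + C (α + j + 1 - τ)) * ∏ s ∈ Finset.range j, (X + C (α + 1 + s)) with hD
  have hr : ∀ l k : ℕ, 0 < risingFac (α + l + 1) k := fun l k =>
    risingFac_pos (by have := l.cast_nonneg (α := ℝ); linarith) k
  have hNe : ∀ l : ℕ, N.eval (l : ℝ) = risingFac (α + l + 1) (j + 1)
      * ∑ i ∈ Finset.range (j + 2), limitCoeff α θ i * (-2) ^ i
      * ((l.choose i : ℝ) * (i.factorial : ℝ)) / risingFac (α + l + 1) i := by
    intro l
    rw [hN, eval_finsetSum, Finset.mul_sum]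
    refine Finset.sum_congr rfl fun i hi => ?_
    have hi' : i ≤ j + 1 := by have := Finset.mem_range.1 hi; omega
    have e1 : risingFac (α + l + 1) (j + 1)
        = risingFac (α + l + 1) i * ∏ s ∈ Finset.Ico i (j + 1), ((l : ℝ) + (α + 1 + s)) := by
      rw [risingFac, risingFac, ← Finset.prod_range_mul_prod_Ico _ hi']
      congr 1
      exact Finset.prod_congr rfl fun s _ => by ring
    rw [e1]
    simp only [eval_mul, eval_C, eval_prod, eval_sub, eval_X, eval_add]
    rw [prod_sub_eq_choose_mul_factorial]
    have := (hr l i).ne'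
    field_simp
  have hDe : ∀ l : ℕ, D.eval (l : ℝ) = risingFac (α + l + 1) (j + 1) * θ l := by
    intro l
    have hA : α + j + 1 + l ≠ 0 := by
      have h1 := l.cast_nonneg (α := ℝ)
      have h2 := j.cast_nonneg (α := ℝ)
      linarith
    rw [hD, risingFac_succ, risingFac]
    simp only [eval_mul, eval_C, eval_prod, eval_X, eval_add, hθ]
    have e : ∏ s ∈ Finset.range j, ((l : ℝ) + (α + 1 + s))
        = ∏ s ∈ Finset.range j, (α + l + 1 + s) := Finset.prod_congr rfl fun s _ => by ring
    rw [e]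
    field_simp
    ring
  have hlin : ∀ c : ℝ, (X + C c : ℝ[X]).natDegree ≤ 1 := fun c => (natDegree_X_add_C c).le
  have hNd : N.natDegree ≤ j + 1 := by
    refine natDegree_sum_le_of_forall_le _ _ fun i hi => ?_
    have hi' : i ≤ j + 1 := by have := Finset.mem_range.1 hi; omega
    refine (natDegree_C_mul_le _ _).trans (natDegree_mul_le.trans ?_)
    have h1 : (∏ s ∈ Finset.range i, (X - C (s : ℝ))).natDegree ≤ i := by
      refine (natDegree_prod_le _ _).trans ((Finset.sum_le_sum fun (s : ℕ) _ =>
        (natDegree_X_sub_C (s : ℝ)).le).trans ?_)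
      simp
    have h2 : (∏ s ∈ Finset.Ico i (j + 1), (X + C (α + 1 + (s : ℝ)))).natDegree ≤ j + 1 - i := by
      refine (natDegree_prod_le _ _).trans ((Finset.sum_le_sum fun (s : ℕ) _ =>
        hlin (α + 1 + (s : ℝ))).trans ?_)
      simp
    omega
  have hDd : D.natDegree ≤ j + 1 := by
    refine natDegree_mul_le.trans ?_
    have h1 : (∏ s ∈ Finset.range j, (X + C (α + 1 + (s : ℝ)))).natDegree ≤ j := by
      refine (natDegree_prod_le _ _).trans ((Finset.sum_le_sum fun (s : ℕ) _ =>
        hlin (α + 1 + (s : ℝ))).trans ?_)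
      simp
    have h2 := hlin (α + j + 1 - τ)
    omega
  have hND : N = D := by
    refine eq_of_natDegree_lt_card_of_eval_eq' N D
      ((Finset.range (j + 2)).image (fun l : ℕ => (l : ℝ))) ?_ ?_
    · intro x hx
      obtain ⟨l, hl, rfl⟩ := Finset.mem_image.1 hx
      rw [hNe, hDe, limitCoeff_sum hα θ (by have := Finset.mem_range.1 hl; omega)]
    · rw [Finset.card_image_of_injective _ Nat.cast_injective, Finset.card_range]
      exact max_lt (by omega) (by omega)
  have h1 := hNe l
  rw [hND, hDe l] at h1
  exact (mul_left_cancel₀ (hr l (j + 1)).ne' h1).symm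

/-- The function of order α+2i contributes w^i times an entire series in w = x². The coefficient of
w^l is then that of the Bessel series of order α times the sum evaluated in `limitCoeff_sum_all`. -/
lemma besselCombination_eq {α : ℝ} (hα : -1 < α) (j : ℕ) (c : ℝ) {x : ℝ} (hx : 0 < x) :
    besselCombination α j (fun i => 1 - c * (α + 2 * j + 1) / (α + j + 1 + i)) x
      = psum (limitSeries α j c) (x ^ 2) / Real.Gamma (α + 1) := by
  set θ : ℕ → ℝ := fun i => 1 - c * (α + 2 * j + 1) / (α + j + 1 + i) with hθ
  have hG := Real.Gamma_pos_of_pos (by linarith : 0 < α + 1)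
  have hx2 : 0 < x / 2 := by positivity
  have hν : ∀ i : ℕ, -1 < α + 2 * i := fun i => by
    have := i.cast_nonneg (α := ℝ); linarith
  have hterm : ∀ i : ℕ, limitCoeff α θ i * 2 ^ i * (x / 2) ^ (-α) * besselJ (α + 2 * i) x
      = limitCoeff α θ i * 2 ^ i / (4 ^ i * Real.Gamma (α + 2 * i + 1))
        * ((x ^ 2) ^ i * psum (besselCoeff (α + 2 * i)) (x ^ 2)) := by
    intro i
    rw [besselJ_eq (hν i) hx]
    have e1 : (x / 2) ^ (α + 2 * (i : ℝ)) = (x / 2) ^ α * ((x ^ 2) ^ i / 4 ^ i) := by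
      rw [Real.rpow_add hx2, show (2 : ℝ) * i = ((2 * i : ℕ) : ℝ) by push_cast; ring,
        Real.rpow_natCast, pow_mul, div_pow x 2 2, div_pow]
      norm_num
    have e2 : (x / 2) ^ (-α) * (x / 2) ^ α = 1 := by
      rw [← Real.rpow_add hx2]; simp
    rw [e1]
    have := Real.Gamma_pos_of_pos (by linarith [hν i] : 0 < α + 2 * i + 1)
    field_simp
    linear_combination (limitCoeff α θ i * psum (besselCoeff (α + 2 * i)) (x ^ 2)) * e2
  rw [besselCombination, Finset.sum_congr rfl fun i _ => hterm i]
  have hs : HasSum (fun l => ∑ i ∈ Finset.range (j + 2),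
      limitCoeff α θ i * 2 ^ i / (4 ^ i * Real.Gamma (α + 2 * i + 1))
        * (shiftCoeff i (besselCoeff (α + 2 * i)) l * (x ^ 2) ^ l))
      (∑ i ∈ Finset.range (j + 2), limitCoeff α θ i * 2 ^ i / (4 ^ i * Real.Gamma (α + 2 * i + 1))
        * ((x ^ 2) ^ i * psum (besselCoeff (α + 2 * i)) (x ^ 2))) :=
    hasSum_sum fun i _ => (hasSum_shiftCoeff (entireCoeff_besselCoeff (hν i)) i (x ^ 2)).mul_left _
  rw [← hs.tsum_eq, psum, div_eq_mul_inv, ← tsum_mul_right]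
  refine tsum_congr fun l => ?_
  have hsum := limitCoeff_sum_all hα (j := j) (c * (α + 2 * j + 1)) l
  have hl1 : 0 < α + l + 1 := by have := l.cast_nonneg (α := ℝ); linarith
  have hGl := Real.Gamma_pos_of_pos hl1
  have hcoef : ∀ i ∈ Finset.range (j + 2),
      limitCoeff α θ i * 2 ^ i / (4 ^ i * Real.Gamma (α + 2 * i + 1))
        * (shiftCoeff i (besselCoeff (α + 2 * i)) l * (x ^ 2) ^ l)
      = (limitCoeff α θ i * (-2) ^ i * ((l.choose i : ℝ) * (i.factorial : ℝ))
        / risingFac (α + l + 1) i) * (besselCoeff α l * (x ^ 2) ^ l / Real.Gamma (α + 1)) := by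
    intro i _
    rcases Nat.lt_or_ge l i with h | h
    · rw [Nat.choose_eq_zero_of_lt h, shiftCoeff, if_neg (by omega)]
      simp
    · obtain ⟨d, rfl⟩ := Nat.exists_eq_add_of_le h
      rw [shiftCoeff, if_pos h, Nat.add_sub_cancel_left, besselCoeff, besselCoeff,
        jacobiCoeffLim_eq hα, jacobiCoeffLim_eq (hν i)]
      have hf : ((i + d).choose i : ℝ) * i.factorial * d.factorial = (i + d).factorial := by
        have := Nat.choose_mul_factorial_mul_factorial h
        rw [Nat.add_sub_cancel_left] at this
        exact_mod_cast this
      have hp1 := risingFac_pos (by linarith : 0 < α + 1) (i + d)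
      have hp2 := risingFac_pos (by linarith [hν i] : 0 < α + 2 * i + 1) d
      have hp3 := risingFac_pos hl1 i
      have hg1 := Real.Gamma_pos_of_pos (by linarith [hν i] : 0 < α + 2 * i + 1)
      have hGG : risingFac (α + 2 * i + 1) d * Real.Gamma (α + 2 * i + 1)
          = risingFac (α + ((i + d : ℕ) : ℝ) + 1) i
            * (risingFac (α + 1) (i + d) * Real.Gamma (α + 1)) := by
        rw [← Gamma_add_nat (by linarith [hν i]), ← Gamma_add_nat (by linarith : 0 < α + 1),
          show α + 1 + ((i + d : ℕ) : ℝ) = α + ((i + d : ℕ) : ℝ) + 1 by ring, ← Gamma_add_nat hl1]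
        congr 1
        push_cast
        ring
      have hfd : (0 : ℝ) < d.factorial := by positivity
      have hch : ((i + d).choose i : ℝ) * i.factorial = (i + d).factorial / d.factorial := by
        rw [← hf]; field_simp
      rw [hch, show (-2 : ℝ) ^ i = (-1) ^ i * 2 ^ i by rw [← mul_pow]; norm_num]
      have hfl : (0 : ℝ) < (i + d).factorial := by positivity
      have h1 : (-1 : ℝ) ^ i * (-1) ^ i = 1 := by rw [← mul_pow]; simp
      have hRHS : limitCoeff α θ i * ((-1) ^ i * 2 ^ i) * ((i + d).factorial / d.factorial : ℝ)
          / risingFac (α + ((i + d : ℕ) : ℝ) + 1) i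
          * ((-1) ^ (i + d) / (risingFac (α + 1) (i + d) * (i + d).factorial) / 4 ^ (i + d)
            * (x ^ 2) ^ (i + d) / Real.Gamma (α + 1))
          = limitCoeff α θ i * 2 ^ i * (-1) ^ d * (x ^ 2) ^ (i + d)
            / (4 ^ (i + d) * d.factorial * (risingFac (α + ((i + d : ℕ) : ℝ) + 1) i
            * (risingFac (α + 1) (i + d) * Real.Gamma (α + 1)))) * ((-1) ^ i * (-1) ^ i) := by
        rw [pow_add (-1 : ℝ)]
        field_simp
      rw [hRHS, ← hGG, h1, mul_one, pow_add (4 : ℝ)]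
      field_simp
  rw [Finset.sum_congr rfl hcoef, ← Finset.sum_mul, hsum, limitSeries, mul_div_assoc c]
  ring

end BesselFunctions

/-! ### The substitution t = (1-x)/2. -/

section ChangeOfVariables

variable {α β : ℝ}

/-- The mass of the Sobolev form in the variable `t = (1-x)/2`. -/
def scaledMass (α β : ℝ) (j : ℕ) (m : ℝ) : ℝ :=
  m * (j.factorial : ℝ) ^ 2 / (4 ^ j * (2 : ℝ) ^ (α + β + 1))

lemma scaledMass_nonneg {j : ℕ} {m : ℝ} (hm : 0 ≤ m) : 0 ≤ scaledMass α β j m := by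
  have := Real.rpow_pos_of_pos (two_pos : (0 : ℝ) < 2) (α + β + 1)
  rw [scaledMass]
  positivity

lemma coeff_comp_one_sub_two_mul (P : ℝ[X]) (j : ℕ) :
    (j.factorial : ℝ) * (P.comp (1 - C 2 * X)).coeff j
      = (-2) ^ j * (derivative^[j] P).eval 1 := by
  have h1 : P.comp (1 - C 2 * X) = (taylor 1 P).comp (C (-2) * X) := by
    rw [taylor_apply, comp_assoc]
    congr 1
    simp
    ring
  rw [h1, comp_C_mul_X_coeff, taylor_coeff, ← factorial_smul_hasseDeriv]
  simp
  ring

lemma jacobiSobolevForm_eq (j : ℕ) (m : ℝ) (P F : ℝ[X]) :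
    jacobiSobolevForm α β j m P F = (2 : ℝ) ^ (α + β + 1)
      * (jacobiFunctional α β (P.comp (1 - C 2 * X) * F.comp (1 - C 2 * X))
        + scaledMass α β j m * (P.comp (1 - C 2 * X)).coeff j * (F.comp (1 - C 2 * X)).coeff j) := by
  have h2 := Real.rpow_pos_of_pos (two_pos : (0 : ℝ) < 2) (α + β + 1)
  have hint : ∫ x in (-1 : ℝ)..1, P.eval x * F.eval x * (1 - x) ^ α * (1 + x) ^ β
      = (2 : ℝ) ^ (α + β + 1)
        * jacobiFunctional α β (P.comp (1 - C 2 * X) * F.comp (1 - C 2 * X)) := by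
    have h := intervalIntegral.integral_comp_sub_mul (a := 0) (b := 1) (c := 2)
      (fun x : ℝ => P.eval x * F.eval x * (1 - x) ^ α * (1 + x) ^ β) two_ne_zero 1
    norm_num at h
    have h3 : ∫ x in (-1 : ℝ)..1, P.eval x * F.eval x * (1 - x) ^ α * (1 + x) ^ β
        = 2 * ∫ t in (0 : ℝ)..1, P.eval (1 - 2 * t) * F.eval (1 - 2 * t) * (2 * t) ^ α
          * (1 + (1 - 2 * t)) ^ β := by
      rw [h]
      ring
    rw [h3, jacobiFunctional, ← intervalIntegral.integral_const_mul,
      ← intervalIntegral.integral_const_mul]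
    refine intervalIntegral.integral_congr_Ioo_of_le zero_le_one fun t ht => ?_
    have ht1 : 0 ≤ 1 - t := by linarith [ht.2]
    simp only [eval_mul, eval_comp, eval_sub, eval_one, eval_C, eval_X]
    rw [show 1 + (1 - 2 * t) = 2 * (1 - t) by ring, Real.mul_rpow zero_le_two ht.1.le,
      Real.mul_rpow zero_le_two ht1, Real.rpow_add two_pos, Real.rpow_add two_pos, Real.rpow_one]
    ring
  have c1 := coeff_comp_one_sub_two_mul P j
  have c2 := coeff_comp_one_sub_two_mul F j
  have hf : (0 : ℝ) < j.factorial := by positivity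
  have h4 : (-2 : ℝ) ^ j * (-2) ^ j = 4 ^ j := by rw [← mul_pow]; norm_num
  rw [jacobiSobolevForm, hint, mul_add, scaledMass]
  congr 1
  have h5 : ((j.factorial : ℝ) * (P.comp (1 - C 2 * X)).coeff j)
      * ((j.factorial : ℝ) * (F.comp (1 - C 2 * X)).coeff j)
      = 4 ^ j * ((derivative^[j] P).eval 1 * (derivative^[j] F).eval 1) := by
    rw [c1, c2, ← h4]
    ring
  field_simp
  linear_combination (-m) * h5

lemma natDegree_one_sub_two_mul : (1 - C 2 * X : ℝ[X]).natDegree = 1 := by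
  have : (1 - C 2 * X : ℝ[X]) = C (-2) * X + C 1 := by simp; ring
  rw [this]
  exact natDegree_linear (by norm_num)

lemma IsJacobiSobolevOP.comp {j n : ℕ} {m : ℝ} {P : ℝ[X]} (h : IsJacobiSobolevOP α β j m n P) :
    (P.comp (1 - C 2 * X)).degree = n ∧ ∀ f : ℝ[X], f.degree < (n : WithBot ℕ) →
      jacobiFunctional α β (P.comp (1 - C 2 * X) * f)
        + scaledMass α β j m * (P.comp (1 - C 2 * X)).coeff j * f.coeff j = 0 := by
  have hlin : (C (1 / 2 : ℝ) - C (1 / 2 : ℝ) * X : ℝ[X]).natDegree ≤ 1 := by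
    refine (natDegree_sub_le _ _).trans (max_le (by simp) ?_)
    exact (natDegree_C_mul_le _ _).trans natDegree_X_le
  refine ⟨?_, fun f hf => ?_⟩
  · have hP0 : P ≠ 0 := by
      rintro rfl
      have := h.1
      simp at this
    have hn : P.natDegree = n := natDegree_eq_of_degree_eq_some h.1
    have hnd : (P.comp (1 - C 2 * X)).natDegree = n := by
      rw [natDegree_comp, natDegree_one_sub_two_mul, hn, mul_one]
    have hne : P.comp (1 - C 2 * X) ≠ 0 := by
      intro h0
      have h1 : (P.comp (1 - C 2 * X)).comp (C (1 / 2 : ℝ) - C (1 / 2 : ℝ) * X) = P := by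
        rw [comp_assoc]
        have : (1 - C 2 * X : ℝ[X]).comp (C (1 / 2 : ℝ) - C (1 / 2 : ℝ) * X) = X := by
          refine Polynomial.funext fun x => ?_
          simp
          ring
        rw [this, comp_X]
      rw [h0, zero_comp] at h1
      exact hP0 h1.symm
    rw [degree_eq_natDegree hne, hnd]
  · set F := f.comp (C (1 / 2 : ℝ) - C (1 / 2 : ℝ) * X) with hF
    have hFf : F.comp (1 - C 2 * X) = f := by
      rw [hF, comp_assoc]
      have : (C (1 / 2 : ℝ) - C (1 / 2 : ℝ) * X : ℝ[X]).comp (1 - C 2 * X) = X := by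
        refine Polynomial.funext fun x => ?_
        simp
        ring
      rw [this, comp_X]
    have hFd : F.degree < (n : WithBot ℕ) := by
      by_cases hf0 : f = 0
      · rw [hF, hf0, zero_comp]
        rwa [hf0] at hf
      · have h1 : f.natDegree < n := (natDegree_lt_iff_degree_lt hf0).2 hf
        refine lt_of_le_of_lt degree_le_natDegree ?_
        have : F.natDegree < n := by
          refine lt_of_le_of_lt natDegree_comp_le ?_
          nlinarith
        exact_mod_cast this
    have h2 := h.2 F hFd
    rw [jacobiSobolevForm_eq, hFf] at h2
    exact (mul_eq_zero.1 h2).resolve_left (Real.rpow_pos_of_pos two_pos _).ne'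

end ChangeOfVariables

/-! ### The relative mass in the three regimes. -/

section Mass

variable {α β : ℝ}

lemma tendsto_coeff_jacobiKernel_self (hα : -1 < α) (hβ : -1 < β) (j : ℕ) :
    Tendsto (fun n : ℕ => (jacobiKernel α β j n).coeff j / (n : ℝ) ^ (2 * (α + 2 * j + 1))
      * ((j.factorial : ℝ) ^ 2 / (4 ^ j * (2 : ℝ) ^ (α + β + 1)))) atTop
      (𝓝 (1 / massConst α β j)) := by
  have h := (tendsto_coeff_jacobiKernel hα hβ j j).mul_const
    ((j.factorial : ℝ) ^ 2 / (4 ^ j * (2 : ℝ) ^ (α + β + 1)))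
  have hjr : (0 : ℝ) ≤ j := j.cast_nonneg
  have e : jacobiCoeffLim α j * jacobiCoeffLim α j
      / (Real.Gamma (α + 1) ^ 2 * (α + j + 1 + j))
      * ((j.factorial : ℝ) ^ 2 / (4 ^ j * (2 : ℝ) ^ (α + β + 1))) = 1 / massConst α β j := by
    have hG := Real.Gamma_pos_of_pos (by linarith : 0 < α + 1)
    have hr := risingFac_pos (by linarith : 0 < α + 1) j
    have hp := Real.rpow_pos_of_pos (two_pos : (0 : ℝ) < 2) (α + β + 1)
    have h1 : (-1 : ℝ) ^ j * (-1) ^ j = 1 := by rw [← mul_pow]; simp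
    have h2 : (2 : ℝ) ^ (α + β + 2 * j + 1) = 4 ^ j * (2 : ℝ) ^ (α + β + 1) := by
      rw [show α + β + 2 * (j : ℝ) + 1 = ((2 * j : ℕ) : ℝ) + (α + β + 1) by push_cast; ring,
        Real.rpow_add two_pos, Real.rpow_natCast, pow_mul]
      norm_num
    have hA : 0 < α + j + 1 + j := by linarith
    rw [jacobiCoeffLim_eq hα, massConst, h2, show α + (j : ℝ) + 1 = α + 1 + j by ring,
      Gamma_add_nat (by linarith : 0 < α + 1), show α + 2 * (j : ℝ) + 1 = α + j + 1 + j by ring,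
      show α + 1 + (j : ℝ) + j = α + j + 1 + j by ring]
    have h3 : (-1 : ℝ) ^ j / (risingFac (α + 1) j * j.factorial)
        * ((-1) ^ j / (risingFac (α + 1) j * j.factorial))
        = 1 / (risingFac (α + 1) j * j.factorial) ^ 2 := by
      rw [div_mul_div_comm, h1, sq]
    rw [h3]
    field_simp
  rw [e, show α + (j : ℝ) + 1 + j = α + 2 * j + 1 by ring] at h
  exact h

lemma massConst_pos (hα : -1 < α) (j : ℕ) : 0 < massConst α β j := by
  have hjr : (0 : ℝ) ≤ j := j.cast_nonneg
  have h1 := Real.Gamma_pos_of_pos (by linarith : 0 < α + j + 1)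
  have h2 := Real.rpow_pos_of_pos (two_pos : (0 : ℝ) < 2) (α + β + 2 * j + 1)
  have h3 : 0 < α + 2 * j + 1 := by linarith
  rw [massConst]
  positivity

lemma tendsto_div_one_add {u : ℕ → ℝ} {k : ℝ} (hk : 0 ≤ k) (hu : Tendsto u atTop (𝓝 k)) :
    Tendsto (fun n => u n / (1 + u n)) atTop (𝓝 (k / (1 + k))) :=
  hu.div (hu.const_add 1) (by positivity)

lemma tendsto_div_one_add_atTop {u : ℕ → ℝ} (hu : Tendsto u atTop atTop) :
    Tendsto (fun n => u n / (1 + u n)) atTop (𝓝 1) := by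
  have h : Tendsto (fun n => 1 - (1 + u n)⁻¹) atTop (𝓝 (1 - 0)) :=
    (tendsto_inv_atTop_zero.comp (tendsto_atTop_add_const_left _ 1 hu)).const_sub 1
  rw [sub_zero] at h
  refine h.congr' ?_
  filter_upwards [hu.eventually_gt_atTop 0] with n hn
  have : 1 + u n ≠ 0 := by linarith
  field_simp
  ring

/-- The limits of the relative mass in the three regimes. -/
lemma tendsto_relative_mass (hα : -1 < α) (hβ : -1 < β) {γ M : ℝ} (hM : 0 < M) (j : ℕ)
    {m : ℕ → ℝ} (hlim : Tendsto (fun n : ℕ => m n * (n : ℝ) ^ γ) atTop (𝓝 M)) :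
    (γ > 2 * (α + 2 * j + 1) → Tendsto (fun n => scaledMass α β j (m n)
      * (jacobiKernel α β j n).coeff j / (1 + scaledMass α β j (m n)
        * (jacobiKernel α β j n).coeff j)) atTop (𝓝 0)) ∧
    (γ < 2 * (α + 2 * j + 1) → Tendsto (fun n => scaledMass α β j (m n)
      * (jacobiKernel α β j n).coeff j / (1 + scaledMass α β j (m n)
        * (jacobiKernel α β j n).coeff j)) atTop (𝓝 1)) ∧
    (γ = 2 * (α + 2 * j + 1) → Tendsto (fun n => scaledMass α β j (m n)
      * (jacobiKernel α β j n).coeff j / (1 + scaledMass α β j (m n)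
        * (jacobiKernel α β j n).coeff j)) atTop (𝓝 (M / (M + massConst α β j)))) := by
  have hD := massConst_pos (β := β) hα j
  have hX := tendsto_coeff_jacobiKernel_self hα hβ j
  have hmul := hlim.mul hX
  have hk0 : 0 < M * (1 / massConst α β j) := by positivity
  -- The product of mass and kernel is a sequence tending to M/D > 0 times n^(2(α+2j+1)-γ), so the
  -- sign of this exponent separates the regimes.
  have heq : ∀ n : ℕ, 1 ≤ n → scaledMass α β j (m n) * (jacobiKernel α β j n).coeff j
      = (m n * (n : ℝ) ^ γ * ((jacobiKernel α β j n).coeff j / (n : ℝ) ^ (2 * (α + 2 * j + 1))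
      * ((j.factorial : ℝ) ^ 2 / (4 ^ j * (2 : ℝ) ^ (α + β + 1)))))
        * (n : ℝ) ^ (2 * (α + 2 * j + 1) - γ) := by
    intro n hn
    have hn0 : (0 : ℝ) < n := by exact_mod_cast hn
    have h1 := Real.rpow_pos_of_pos hn0 (2 * (α + 2 * j + 1))
    have h2 := Real.rpow_pos_of_pos hn0 γ
    rw [Real.rpow_sub hn0, scaledMass]
    field_simp
  refine ⟨fun hγ => ?_, fun hγ => ?_, fun hγ => ?_⟩
  · have h1 : Tendsto (fun n : ℕ => (n : ℝ) ^ (2 * (α + 2 * j + 1) - γ)) atTop (𝓝 0) := by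
      have := (tendsto_rpow_neg_atTop (y := γ - 2 * (α + 2 * j + 1)) (by linarith)).comp
        (tendsto_natCast_atTop_atTop (R := ℝ))
      refine this.congr fun n => ?_
      rw [Function.comp_apply, neg_sub]
    have h2 := hmul.mul h1
    rw [mul_zero] at h2
    have h3 := tendsto_div_one_add le_rfl (h2.congr' (by
      filter_upwards [eventually_ge_atTop 1] with n hn
      exact (heq n hn).symm))
    rwa [zero_div] at h3
  · have h1 : Tendsto (fun n : ℕ => (n : ℝ) ^ (2 * (α + 2 * j + 1) - γ)) atTop atTop :=
      (tendsto_rpow_atTop (by linarith)).comp tendsto_natCast_atTop_atTop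
    have h2 := hmul.pos_mul_atTop hk0 h1
    exact tendsto_div_one_add_atTop (h2.congr' (by
      filter_upwards [eventually_ge_atTop 1] with n hn
      exact (heq n hn).symm))
  · have h2 : Tendsto (fun n => scaledMass α β j (m n) * (jacobiKernel α β j n).coeff j) atTop
        (𝓝 (M * (1 / massConst α β j))) := hmul.congr' (by
      filter_upwards [eventually_ge_atTop 1] with n hn
      rw [heq n hn, hγ, sub_self, Real.rpow_zero, mul_one])
    have h3 := tendsto_div_one_add hk0.le h2
    have e : M * (1 / massConst α β j) / (1 + M * (1 / massConst α β j))
        = M / (M + massConst α β j) := by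
      have : M + massConst α β j ≠ 0 := by positivity
      field_simp
      ring
    rwa [e] at h3

end Mass

/-! ### Position of the first root relative to the origin. -/

section SignedRoots

/-- `p n` is a positive multiple of `∏ (w n k - x)`, all `w n k` except possibly `w n 1` are
positive, and the coefficients of `p n` converge dominatedly to those of an entire series `b` whose
coefficients eventually alternate and decay fast. -/
structure AlternatingLimit (p : ℕ → ℝ[X]) (w : ℕ → ℕ → ℝ) (b C : ℕ → ℝ) (l₀ : ℕ) : Prop where
  dom : DomTendsto atTop (fun n => (p n).coeff) b C
  root : ∀ᶠ n in atTop, ∃ l, 0 < l ∧ ∀ x, (p n).eval x = l * ∏ k ∈ Finset.Icc 1 n, (w n k - x)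
  mono : ∀ᶠ n in atTop, StrictMonoOn (w n) (Icc 1 n)
  pos : ∀ᶠ n in atTop, ∀ k, 1 < k → k ≤ n → 0 < w n k
  coeff_pos : ∀ l ≥ l₀, 0 < (-1) ^ l * b l
  coeff_small : ∀ ε > 0, ∃ K, ∀ l, |b l| * (l.factorial : ℝ) ≤ K * ε ^ l
  simple : ∀ x, 0 ≤ x → psum b x = 0 → psum (coeffDeriv b) x ≠ 0

variable {p : ℕ → ℝ[X]} {w : ℕ → ℕ → ℝ} {b C : ℕ → ℝ} {l₀ : ℕ}

namespace AlternatingLimit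

/-- To the left of 0 every factor but the first is positive, so the sign of a value locates the
first root relative to the point of evaluation. -/
lemma eval_eq (h : AlternatingLimit p w b C l₀) :
    ∀ᶠ n in atTop, ∀ x ≤ 0, ∃ l, 0 < l ∧ (p n).eval x = l * (w n 1 - x) := by
  filter_upwards [h.root, h.pos, eventually_ge_atTop 1] with n ⟨l, hl, he⟩ hp hn x hx
  refine ⟨l * ∏ k ∈ Finset.Icc 2 n, (w n k - x),
    mul_pos hl (Finset.prod_pos fun k hk => ?_), ?_⟩
  · have hk' := Finset.mem_Icc.1 hk
    have := hp k (by omega) hk'.2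
    linarith
  · rw [he, ← Finset.insert_Icc_add_one_left_eq_Icc hn, Finset.prod_insert (by simp),
      mul_comm (w n 1 - x), mul_assoc]
    rfl

lemma tendsto_eval (h : AlternatingLimit p w b C l₀) (x : ℝ) :
    Tendsto (fun n => (p n).eval x) atTop (𝓝 (psum b x)) := by
  simpa only [psum_polynomial] using h.dom.tendsto_psum (tendsto_const_nhds (x := x))

lemma lt_first (h : AlternatingLimit p w b C l₀) {x : ℝ} (hx : x ≤ 0) (hpos : 0 < psum b x) :
    ∀ᶠ n in atTop, x < w n 1 := by
  filter_upwards [h.eval_eq, (h.tendsto_eval x).eventually (lt_mem_nhds hpos)] with n hn h0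
  obtain ⟨l, hl, he⟩ := hn x hx
  rw [he] at h0
  have := pos_of_mul_pos_right h0 hl.le
  linarith

lemma first_lt (h : AlternatingLimit p w b C l₀) {x : ℝ} (hx : x ≤ 0) (hneg : psum b x < 0) :
    ∀ᶠ n in atTop, w n 1 < x := by
  filter_upwards [h.eval_eq, (h.tendsto_eval x).eventually (gt_mem_nhds hneg)] with n hn h0
  obtain ⟨l, hl, he⟩ := hn x hx
  rw [he] at h0
  have := neg_of_mul_neg_right h0 hl.le
  linarith

lemma exists_lower (h : AlternatingLimit p w b C l₀) : ∃ B, ∀ᶠ n in atTop, -B ≤ w n 1 := by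
  obtain ⟨v, hv, hv0⟩ := ((psum_neg_ge h.dom.entire h.coeff_pos 0 1).and
    (eventually_ge_atTop 0)).exists
  rw [pow_zero, mul_one] at hv
  exact ⟨v, (h.lt_first (by linarith) (by linarith)).mono fun _ hn => hn.le⟩

lemma first_pos (h : AlternatingLimit p w b C l₀) (h0 : 0 < b 0) : ∀ᶠ n in atTop, 0 < w n 1 :=
  h.lt_first le_rfl (by rwa [psum_zero])

lemma first_neg (h : AlternatingLimit p w b C l₀) (h0 : b 0 < 0) : ∀ᶠ n in atTop, w n 1 < 0 :=
  h.first_lt le_rfl (by rwa [psum_zero])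

lemma exists_nthPosZero_of_pos (h : AlternatingLimit p w b C l₀) (h0 : 0 < b 0) (i : ℕ)
    (hi : 1 ≤ i) : ∃ z, IsNthPosZero (psum b) i z ∧ Tendsto (fun n => w n i) atTop (𝓝 z) := by
  have hf := h.first_pos h0
  have hR : RootFamily p w b C l₀ 0 0 :=
    { dom := h.dom
      root := h.root
      mono := h.mono
      coeff_pos := h.coeff_pos
      coeff_small := h.coeff_small
      lower := hf.mono fun n hn => by rw [neg_zero]; exact hn.le
      le_one := Nat.zero_le 1
      root_pos := by
        filter_upwards [hf, h.pos] with n h1 h2 k hk hkn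
        rcases Nat.lt_or_ge 1 k with hk1 | hk1
        · exact h2 k hk1 hkn
        · rwa [show k = 1 by omega]
      upper := fun h => absurd h zero_ne_one
      zero := fun h => absurd h h0.ne'
      simple := h.simple }
  exact hR.exists_nthPosZero i hi

lemma exists_nthPosZero_of_neg (h : AlternatingLimit p w b C l₀) (h0 : b 0 < 0) (i : ℕ)
    (hi : 1 ≤ i) :
    ∃ z, IsNthPosZero (psum b) i z ∧ Tendsto (fun n => w n (i + 1)) atTop (𝓝 z) := by
  obtain ⟨B, hB⟩ := h.exists_lower
  have hR : RootFamily p w b C l₀ B 1 :=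
    { dom := h.dom
      root := h.root
      mono := h.mono
      coeff_pos := h.coeff_pos
      coeff_small := h.coeff_small
      lower := hB
      le_one := le_rfl
      root_pos := h.pos
      upper := fun _ ε hε => (h.first_neg h0).mono fun n hn => hn.trans hε
      zero := fun h => absurd h h0.ne
      simple := h.simple }
  exact hR.exists_nthPosZero i hi

/-- When alternation starts at index 1 and b_0 = 0, the limit is positive on the negative axis,
which bounds the first root from below. The simple zero at 0 supplies a root below every ε > 0. -/
lemma tendsto_first (h : AlternatingLimit p w b C 1) (h0 : b 0 = 0) :
    Tendsto (fun n => w n 1) atTop (𝓝 0) := by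
  refine tendsto_order.2 ⟨fun x hx => ?_, fun ε hε => ?_⟩
  · refine h.lt_first hx.le ?_
    have hterm : ∀ l, b l * x ^ l = (-1) ^ l * b l * (-x) ^ l := fun l => by
      rw [mul_right_comm, ← mul_pow, neg_one_mul, neg_neg, mul_comm]
    refine (h.dom.entire.summable x).tsum_pos (fun l => ?_) 1 ?_
    · rcases Nat.eq_zero_or_pos l with rfl | hl
      · rw [h0, zero_mul]
      · rw [hterm]
        exact mul_nonneg (h.coeff_pos l hl).le (pow_nonneg (by linarith) l)
    · rw [hterm]
      exact mul_pos (h.coeff_pos 1 le_rfl) (pow_pos (by linarith) 1)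
  · have hz : psum b 0 = 0 := by rw [psum_zero, h0]
    filter_upwards [exists_root_near h.dom hε hz (h.simple 0 le_rfl hz), h.root, h.mono]
      with n ⟨x, hx, hx0⟩ ⟨l, hl, he⟩ hmono
    rw [he, mul_eq_zero, or_iff_right hl.ne', Finset.prod_eq_zero_iff] at hx0
    obtain ⟨k, hk, hk0⟩ := hx0
    have hk' := Finset.mem_Icc.1 hk
    have := hmono.monotoneOn (mem_Icc.2 ⟨le_rfl, hk'.1.trans hk'.2⟩) (mem_Icc.2 hk') hk'.1
    have := hx.2
    linarith

lemma exists_nthPosZero_of_eq_zero (h : AlternatingLimit p w b C 1) (h0 : b 0 = 0) (i : ℕ)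
    (hi : 1 ≤ i) :
    ∃ z, IsNthPosZero (psum b) i z ∧ Tendsto (fun n => w n (i + 1)) atTop (𝓝 z) := by
  obtain ⟨B, hB⟩ := h.exists_lower
  have ht := h.tendsto_first h0
  have hR : RootFamily p w b C 1 B 1 :=
    { dom := h.dom
      root := h.root
      mono := h.mono
      coeff_pos := h.coeff_pos
      coeff_small := h.coeff_small
      lower := hB
      le_one := le_rfl
      root_pos := h.pos
      upper := fun _ ε hε => ht.eventually (gt_mem_nhds hε)
      zero := fun _ => ⟨rfl, ht⟩
      simple := h.simple }
  exact hR.exists_nthPosZero i hi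

end AlternatingLimit

end SignedRoots

/-! ### Return to the original variables and assembly of the cases. -/

lemma IsNthPosZero.sqrt {f g : ℝ → ℝ} (hfg : ∀ x, 0 < x → (f x = 0 ↔ g (x ^ 2) = 0)) {i : ℕ}
    {z : ℝ} (h : IsNthPosZero g i z) : IsNthPosZero f i √z := by
  obtain ⟨hz, hgz, hcard⟩ := h
  have hsz := Real.sqrt_pos.2 hz
  refine ⟨hsz, (hfg _ hsz).2 (by rwa [Real.sq_sqrt hz.le]), ?_⟩
  have himg : {s : ℝ | 0 < s ∧ s ≤ √z ∧ f s = 0}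
      = Real.sqrt '' {s : ℝ | 0 < s ∧ s ≤ z ∧ g s = 0} := by
    ext s
    constructor
    · rintro ⟨hs, hsz, hfs⟩
      exact ⟨s ^ 2, ⟨by positivity, (Real.le_sqrt' hs).1 hsz, (hfg s hs).1 hfs⟩,
        Real.sqrt_sq hs.le⟩
    · rintro ⟨r, ⟨hr, hrz, hgr⟩, rfl⟩
      have hsr := Real.sqrt_pos.2 hr
      exact ⟨hsr, Real.sqrt_le_sqrt hrz, (hfg _ hsr).2 (by rwa [Real.sq_sqrt hr.le])⟩
  rw [himg, InjOn.encard_image, hcard]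
  intro x hx y hy hxy
  exact (Real.sqrt_inj hx.1.le hy.1.le).1 hxy

section Limit

variable {α β : ℝ}

lemma besselCoeff_sign (hα : -1 < α) (i : ℕ) : 0 < (-1) ^ i * besselCoeff α i := by
  have h1 := risingFac_pos (by linarith : 0 < α + 1) i
  rw [besselCoeff, jacobiCoeffLim_eq hα, ← mul_div_assoc, ← mul_div_assoc, ← mul_pow]
  norm_num
  positivity

lemma limitSeries_zero (j : ℕ) (c : ℝ) :
    limitSeries α j c 0 = 1 - c * (α + 2 * j + 1) / (α + j + 1) := by
  rw [limitSeries, besselCoeff_zero, one_mul, Nat.cast_zero, add_zero, mul_div_assoc]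

lemma limitSeries_sign (hα : -1 < α) {j i : ℕ} {c : ℝ} (h : c * (α + 2 * j + 1) < α + j + 1 + i) :
    0 < (-1) ^ i * limitSeries α j c i := by
  have hi := i.cast_nonneg (α := ℝ)
  have hj := j.cast_nonneg (α := ℝ)
  have hA : 0 < α + j + 1 + i := by linarith
  rw [limitSeries, ← mul_assoc, ← mul_div_assoc]
  exact mul_pos (besselCoeff_sign hα i) (sub_pos.2 ((div_lt_one hA).2 h))

/-- The scaled zeros of the orthogonal polynomials form an alternating family. -/
lemma alternatingLimit_scaledPoly (hα : -1 < α) (hβ : -1 < β) {j : ℕ} (hj : 1 ≤ j) {μ : ℕ → ℝ}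
    {c : ℝ} (hc : Tendsto (fun n => μ n * (jacobiKernel α β j n).coeff j
      / (1 + μ n * (jacobiKernel α β j n).coeff j)) atTop (𝓝 c))
    {t : ℕ → ℕ → ℝ} (hmono : ∀ n, StrictMonoOn (t n) (Icc 1 n))
    (hpos : ∀ n k, 1 < k → k ≤ n → 0 < t n k)
    (hroot : ∀ n, j < n → ∃ l, 0 < l ∧ ∀ x, (scaledPoly α β j (μ n) n).eval x
      = l * ∏ k ∈ Finset.Icc 1 n, (4 * (n : ℝ) ^ 2 * t n k - x))
    {l₀ : ℕ} (hl₀ : ∀ l : ℕ, l₀ ≤ l → c * (α + 2 * j + 1) < α + j + 1 + l) :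
    ∃ C, AlternatingLimit (fun n => scaledPoly α β j (μ n) n) (fun n k => 4 * (n : ℝ) ^ 2 * t n k)
      (limitSeries α j c) C l₀ := by
  obtain ⟨K, hK⟩ := domTendsto_scaledPoly hα hβ hj hc
  have h4 : ∀ n : ℕ, 1 ≤ n → (0 : ℝ) < 4 * (n : ℝ) ^ 2 := fun n hn => by
    have : (0 : ℝ) < n := by exact_mod_cast hn
    positivity
  refine ⟨_, hK, (eventually_gt_atTop j).mono hroot, ?_, ?_,
    fun l hl => limitSeries_sign hα (hl₀ l hl), fun ε hε => ?_,
    fun x hx h0 => limitSeries_simple hα hj c hx h0⟩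
  · filter_upwards [eventually_ge_atTop 1] with n hn x hx y hy hxy
    exact mul_lt_mul_of_pos_left (hmono n hx hy hxy) (h4 n hn)
  · filter_upwards [eventually_ge_atTop 1] with n hn k hk hkn
    exact mul_pos (h4 n hn) (hpos n k hk hkn)
  · obtain ⟨K', hK'⟩ := jacobiBound_mul_factorial_le (β := β) hα hε
    refine ⟨|K| * K', fun l => ?_⟩
    calc |limitSeries α j c l| * (l.factorial : ℝ)
        ≤ |K| * jacobiBound α β l * (l.factorial : ℝ) := by
          refine mul_le_mul_of_nonneg_right ((hK.abs_le l).trans ?_) (by positivity)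
          exact mul_le_mul_of_nonneg_right (le_abs_self K) (jacobiBound_nonneg hα l)
      _ = |K| * (jacobiBound α β l * (l.factorial : ℝ)) := by ring
      _ ≤ |K| * (K' * ε ^ l) := mul_le_mul_of_nonneg_left (hK' l) (abs_nonneg K)
      _ = |K| * K' * ε ^ l := by ring

lemma besselJ_eq_zero_iff (hα : -1 < α) (j : ℕ) {x : ℝ} (hx : 0 < x) :
    besselJ α x = 0 ↔ psum (limitSeries α j 0) (x ^ 2) = 0 := by
  have hG := Real.Gamma_pos_of_pos (by linarith : 0 < α + 1)
  have h1 : (0 : ℝ) < (x / 2) ^ α := Real.rpow_pos_of_pos (by positivity) α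
  have h2 : limitSeries α j 0 = besselCoeff α := funext fun i => by simp [limitSeries]
  rw [besselJ_eq hα hx, h2, mul_eq_zero, or_iff_right (by positivity)]

lemma besselCombination_eq_zero_iff (hα : -1 < α) (j : ℕ) (c : ℝ) {θ : ℕ → ℝ}
    (hθ : ∀ i : ℕ, θ i = 1 - c * (α + 2 * j + 1) / (α + j + 1 + i)) {x : ℝ} (hx : 0 < x) :
    besselCombination α j θ x = 0 ↔ psum (limitSeries α j c) (x ^ 2) = 0 := by
  have hG := Real.Gamma_pos_of_pos (by linarith : 0 < α + 1)
  rw [funext hθ, besselCombination_eq hα j c hx, div_eq_zero_iff, or_iff_left hG.ne']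

lemma varphiFun_eq_zero_iff (hα : -1 < α) (j : ℕ) {x : ℝ} (hx : 0 < x) :
    varphiFun α j x = 0 ↔ psum (limitSeries α j 1) (x ^ 2) = 0 := by
  refine besselCombination_eq_zero_iff hα j 1 (fun i => ?_) hx
  have hi := i.cast_nonneg (α := ℝ)
  have hj := j.cast_nonneg (α := ℝ)
  have hA : α + j + 1 + i ≠ 0 := by linarith
  rw [show α + j + i + 1 = α + j + 1 + i by ring]
  field_simp
  ring

lemma psiFun_eq_zero_iff (hα : -1 < α) (j : ℕ) {M : ℝ} (hM : 0 < M) {x : ℝ} (hx : 0 < x) :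
    psiFun α β j M x = 0
      ↔ psum (limitSeries α j (M / (M + massConst α β j))) (x ^ 2) = 0 := by
  refine besselCombination_eq_zero_iff hα j _ (fun i => ?_) hx
  have hi := i.cast_nonneg (α := ℝ)
  have hj := j.cast_nonneg (α := ℝ)
  have hA : α + j + 1 + i ≠ 0 := by linarith
  have hD := massConst_pos (β := β) hα j
  have hMD : M + massConst α β j ≠ 0 := by positivity
  rw [show α + j + i + 1 = α + j + 1 + i by ring]
  field_simp
  ring

/-- The zeros of an orthogonal polynomial of the Sobolev form, and the factorization of the
associated scaled polynomial. -/
lemma IsJacobiSobolevOP.exists_zeros (hα : -1 < α) (hβ : -1 < β) {j n : ℕ} (hj : 1 ≤ j) {m : ℝ}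
    (hm : 0 ≤ m) {P : ℝ[X]} (h : IsJacobiSobolevOP α β j m n P) :
    ∃ t : ℕ → ℝ, StrictMonoOn t (Icc 1 n) ∧ (∀ k, 1 < k → k ≤ n → 0 < t k) ∧
      IsZeroList P n (fun k => 1 - 2 * t k) ∧
      (j < n → ∃ l, 0 < l ∧ ∀ x, (scaledPoly α β j (scaledMass α β j m) n).eval x
        = l * ∏ k ∈ Finset.Icc 1 n, (4 * (n : ℝ) ^ 2 * t k - x)) := by
  obtain ⟨hdeg, horth⟩ := h.comp
  obtain ⟨t, hmono, hpos, l, hl, he⟩ := exists_roots_of_orthogonal hα hβ hj hdeg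
    (fun f hf hfj => by simpa [hfj] using horth f hf)
  refine ⟨t, hmono, hpos, ⟨fun x hx y hy hxy => ?_, fun x => ?_⟩, fun hn => ?_⟩
  · have := hmono hx hy hxy
    linarith
  · have hx : P.eval x = (P.comp (1 - C 2 * X)).eval ((1 - x) / 2) := by
      rw [eval_comp]
      congr 1
      simp
      ring
    rw [IsRoot.def, hx, he, mul_eq_zero, or_iff_right hl, Finset.prod_eq_zero_iff]
    refine exists_congr fun k => ?_
    rw [← Finset.mem_coe, Finset.coe_Icc]
    exact and_congr_right fun _ => ⟨fun h => by linarith, fun h => by linarith⟩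
  · obtain ⟨a, ha, hq⟩ := eq_jacobiPoly_sub_jacobiKernel hα hβ (scaledMass_nonneg hm) hdeg horth
    have hn0 : (0 : ℝ) < n := by exact_mod_cast (Nat.zero_le j).trans_lt hn
    have hN : (0 : ℝ) < 4 * (n : ℝ) ^ 2 := by positivity
    set N : ℝ := 4 * (n : ℝ) ^ 2 with hNdef
    set p := scaledPoly α β j (scaledMass α β j m) n with hp
    have hev : ∀ x, p.eval x = l / a / N ^ n * ∏ k ∈ Finset.Icc 1 n, (N * t k - x) := by
      intro x
      have h1 : a * p.eval x = l * ∏ k ∈ Finset.Icc 1 n, (t k - x / N) := by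
        have hx : (C (1 / (4 * (n : ℝ) ^ 2)) * X : ℝ[X]).eval x = x / N := by
          rw [eval_C_mul, eval_X, one_div_mul_eq_div]
        rw [← he, hq, hp, scaledPoly, eval_comp, hx, eval_C_mul]
      have h2 : ∏ k ∈ Finset.Icc 1 n, (N * t k - x)
          = N ^ n * ∏ k ∈ Finset.Icc 1 n, (t k - x / N) := by
        have hcard : N ^ n = ∏ _k ∈ Finset.Icc 1 n, N := by
          rw [Finset.prod_const, Nat.card_Icc, Nat.add_sub_cancel]
        rw [hcard, ← Finset.prod_mul_distrib]
        refine Finset.prod_congr rfl fun k _ => ?_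
        field_simp
      have hNn : N ^ n ≠ 0 := (pow_pos hN n).ne'
      rw [h2, ← mul_assoc, div_mul_cancel₀ _ hNn, div_mul_eq_mul_div, ← h1,
        mul_div_cancel_left₀ _ ha]
    refine ⟨_, ?_, hev⟩
    -- The kernel has degree below n, so the leading coefficient is that of the scaled Jacobi
    -- polynomial, of sign (-1)^n; hence the constant in front of the product is positive.
    have hc := coeff_of_eval_eq_prod hev
    rw [coeff_scaledPoly hα hβ hj hn, kernelCoeff,
      coeff_eq_zero_of_degree_lt (degree_jacobiKernel_lt j n), zero_div, zero_div, mul_zero,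
      sub_zero] at hc
    have hs := div_pos (jacobiCoeff_sign hα hβ (by omega : 1 ≤ n) le_rfl) (pow_pos hN n)
    rw [mul_div_assoc, hc, mul_comm, mul_assoc, ← mul_pow] at hs
    simpa using hs

lemma nat_mul_sqrt_eq (n : ℕ) (t : ℝ) :
    (n : ℝ) * √(2 * (1 - (1 - 2 * t))) = √(4 * (n : ℝ) ^ 2 * t) := by
  rw [show 4 * (n : ℝ) ^ 2 * t = (n : ℝ) ^ 2 * (2 * (1 - (1 - 2 * t))) by ring,
    Real.sqrt_mul (sq_nonneg (n : ℝ)), Real.sqrt_sq n.cast_nonneg]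

lemma tendsto_one_sub {t : ℕ → ℝ} {B B' : ℝ} (h1 : ∀ᶠ n : ℕ in atTop, -B ≤ 4 * (n : ℝ) ^ 2 * t n)
    (h2 : ∀ᶠ n : ℕ in atTop, 4 * (n : ℝ) ^ 2 * t n ≤ B') :
    Tendsto (fun n => 1 - 2 * t n) atTop (𝓝 1) := by
  have hinf : Tendsto (fun n : ℕ => 4 * (n : ℝ) ^ 2) atTop atTop :=
    ((tendsto_pow_atTop two_ne_zero).comp tendsto_natCast_atTop_atTop).const_mul_atTop
      (by norm_num)
  have ht : Tendsto t atTop (𝓝 0) := by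
    refine tendsto_of_tendsto_of_tendsto_of_le_of_le' (tendsto_const_nhds.div_atTop hinf)
      (tendsto_const_nhds.div_atTop hinf) (g := fun n : ℕ => -B / (4 * (n : ℝ) ^ 2))
      (h := fun n : ℕ => B' / (4 * (n : ℝ) ^ 2)) ?_ ?_
    · filter_upwards [h1, hinf.eventually_gt_atTop 0] with n hn hpos
      rw [div_le_iff₀ hpos]
      linarith
    · filter_upwards [h2, hinf.eventually_gt_atTop 0] with n hn hpos
      rw [le_div_iff₀ hpos]
      linarith
  simpa using (ht.const_mul 2).const_sub 1

end Limit

end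

theorem proposition4 (α β γ M : ℝ) (hα : -1 < α) (hβ : -1 < β) (hM : 0 < M)
    (j : ℕ) (hj : 0 < j)
    (m : ℕ → ℝ) (hm : ∀ n, 0 ≤ m n)
    (hlim : Tendsto (fun n : ℕ => m n * (n : ℝ) ^ γ) atTop (𝓝 M))
    (Q : ℕ → ℝ[X]) (hQ : ∀ n, IsJacobiSobolevOP α β j (m n) n (Q n)) :
    ∃ y : ℕ → ℕ → ℝ, (∀ n, IsZeroList (Q n) n (y n)) ∧
      (γ > 2 * (α + 2 * j + 1) →
        ∀ i ≥ 1, ∃ z, IsNthPosZero (besselJ α) i z ∧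
          Tendsto (fun n : ℕ => (n : ℝ) * √(2 * (1 - y n i))) atTop (𝓝 z)) ∧
      (γ < 2 * (α + 2 * j + 1) →
        Tendsto (fun n : ℕ => y n 1) atTop (𝓝 1) ∧
        ∀ i ≥ 2, ∃ s, IsNthPosZero (varphiFun α j) (i - 1) s ∧
          Tendsto (fun n : ℕ => (n : ℝ) * √(2 * (1 - y n i))) atTop (𝓝 s)) ∧
      (γ = 2 * (α + 2 * j + 1) →
        (M < massThreshold α β j →
          (∀ᶠ n : ℕ in atTop, y n 1 ≤ 1) ∧
          ∀ i ≥ 1, ∃ t, IsNthPosZero (psiFun α β j M) i t ∧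
            Tendsto (fun n : ℕ => (n : ℝ) * √(2 * (1 - y n i))) atTop (𝓝 t)) ∧
        (M = massThreshold α β j →
          Tendsto (fun n : ℕ => (n : ℝ) * √(2 * |1 - y n 1|)) atTop (𝓝 0) ∧
          ∀ i ≥ 2, ∃ t, IsNthPosZero (psiFun α β j M) (i - 1) t ∧
            Tendsto (fun n : ℕ => (n : ℝ) * √(2 * (1 - y n i))) atTop (𝓝 t)) ∧
        (M > massThreshold α β j →
          Tendsto (fun n : ℕ => y n 1) atTop (𝓝 1) ∧
          ∀ i ≥ 2, ∃ t, IsNthPosZero (psiFun α β j M) (i - 1) t ∧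
            Tendsto (fun n : ℕ => (n : ℝ) * √(2 * (1 - y n i))) atTop (𝓝 t))) := by
  choose t hmono hpos hlist hroot using fun n => (hQ n).exists_zeros hα hβ hj (hm n)
  have hj0 : (0 : ℝ) < j := by exact_mod_cast hj
  have hA : 0 < α + j + 1 := by linarith
  have hA2 : 0 < α + 2 * j + 1 := by linarith
  have hD := massConst_pos (β := β) hα j
  obtain ⟨hc₀, hc₁, hc₂⟩ := tendsto_relative_mass hα hβ hM j hlim
  have hl₀ : ∀ c : ℝ, c ≤ 1 → ∀ l : ℕ, j + 1 ≤ l → c * (α + 2 * j + 1) < α + j + 1 + l := by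
    intro c hc l hl
    have : (j : ℝ) + 1 ≤ l := by exact_mod_cast hl
    nlinarith
  have hsqrt : ∀ {f : ℝ → ℝ} {c : ℝ} {i k : ℕ},
      (∀ x, 0 < x → (f x = 0 ↔ psum (limitSeries α j c) (x ^ 2) = 0)) →
      (∃ z, IsNthPosZero (psum (limitSeries α j c)) k z ∧
        Tendsto (fun n : ℕ => 4 * (n : ℝ) ^ 2 * t n i) atTop (𝓝 z)) →
      ∃ z, IsNthPosZero f k z ∧
        Tendsto (fun n : ℕ => (n : ℝ) * √(2 * (1 - (1 - 2 * t n i)))) atTop (𝓝 z) := by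
    rintro f c i k hf ⟨z, hz, hlim⟩
    refine ⟨√z, hz.sqrt hf, ?_⟩
    simp only [nat_mul_sqrt_eq]
    exact (Real.continuous_sqrt.tendsto z).comp hlim
  have hthr : massThreshold α β j * j = massConst α β j * (α + j + 1) := by
    rw [massThreshold, massConst, div_mul_cancel₀ _ hj0.ne']
    ring
  -- The threshold V is the mass at which the limit function vanishes at 0, since V·j = D·(α+j+1).
  have hval : limitSeries α j (M / (M + massConst α β j)) 0
      = (massThreshold α β j - M) * j / ((M + massConst α β j) * (α + j + 1)) := by
    rw [limitSeries_zero, sub_mul, hthr]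
    have : M + massConst α β j ≠ 0 := by positivity
    field_simp
    ring
  have hcM : M / (M + massConst α β j) ≤ 1 := (div_le_one (by positivity)).2 (by linarith)
  refine ⟨fun n k => 1 - 2 * t n k, hlist, fun hγ i hi => ?_, fun hγ => ?_, fun hγ => ⟨fun hMV => ?_,
    fun hMV => ?_, fun hMV => ?_⟩⟩
  · obtain ⟨C, hC⟩ := alternatingLimit_scaledPoly hα hβ hj (hc₀ hγ) hmono hpos hroot
      (hl₀ 0 zero_le_one)
    exact hsqrt (fun x hx => besselJ_eq_zero_iff hα j hx)
      (hC.exists_nthPosZero_of_pos (by rw [limitSeries_zero]; norm_num) i hi)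
  · obtain ⟨C, hC⟩ := alternatingLimit_scaledPoly hα hβ hj (hc₁ hγ) hmono hpos hroot
      (hl₀ 1 le_rfl)
    have h0 : limitSeries α j 1 0 < 0 := by
      rw [limitSeries_zero, sub_neg, one_mul, one_lt_div hA]
      linarith
    obtain ⟨B, hB⟩ := hC.exists_lower
    refine ⟨tendsto_one_sub hB ((hC.first_neg h0).mono fun n hn => hn.le), fun i hi => ?_⟩
    obtain ⟨k, rfl⟩ : ∃ k, i = k + 1 := ⟨i - 1, by omega⟩
    exact hsqrt (fun x hx => varphiFun_eq_zero_iff hα j hx)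
      (hC.exists_nthPosZero_of_neg h0 k (by omega))
  · obtain ⟨C, hC⟩ := alternatingLimit_scaledPoly hα hβ hj (hc₂ hγ) hmono hpos hroot
      (hl₀ _ hcM)
    have h0 : 0 < limitSeries α j (M / (M + massConst α β j)) 0 := by
      rw [hval]
      have := sub_pos.2 hMV
      positivity
    refine ⟨?_, fun i hi => hsqrt (fun x hx => psiFun_eq_zero_iff hα j hM hx)
      (hC.exists_nthPosZero_of_pos h0 i hi)⟩
    filter_upwards [hC.first_pos h0] with n hn
    have := pos_of_mul_pos_right hn (by positivity)
    linarith
  · have h0 : limitSeries α j (M / (M + massConst α β j)) 0 = 0 := by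
      rw [hval, hMV, sub_self, zero_mul, zero_div]
    -- At M = V the vanishing at 0 says c(α+2j+1) = α+j+1, so alternation begins at index 1, as
    -- `tendsto_first` requires.
    obtain ⟨C, hC⟩ := alternatingLimit_scaledPoly hα hβ hj (hc₂ hγ) hmono hpos hroot (l₀ := 1) (by
      intro l hl
      have : (1 : ℝ) ≤ l := by exact_mod_cast hl
      rw [limitSeries_zero, sub_eq_zero, eq_comm, div_eq_one_iff_eq hA.ne'] at h0
      linarith)
    refine ⟨?_, fun i hi => ?_⟩
    · have h1 := (hC.tendsto_first h0).abs
      rw [abs_zero] at h1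
      have h2 := (Real.continuous_sqrt.tendsto 0).comp h1
      rw [Real.sqrt_zero] at h2
      refine h2.congr fun n => ?_
      rw [Function.comp_apply, sub_sub_cancel, abs_mul,
        abs_of_nonneg (by positivity : (0 : ℝ) ≤ 4 * (n : ℝ) ^ 2), ← nat_mul_sqrt_eq,
        sub_sub_cancel, abs_mul, abs_two]
    · obtain ⟨k, rfl⟩ : ∃ k, i = k + 1 := ⟨i - 1, by omega⟩
      exact hsqrt (fun x hx => psiFun_eq_zero_iff hα j hM hx)
        (hC.exists_nthPosZero_of_eq_zero h0 k (by omega))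
  · obtain ⟨C, hC⟩ := alternatingLimit_scaledPoly hα hβ hj (hc₂ hγ) hmono hpos hroot
      (hl₀ _ hcM)
    have h0 : limitSeries α j (M / (M + massConst α β j)) 0 < 0 := by
      rw [hval]
      exact div_neg_of_neg_of_pos (mul_neg_of_neg_of_pos (sub_neg.2 hMV) hj0) (by positivity)
    obtain ⟨B, hB⟩ := hC.exists_lower
    refine ⟨tendsto_one_sub hB ((hC.first_neg h0).mono fun n hn => hn.le), fun i hi => ?_⟩
    obtain ⟨k, rfl⟩ : ∃ k, i = k + 1 := ⟨i - 1, by omega⟩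
    exact hsqrt (fun x hx => psiFun_eq_zero_iff hα j hM hx)
      (hC.exists_nthPosZero_of_neg h0 k (by omega))
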